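/- Let $P \ge 1$, $g \ge 0$ and $L \ge 0$ be fixed integers. A \emph{BSP schedule} of a finite DAG $G=(V,E)$ on $P$ processors consists of a number $S$ of supersteps, assignments $\pi : V \to [P]$ and $\tau : V \to [S]$, and a set $\Gamma \subseteq V \times [P] \times [P] \times [S]$, where $(v,p_1,p_2,s) \in \Gamma$ means that the output of $v$ is sent from $p_1$ to $p_2$ in the communication phase of superstep $s$. In the base model DS (direct transfer, singlecast) it is \emph{valid} if (i) for every $(u,v) \in E$: if $\pi(u)=\pi(v)$ then $\tau(u) \le \tau(v)$, and if $\pi(u) \ne \pi(v)$ then $(u,\pi(u),\pi(v),s) \in \Gamma$ for some $s < \tau(v)$; (ii) every $(v,p_1,p_2,s) \in \Gamma$ satisfies $p_1 = \pi(v)$ and $\tau(v) \le s$. Its cost is $$C = \sum_{s=1}^{S} \Big( \max_{p} \big|\{v : \pi(v)=p,\ \tau(v)=s\}\big| + g \cdot \max_{p} \max\big(C_{sent}^{(s,p)}, C_{rec}^{(s,p)}\big) + L \Big),$$ where $C_{sent}^{(s,p)}$ and $C_{rec}^{(s,p)}$ are the numbers of elements of $\Gamma$ of the form $(v,p,p',s)$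 and $(v,p',p,s)$, respectively. In the broadcast models DB and FB, $C_{sent}^{(s,p)}$ is instead the number of $v \in V$ such that $(v,p,p',s) \in \Gamma$ for some $p'$. In the models FS and FB with free data movement, say that $v$ is present on $p$ at $s$ if $\pi(v)=p$ and $\tau(v) \le s$, or if $(v,p',p,s') \in \Gamma$ for some $p'$ and some $s'<s$; then (i) is replaced by: for every $(u,v) \in E$, $u$ is present on $\pi(v)$ at $\tau(v)$; and (ii) is replaced by: for every $(v,p_1,p_2,s) \in \Gamma$, $v$ is present on $p_1$ at $s$. The \emph{BSP scheduling problem} asks, given $G$ (by the list of its nodes and edges), for a valid BSP schedule of minimal cost, where $S$ can be chosen freely; $P$, $g$, $L$ are constants and not part of the input. A \emph{chain DAG} is a DAG in which every node has indegree at most $1$ and outdegree at most $1$. A \emph{connected chain DAG} is a DAG obtained from a chain DAG by adding a new source node $v_0$ and an edge from $v_0$ to the first node of every chain. \textbf{Theorem.} For all fixed $P \ge 1$, $g$, $L$, and in each of the four communication models DS, DB, FS, FB, the BSP scheduling problem restricted to chain DAGs can be solved in time polynomial in the number $n=|V|$ of nodes, and so can the BSP scheduling problem restricted to connected chain DAGs.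 (Time is counted on a random access machine with natural-number entries whose unit-time operations are constants, direct and indirect access, addition, truncated subtraction and tests for zero.) -/

import Mathlib

namespace BSP

/-! ### Classes of directed acyclic graphs -/

/-- A directed graph is a DAG if no node is reachable from itself along a nonempty path. -/
def IsDAG {V : Type*} (G : Digraph V) : Prop :=
  ∀ v, ¬ Relation.TransGen G.Adj v v

/-- A chain DAG: a DAG in which every indegree and every outdegree is at most `1`. -/
def IsChainDAG {V : Type*} (G : Digraph V) : Prop :=
  IsDAG G ∧ (∀ v, {u | G.Adj u v}.encard ≤ 1) ∧ (∀ u, {v | G.Adj u v}.encard ≤ 1)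

/-- The digraph obtained from `G` by deleting the node `v₀`. -/
def deleteNode {V : Type*} (G : Digraph V) (v₀ : V) : Digraph {v : V // v ≠ v₀} where
  Adj u v := G.Adj u v

/-- A connected chain DAG: it consists of a chain DAG together with one extra source node `v₀`
whose out-neighbours are exactly the first nodes of the chains, i.e. the nodes that have no
predecessor within the chain DAG. -/
def IsConnectedChainDAG {V : Type*} (G : Digraph V) : Prop :=
  ∃ v₀ : V, IsChainDAG (deleteNode G v₀) ∧ (∀ u, ¬ G.Adj u v₀) ∧
    ∀ v : {v : V // v ≠ v₀}, G.Adj v₀ v ↔ ∀ u, ¬ (deleteNode G v₀).Adj u v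

/-! ### BSP schedules -/

/-- The four communication models: direct transfer (`D`) or free data movement (`F`), combined
with singlecast (`S`) or broadcast (`B`). The base model is `DS`. -/
inductive CommModel
  | DS
  | DB
  | FS
  | FB

/-- A BSP schedule (not necessarily valid) of the node set `V` on `P` processors: the number `S`
of supersteps, the assignments `π` of nodes to processors and `τ` of nodes to supersteps, and the
set `Γ` of communication steps; `(v, p₁, p₂, s) ∈ Γ` says that the output of `v` is sent from `p₁`
to `p₂` in the communication phase of superstep `s`. Processors and supersteps are numbered
from `0`. -/
structure Schedule (V : Type*) (P : ℕ) where
  S : ℕ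
  π : V → Fin P
  τ : V → Fin S
  Γ : Finset (V × Fin P × Fin P × Fin S)

namespace Schedule

variable {V : Type*} {P : ℕ}

/-- Validity under direct data transfer. -/
def ValidDirect (G : Digraph V) (σ : Schedule V P) : Prop :=
  (∀ u v, G.Adj u v →
    (σ.π u = σ.π v → σ.τ u ≤ σ.τ v) ∧
    (σ.π u ≠ σ.π v → ∃ s, s < σ.τ v ∧ (u, σ.π u, σ.π v, s) ∈ σ.Γ)) ∧
  (∀ v p₁ p₂ s, (v, p₁, p₂, s) ∈ σ.Γ → p₁ = σ.π v ∧ σ.τ v ≤ s)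

/-- The output of `v` is present on processor `p` at the end of the computation phase of
superstep `s`. -/
def Present (σ : Schedule V P) (v : V) (p : Fin P) (s : Fin σ.S) : Prop :=
  (σ.π v = p ∧ σ.τ v ≤ s) ∨ ∃ p' s', s' < s ∧ (v, p', p, s') ∈ σ.Γ

/-- Validity under free data movement. -/
def ValidFree (G : Digraph V) (σ : Schedule V P) : Prop :=
  (∀ u v, G.Adj u v → σ.Present u (σ.π v) (σ.τ v)) ∧
  (∀ v p₁ p₂ s, (v, p₁, p₂, s) ∈ σ.Γ → σ.Present v p₁ s)

/-- Validity of a schedule of `G` in the given communication model. -/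
def Valid (M : CommModel) (G : Digraph V) (σ : Schedule V P) : Prop :=
  match M with
  | .DS | .DB => σ.ValidDirect G
  | .FS | .FB => σ.ValidFree G

variable [Fintype V] [DecidableEq V]

/-- The number of nodes computed on processor `p` in superstep `s`. -/
def workCost (σ : Schedule V P) (s : Fin σ.S) (p : Fin P) : ℕ :=
  (Finset.univ.filter fun v => σ.π v = p ∧ σ.τ v = s).card

/-- The send cost of processor `p` in superstep `s`: under singlecast the number of communication
steps that leave `p`, under broadcast the number of distinct values that leave `p`. -/
def sentCost (M : CommModel) (σ : Schedule V P) (s : Fin σ.S) (p : Fin P) : ℕ :=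
  match M with
  | .DS | .FS => (σ.Γ.filter fun c => c.2.1 = p ∧ c.2.2.2 = s).card
  | .DB | .FB => (Finset.univ.filter fun v => ∃ p', (v, p, p', s) ∈ σ.Γ).card

/-- The receive cost of processor `p` in superstep `s`. -/
def recCost (σ : Schedule V P) (s : Fin σ.S) (p : Fin P) : ℕ :=
  (σ.Γ.filter fun c => c.2.2.1 = p ∧ c.2.2.2 = s).card

/-- The cost of superstep `s`: the maximal work cost of a processor, plus `g` times the maximal
send or receive cost of a processor, plus the latency `L`. -/
def stepCost (M : CommModel) (g L : ℕ) (σ : Schedule V P) (s : Fin σ.S) : ℕ :=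
  (Finset.univ.sup fun p => σ.workCost s p) +
    g * (Finset.univ.sup fun p => max (σ.sentCost M s p) (σ.recCost s p)) + L

/-- The cost of a schedule: the sum of the costs of its supersteps. -/
def cost (M : CommModel) (g L : ℕ) (σ : Schedule V P) : ℕ :=
  ∑ s, σ.stepCost M g L s

/-- `σ` is a solution of the BSP scheduling problem for `G`: it is valid, and its cost is minimal
among all valid schedules, with any number of supersteps. -/
def IsOptimal (M : CommModel) (g L : ℕ) (G : Digraph V) (σ : Schedule V P) : Prop :=
  σ.Valid M G ∧ ∀ σ' : Schedule V P, σ'.Valid M G → σ.cost M g L ≤ σ'.cost M g L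

end Schedule

/-! ### Random access machines

The state of a machine consists of registers and of arrays, all with natural numbers as entries.
A program is a fixed finite text and so names only finitely many registers and arrays, while the
positions within an array are computed at run time. Every operation takes one time unit. Apart
from truncated subtraction, addition is the only arithmetic operation, so bit lengths grow by at
most one per time unit, and polynomial time on this machine is the usual polynomial time. -/

/-- The contents of the registers and of the arrays. -/
structure Store where
  reg : ℕ → ℕ
  arr : ℕ → ℕ → ℕ

/-- Expressions: constants, registers, array entries, sums and truncated differences. -/
inductive Expr
  | lit (k : ℕ)
  | reg (x : ℕ)
  | read (a : ℕ) (e : Expr)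
  | add (e₁ e₂ : Expr)
  | sub (e₁ e₂ : Expr)

namespace Expr

/-- The value of an expression. -/
def eval (m : Store) : Expr → ℕ
  | lit k => k
  | reg x => m.reg x
  | read a e => m.arr a (e.eval m)
  | add e₁ e₂ => e₁.eval m + e₂.eval m
  | sub e₁ e₂ => e₁.eval m - e₂.eval m

/-- The time needed to evaluate an expression: one unit for each operation in it. -/
def time : Expr → ℕ
  | lit _ => 1
  | reg _ => 1
  | read _ e => e.time + 1
  | add e₁ e₂ => e₁.time + e₂.time + 1
  | sub e₁ e₂ => e₁.time + e₂.time + 1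

end Expr

/-- Programs: assignment to a register, assignment to the array entry `a[i]`, composition, branching
on whether an expression is nonzero, and repetition while an expression is nonzero. -/
inductive Program
  | assign (x : ℕ) (e : Expr)
  | write (a : ℕ) (i e : Expr)
  | seq (c d : Program)
  | ite (e : Expr) (c d : Program)
  | loop (e : Expr) (c : Program)

/-- `Runs c m t m'`: started in `m`, the program `c` halts in `m'` after exactly `t` time units. -/
inductive Runs : Program → Store → ℕ → Store → Prop
  | assign (x : ℕ) (e : Expr) (m : Store) :
      Runs (.assign x e) m (e.time + 1) { m with reg := Function.update m.reg x (e.eval m) }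
  | write (a : ℕ) (i e : Expr) (m : Store) :
      Runs (.write a i e) m (i.time + e.time + 1)
        { m with arr := Function.update m.arr a
                          (Function.update (m.arr a) (i.eval m) (e.eval m)) }
  | seq {c d : Program} {m m' m'' : Store} {t t' : ℕ} :
      Runs c m t m' → Runs d m' t' m'' → Runs (.seq c d) m (t + t') m''
  | ite_nonzero {e : Expr} {c : Program} (d : Program) {m m' : Store} {t : ℕ} :
      e.eval m ≠ 0 → Runs c m t m' → Runs (.ite e c d) m (e.time + 1 + t) m'
  | ite_zero {e : Expr} (c : Program) {d : Program} {m m' : Store} {t : ℕ} :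
      e.eval m = 0 → Runs d m t m' → Runs (.ite e c d) m (e.time + 1 + t) m'
  | loop_nonzero {e : Expr} {c : Program} {m m' m'' : Store} {t t' : ℕ} :
      e.eval m ≠ 0 → Runs c m t m' → Runs (.loop e c) m' t' m'' →
        Runs (.loop e c) m (e.time + 1 + t + t') m''
  | loop_zero {e : Expr} (c : Program) {m : Store} :
      e.eval m = 0 → Runs (.loop e c) m (e.time + 1) m

/-! ### Solving the BSP scheduling problem in polynomial time -/

/-- `E` lists the edges of `G`, each of them once, in some order. -/
def ListsEdges {n : ℕ} (G : Digraph (Fin n)) (E : List (Fin n × Fin n)) : Prop :=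
  E.Nodup ∧ ∀ u v, (u, v) ∈ E ↔ G.Adj u v

/-- The input word: the number of nodes, the number of edges, and the two ends of each edge. -/
def inputWord (n : ℕ) (E : List (Fin n × Fin n)) : List ℕ :=
  n :: E.length :: E.flatMap fun e => [(e.1 : ℕ), (e.2 : ℕ)]

/-- The initial state for an input word: the word is in array `0`; all else is `0`. -/
def initStore (w : List ℕ) : Store where
  reg _ := 0
  arr a i := if a = 0 then w.getD i 0 else 0

/-- An output word for the schedule `σ`, with `C` a list of its communication steps: the number of
supersteps, the processor and the superstep of each node, the number of communication steps, and
the communication steps. -/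
def outputWord {n P : ℕ} (σ : Schedule (Fin n) P)
    (C : List (Fin n × Fin P × Fin P × Fin σ.S)) : List ℕ :=
  σ.S :: ((List.finRange n).flatMap fun v => [(σ.π v : ℕ), (σ.τ v : ℕ)]) ++
    C.length :: C.flatMap fun c => [(c.1 : ℕ), (c.2.1 : ℕ), (c.2.2.1 : ℕ), (c.2.2.2 : ℕ)]

/-- Array `1` starts with an output word for `σ`. -/
def Outputs {n P : ℕ} (m : Store) (σ : Schedule (Fin n) P) : Prop :=
  ∃ C : List (Fin n × Fin P × Fin P × Fin σ.S), C.Nodup ∧ C.toFinset = σ.Γ ∧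
    ∀ (i : ℕ) (h : i < (outputWord σ C).length), m.arr 1 i = (outputWord σ C)[i]

/-- For fixed `P`, `g`, `L` and a fixed communication model, the BSP scheduling problem restricted
to the digraphs with property `𝒞` can be solved in time polynomial in the number `n` of nodes: one
program, given any listing of the edges of any such digraph, halts within that time and outputs
an optimal schedule. -/
def SolvableInPolyTime (M : CommModel) (P g L : ℕ)
    (𝒞 : ∀ n : ℕ, Digraph (Fin n) → Prop) : Prop :=
  ∃ (c : Program) (f : Polynomial ℕ),
    ∀ (n : ℕ) (G : Digraph (Fin n)), 𝒞 n G →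
      ∀ E : List (Fin n × Fin n), ListsEdges G E →
        ∃ (t : ℕ) (m : Store) (σ : Schedule (Fin n) P),
          Runs c (initStore (inputWord n E)) t m ∧ t ≤ f.eval n ∧
            Outputs m σ ∧ σ.IsOptimal M g L G

end BSP

namespace BSP

/-! ### Functions computable in polynomial time -/

/-! Let W be the work of a valid schedule, the sum over the supersteps of the maximal load of a
processor. Two nodes of one chain in the same superstep share a processor, because a transferred
value is only usable in a later superstep. Hence W is at least the length of each chain, and it is
at least n / P. Conversely, McNaughton's wrap-around rule packs all chains into W time slots on P
processors. At most one chain crosses each border between two processors, so P cuts in time and at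
most 2 * P communication steps suffice for validity. In a connected chain DAG the source gets a
superstep of its own, and both bounds hold for the other nodes with W - 1 in place of W
(`ChainOrder.bounds`, `ChainOrder.exists_wrap`).

Thus a schedule of work W can beat the wrap-around schedule only if its communication and latency
cost less than a constant K. For L > 0 this bounds the number of supersteps. For L = 0 < g it bounds
the number of supersteps with communication, and the others can be merged into their successors. For
g = L = 0 the wrap-around schedule is at least as good. So schedules with at most T supersteps
suffice, for a constant T (`ChainOrder.exists_bounded`).

With T fixed, a node has constantly many choices of processor, superstep and communication steps.
Validity is a condition on single nodes and on edges (`Schedule.valid_ofChoices`), and the cost is a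
function of 3 * T * P counters of polynomial size (`Schedule.cost_ofChoices`). If the nodes are
visited chain by chain, every edge comes from the node visited just before or from the source. A
dynamic program therefore only remembers the number of supersteps, these two choices and the
counters, which makes polynomially many states (`ChainOrder.isOptimal_best`).

The machine program is never written out. `PComp` is closed under arithmetic, case distinctions over
constant ranges and loops of polynomial length, and the dynamic program is assembled from these.
Only two tables are stored: the values of the dynamic program, which the recursion would otherwise
recompute exponentially often, and the output word (`PRun.valCtx`, `PRun.outCtx`). -/

/-- A context for computations: it tells which machine states represent an element of `α`, and
which registers and arrays this depends on. -/
structure Ctx (α : Type) where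
  /-- The size in which running times are measured. -/
  size : α → ℕ
  /-- Only registers below `depth` hold data. -/
  depth : ℕ
  /-- The arrays that hold data. -/
  used : Set ℕ
  /-- The machine state represents the element. -/
  Rep : α → Store → Prop
  stable : ∀ {a m m'}, (∀ x < depth, m'.reg x = m.reg x) → (∀ k ∈ used, m'.arr k = m.arr k) →
    Rep a m → Rep a m'

variable {α β γ : Type}

/-- The program `c` computes `f` into register `d` within time `p`, and changes no register below
`d` and no array. -/
def Computes (Γ : Ctx α) (d : ℕ) (c : Program) (p : Polynomial ℕ) (f : α → ℕ) : Prop :=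
  ∀ a m, Γ.Rep a m → ∃ t m', Runs c m t m' ∧ t ≤ p.eval (Γ.size a) ∧
    (∀ x < d, m'.reg x = m.reg x) ∧ m'.arr = m.arr ∧ m'.reg d = f a

/-- The function `f` can be computed in polynomial time in the context `Γ`. -/
def PComp (Γ : Ctx α) (f : α → ℕ) : Prop :=
  ∀ d, Γ.depth ≤ d → ∃ c p, Computes Γ d c p f

/-- The predicate `P` can be decided in polynomial time in the context `Γ`. -/
def PDec (Γ : Ctx α) (P : α → Prop) : Prop :=
  ∃ f, PComp Γ f ∧ ∀ a m, Γ.Rep a m → (f a ≠ 0 ↔ P a)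

/-- The function `f` is bounded by a polynomial in the size. -/
def PBdd (Γ : Ctx α) (f : α → ℕ) : Prop :=
  ∃ p : Polynomial ℕ, ∀ a m, Γ.Rep a m → f a ≤ p.eval (Γ.size a)

/-- The context `Δ` holds all the data of the context `Γ`. -/
structure Ctx.Ext (Δ : Ctx β) (φ : β → α) (Γ : Ctx α) : Prop where
  size : ∀ b, Γ.size (φ b) = Δ.size b
  depth : Γ.depth ≤ Δ.depth
  rep : ∀ b m, Δ.Rep b m → Γ.Rep (φ b) m

theorem Ctx.Ext.trans {Δ : Ctx β} {Γ : Ctx α} {Θ : Ctx γ} {φ : β → α} {ψ : γ → β}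
    (h : Θ.Ext ψ Δ) (h' : Δ.Ext φ Γ) : Θ.Ext (fun c => φ (ψ c)) Γ where
  size c := (h'.size _).trans (h.size c)
  depth := h'.depth.trans h.depth
  rep c m hm := h'.rep _ m (h.rep c m hm)

theorem Ctx.Ext.refl (Γ : Ctx α) : Γ.Ext (fun a => a) Γ :=
  ⟨fun _ => rfl, le_rfl, fun _ _ h => h⟩

/-- The context restricted to the elements that satisfy `P`. -/
def Ctx.restrict (Γ : Ctx α) (P : α → Prop) : Ctx α where
  size := Γ.size
  depth := Γ.depth
  used := Γ.used
  Rep a m := Γ.Rep a m ∧ P a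
  stable := fun h h' ⟨h1, h2⟩ => ⟨Γ.stable h h' h1, h2⟩

theorem Ctx.ext_restrict {Γ : Ctx α} {P : α → Prop} : (Γ.restrict P).Ext (fun a => a) Γ :=
  ⟨fun _ => rfl, le_rfl, fun _ _ h => h.1⟩

theorem Ctx.Ext.restrict {Δ : Ctx β} {Γ : Ctx α} {φ : β → α} (h : Δ.Ext φ Γ) {P : β → Prop} :
    (Δ.restrict P).Ext φ Γ :=
  Ctx.ext_restrict.trans h

/-! ### Closure properties that need no loops. -/

section basic

variable {Γ : Ctx α} {Δ : Ctx β} {φ : β → α} {f g h : α → ℕ} {P Q : α → Prop}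

theorem PComp.ext (hf : PComp Γ f) (e : Δ.Ext φ Γ) : PComp Δ (fun b => f (φ b)) := by
  intro d hd
  obtain ⟨c, p, h⟩ := hf d (e.depth.trans hd)
  refine ⟨c, p, fun b m hm => ?_⟩
  rw [← e.size]
  exact h _ m (e.rep b m hm)

theorem PDec.ext (hf : PDec Γ P) (e : Δ.Ext φ Γ) : PDec Δ (fun b => P (φ b)) := by
  obtain ⟨f, hf, h⟩ := hf
  exact ⟨_, hf.ext e, fun b m hm => h _ m (e.rep b m hm)⟩

theorem PBdd.ext (hf : PBdd Γ f) (e : Δ.Ext φ Γ) : PBdd Δ (fun b => f (φ b)) := by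
  obtain ⟨p, h⟩ := hf
  refine ⟨p, fun b m hm => ?_⟩
  rw [← e.size]
  exact h _ m (e.rep b m hm)

theorem PComp.congr (hf : PComp Γ f) (h : ∀ a m, Γ.Rep a m → f a = g a) : PComp Γ g := by
  intro d hd
  obtain ⟨c, p, hc⟩ := hf d hd
  refine ⟨c, p, fun a m hm => ?_⟩
  rw [← h a m hm]
  exact hc a m hm

theorem PDec.congr (hf : PDec Γ P) (h : ∀ a m, Γ.Rep a m → (P a ↔ Q a)) : PDec Γ Q := by
  obtain ⟨f, hf, h'⟩ := hf
  exact ⟨f, hf, fun a m hm => (h' a m hm).trans (h a m hm)⟩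

theorem PBdd.mono (hg : PBdd Γ g) (h : ∀ a m, Γ.Rep a m → f a ≤ g a) : PBdd Γ f := by
  obtain ⟨p, hp⟩ := hg
  exact ⟨p, fun a m hm => (h a m hm).trans (hp a m hm)⟩

theorem PBdd.const (k : ℕ) : PBdd Γ (fun _ => k) :=
  ⟨Polynomial.C k, fun a m _ => by simp⟩

theorem PBdd.size : PBdd Γ Γ.size := ⟨Polynomial.X, fun a m _ => by simp⟩

theorem PBdd.add (hf : PBdd Γ f) (hg : PBdd Γ g) : PBdd Γ (fun a => f a + g a) := by
  obtain ⟨p, hp⟩ := hf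
  obtain ⟨q, hq⟩ := hg
  exact ⟨p + q, fun a m hm => by simpa using add_le_add (hp a m hm) (hq a m hm)⟩

theorem PBdd.mul (hf : PBdd Γ f) (hg : PBdd Γ g) : PBdd Γ (fun a => f a * g a) := by
  obtain ⟨p, hp⟩ := hf
  obtain ⟨q, hq⟩ := hg
  exact ⟨p * q, fun a m hm => by simpa using Nat.mul_le_mul (hp a m hm) (hq a m hm)⟩

theorem PBdd.pow (hf : PBdd Γ f) (k : ℕ) : PBdd Γ (fun a => f a ^ k) := by
  obtain ⟨p, hp⟩ := hf
  exact ⟨p ^ k, fun a m hm => by simpa using Nat.pow_le_pow_left (hp a m hm) k⟩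

theorem PComp.expr (e : Expr) (h : ∀ a m, Γ.Rep a m → e.eval m = f a) : PComp Γ f := by
  intro d _
  refine ⟨.assign d e, Polynomial.C (e.time + 1), fun a m hm => ?_⟩
  refine ⟨_, _, Runs.assign d e m, by simp, fun x hx => ?_, rfl, ?_⟩
  · simp [Function.update_of_ne hx.ne]
  · simp [h a m hm]

theorem PComp.const (k : ℕ) : PComp Γ (fun _ => k) :=
  .expr (.lit k) fun _ _ _ => rfl

/-- Applying an operation of the machine to the value of a function. -/
theorem PComp.map (hf : PComp Γ f) (e : ℕ → Expr) (s : ℕ) (hs : ∀ d, (e d).time ≤ s)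
    (h : ∀ d a m m', Γ.Rep a m → m'.arr = m.arr → m'.reg d = f a → (e d).eval m' = g a) :
    PComp Γ g := by
  intro d hd
  obtain ⟨c, p, hc⟩ := hf d hd
  refine ⟨.seq c (.assign d (e d)), p + Polynomial.C (s + 1), fun a m hm => ?_⟩
  obtain ⟨t, m', hr, ht, h1, h2, h3⟩ := hc a m hm
  refine ⟨_, _, hr.seq (Runs.assign d (e d) m'), ?_, fun x hx => ?_, h2, ?_⟩
  · have := hs d
    simp only [Polynomial.eval_add, Polynomial.eval_C]
    omega
  · simpa [Function.update_of_ne hx.ne] using h1 x hx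
  · simpa using h d a m m' hm h2 h3

/-- Applying an operation of the machine to the values of two functions. -/
theorem PComp.map₂ (hf : PComp Γ f) (hg : PComp Γ g) (e : ℕ → Expr) (s : ℕ)
    (hs : ∀ d, (e d).time ≤ s)
    (he : ∀ d a m', m'.reg d = f a → m'.reg (d + 1) = g a → (e d).eval m' = h a) :
    PComp Γ h := by
  intro d hd
  obtain ⟨c, p, hc⟩ := hf d hd
  -- Registers serve as a stack: computing the second value into `d + 1` preserves the first value
  -- in `d`.
  obtain ⟨c', p', hc'⟩ := hg (d + 1) (by omega)
  refine ⟨.seq c (.seq c' (.assign d (e d))), p + (p' + Polynomial.C (s + 1)), fun a m hm => ?_⟩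
  obtain ⟨t, m', hr, ht, h1, h2, h3⟩ := hc a m hm
  obtain ⟨t', m'', hr', ht', h1', h2', h3'⟩ := hc' a m'
    (Γ.stable (fun x hx => h1 x (by omega)) (fun k _ => by rw [h2]) hm)
  refine ⟨_, _, hr.seq (hr'.seq (Runs.assign d (e d) m'')), ?_, fun x hx => ?_, h2'.trans h2, ?_⟩
  · have := hs d
    simp only [Polynomial.eval_add, Polynomial.eval_C]
    omega
  · simpa [Function.update_of_ne hx.ne] using (h1' x (by omega)).trans (h1 x hx)
  · simpa using he d a m'' ((h1' d (by omega)).trans h3) h3'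

theorem PComp.add (hf : PComp Γ f) (hg : PComp Γ g) : PComp Γ (fun a => f a + g a) :=
  hf.map₂ hg (fun d => .add (.reg d) (.reg (d + 1))) 3 (fun _ => le_rfl)
    fun d a m' h1 h2 => by simp [Expr.eval, h1, h2]

theorem PComp.sub (hf : PComp Γ f) (hg : PComp Γ g) : PComp Γ (fun a => f a - g a) :=
  hf.map₂ hg (fun d => .sub (.reg d) (.reg (d + 1))) 3 (fun _ => le_rfl)
    fun d a m' h1 h2 => by simp [Expr.eval, h1, h2]

theorem PComp.max (hf : PComp Γ f) (hg : PComp Γ g) : PComp Γ (fun a => max (f a) (g a)) :=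
  (hf.add (hg.sub hf)).congr fun a _ _ => by omega

/-- Reading an array. -/
theorem PComp.read (k : ℕ) (hf : PComp Γ f) (h : ∀ a m, Γ.Rep a m → m.arr k (f a) = g a) :
    PComp Γ g :=
  hf.map (fun d => .read k (.reg d)) 2 (fun _ => le_rfl)
    fun d a m m' hm h1 h2 => by simp [Expr.eval, h1, h2, h a m hm]

/-- Only the branch that is taken runs, so each branch may rely on its side of the test. Table
look-ups need this, since they are meaningful only for certain indices. -/
theorem PDec.iteOn (hP : PDec Γ P) [DecidablePred P] (hf : PComp (Γ.restrict P) f)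
    (hg : PComp (Γ.restrict fun a => ¬ P a) g) : PComp Γ (fun a => if P a then f a else g a) := by
  obtain ⟨b, hb, hbP⟩ := hP
  intro d hd
  obtain ⟨c, p, hc⟩ := hb d hd
  obtain ⟨c₁, p₁, hc₁⟩ := hf d hd
  obtain ⟨c₂, p₂, hc₂⟩ := hg d hd
  refine ⟨.seq c (.ite (.reg d) c₁ c₂), p + (Polynomial.C 2 + p₁ + p₂), fun a m hm => ?_⟩
  obtain ⟨t, m', hr, ht, h1, h2, h3⟩ := hc a m hm
  have hm' : Γ.Rep a m' := Γ.stable (fun x hx => h1 x (by omega)) (fun k _ => by rw [h2]) hm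
  by_cases ha : P a
  · obtain ⟨t', m'', hr', ht', h1', h2', h3'⟩ := hc₁ a m' ⟨hm', ha⟩
    refine ⟨_, _, hr.seq (Runs.ite_nonzero c₂ (e := .reg d) ?_ hr'), ?_,
      fun x hx => (h1' x hx).trans (h1 x hx), h2'.trans h2, by simpa [ha] using h3'⟩
    · simpa [Expr.eval, h3] using (hbP a m hm).2 ha
    · simp only [Polynomial.eval_add, Polynomial.eval_C, Expr.time, Ctx.restrict] at ht' ⊢
      omega
  · obtain ⟨t', m'', hr', ht', h1', h2', h3'⟩ := hc₂ a m' ⟨hm', ha⟩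
    refine ⟨_, _, hr.seq (Runs.ite_zero c₁ (e := .reg d) ?_ hr'), ?_,
      fun x hx => (h1' x hx).trans (h1 x hx), h2'.trans h2, by simpa [ha] using h3'⟩
    · simpa [Expr.eval, h3] using mt (hbP a m hm).1 ha
    · simp only [Polynomial.eval_add, Polynomial.eval_C, Expr.time, Ctx.restrict] at ht' ⊢
      omega

theorem PDec.ite (hP : PDec Γ P) [DecidablePred P] (hf : PComp Γ f) (hg : PComp Γ g) :
    PComp Γ (fun a => if P a then f a else g a) :=
  hP.iteOn (hf.ext Ctx.ext_restrict) (hg.ext Ctx.ext_restrict)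

theorem PDec.lt (hf : PComp Γ f) (hg : PComp Γ g) : PDec Γ (fun a => f a < g a) :=
  ⟨_, hg.sub hf, fun a _ _ => by omega⟩

theorem PDec.le (hf : PComp Γ f) (hg : PComp Γ g) : PDec Γ (fun a => f a ≤ g a) :=
  ⟨_, ((hg.add (.const 1)).sub hf), fun a _ _ => by omega⟩

theorem PDec.not (hP : PDec Γ P) : PDec Γ (fun a => ¬ P a) := by
  obtain ⟨f, hf, h⟩ := hP
  exact ⟨_, (PComp.const 1).sub hf, fun a m hm => by
    simp only [← h a m hm]; omega⟩

theorem PDec.or (hP : PDec Γ P) (hQ : PDec Γ Q) : PDec Γ (fun a => P a ∨ Q a) := by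
  obtain ⟨f, hf, h⟩ := hP
  obtain ⟨g, hg, h'⟩ := hQ
  exact ⟨_, hf.add hg, fun a m hm => by
    simp only [← h a m hm, ← h' a m hm]; omega⟩

theorem PDec.and (hP : PDec Γ P) (hQ : PDec Γ Q) : PDec Γ (fun a => P a ∧ Q a) :=
  (hP.not.or hQ.not).not.congr fun a _ _ => by tauto

theorem PDec.eq (hf : PComp Γ f) (hg : PComp Γ g) : PDec Γ (fun a => f a = g a) :=
  ((PDec.le hf hg).and (PDec.le hg hf)).congr fun _ _ _ => by omega

/-- The truth value is hard-wired into the program. This is how undecided-looking conditions on the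
constants `M`, `P`, `T` and on fixed control states enter the program. -/
theorem PDec.const (p : Prop) : PDec Γ (fun _ => p) := by
  by_cases h : p
  · exact ⟨_, .const 1, by simp [h]⟩
  · exact ⟨_, .const 0, by simp [h]⟩

/-- A function of a value from a finite range, given by cases. -/
theorem PComp.cases {F : ℕ → α → ℕ} (N : ℕ) (hf : PComp Γ f) (hF : ∀ x < N, PComp Γ (F x))
    (hN : ∀ a m, Γ.Rep a m → f a < N) : PComp Γ (fun a => F (f a) a) := by
  -- A cascade of `K` equality tests, built by induction on `K`; values not yet covered default to
  -- `0`.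
  have : ∀ K ≤ N, PComp Γ (fun a => if f a < K then F (f a) a else 0) := by
    intro K
    induction K with
    | zero => intro _; simpa using PComp.const 0
    | succ K ih =>
      intro hK
      refine ((PDec.eq hf (.const K)).ite (hF K (by omega)) (ih (by omega))).congr
        fun a m _ => ?_
      by_cases h : f a = K
      · simp [h]
      · have : f a < K + 1 ↔ f a < K := by omega
        simp [h, this]
  exact (this N le_rfl).congr fun a m hm => by simp [hN a m hm]

theorem PDec.cases {F : ℕ → α → Prop} (N : ℕ) (hf : PComp Γ f) (hF : ∀ x < N, PDec Γ (F x))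
    (hN : ∀ a m, Γ.Rep a m → f a < N) : PDec Γ (fun a => F (f a) a) := by
  classical
  refine ⟨_, PComp.cases (F := fun x a => if F x a then 1 else 0) N hf
    (fun x hx => (hF x hx).ite (.const 1) (.const 0)) hN, fun a m hm => by simp⟩

theorem PComp.finsetSum {ι : Type*} {F : ι → α → ℕ} (s : Finset ι) (hF : ∀ i ∈ s, PComp Γ (F i)) :
    PComp Γ (fun a => ∑ i ∈ s, F i a) := by
  classical
  induction s using Finset.induction_on with
  | empty => simpa using PComp.const 0
  | insert i s hi ih =>
    refine ((hF i (by simp)).add (ih fun j hj => hF j (by simp [hj]))).congr fun a _ _ => ?_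
    rw [Finset.sum_insert hi]

theorem PComp.finsetSup {ι : Type*} {F : ι → α → ℕ} (s : Finset ι) (hF : ∀ i ∈ s, PComp Γ (F i)) :
    PComp Γ (fun a => s.sup fun i => F i a) := by
  classical
  induction s using Finset.induction_on with
  | empty => simpa using PComp.const 0
  | insert i s hi ih =>
    refine ((hF i (by simp)).max (ih fun j hj => hF j (by simp [hj]))).congr fun a _ _ => ?_
    rw [Finset.sup_insert]

/-- The factor is a constant of the program text, so the product unrolls to a sum and needs no loop.
-/
theorem PComp.constMul (k : ℕ) (hf : PComp Γ f) : PComp Γ (fun a => k * f a) :=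
  (PComp.finsetSum (Finset.range k) fun _ _ => hf).congr fun a _ _ => by simp

end basic

/-! ### Loops -/

/-- The rule for loops with an invariant indexed by the number of completed rounds. The factor `N +
1` accounts for the final test, which fails. -/
theorem Runs.repeat {e : Expr} {c : Program} (I : ℕ → Store → Prop) (N T : ℕ)
    (step : ∀ i < N, ∀ m, I i m → e.eval m ≠ 0 ∧ ∃ t m', Runs c m t m' ∧ t ≤ T ∧ I (i + 1) m')
    (halt : ∀ m, I N m → e.eval m = 0) {m : Store} (h0 : I 0 m) :
    ∃ t m', Runs (.loop e c) m t m' ∧ t ≤ (N + 1) * (e.time + 1 + T) ∧ I N m' := by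
  -- Induction on the number `j` of rounds still to come.
  have : ∀ j, j ≤ N → ∀ m, I (N - j) m →
      ∃ t m', Runs (.loop e c) m t m' ∧ t ≤ (j + 1) * (e.time + 1 + T) ∧ I N m' := by
    intro j
    induction j with
    | zero =>
      intro _ m hm
      exact ⟨_, m, Runs.loop_zero c (halt m hm), by omega, hm⟩
    | succ j ih =>
      intro hj m hm
      obtain ⟨he, t, m', hr, ht, hI⟩ := step (N - (j + 1)) (by omega) m hm
      obtain ⟨t', m'', hr', ht', hI'⟩ := ih (by omega) m' (by
        have : N - (j + 1) + 1 = N - j := by omega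
        rwa [← this])
      refine ⟨_, m'', Runs.loop_nonzero he hr hr', ?_, hI'⟩
      have : (j + 1 + 1) * (e.time + 1 + T)
        = (j + 1) * (e.time + 1 + T) + (e.time + 1 + T) := by ring
      omega
  exact this N le_rfl m (by simpa using h0)

/-- The context extended by a number that is held in register `r`, subject to the condition `D`. -/
def Ctx.var (Γ : Ctx α) (r e : ℕ) (hr : Γ.depth ≤ r) (he : r < e) (D : α → ℕ → Prop) :
    Ctx (α × ℕ) where
  size x := Γ.size x.1
  depth := e
  used := Γ.used
  Rep x m := Γ.Rep x.1 m ∧ m.reg r = x.2 ∧ D x.1 x.2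
  stable := fun h h' ⟨h1, h2, h3⟩ =>
    ⟨Γ.stable (fun x hx => h x (by omega)) h' h1, (h r he).trans h2, h3⟩

section var

variable {Γ : Ctx α} {r e : ℕ} {hr : Γ.depth ≤ r} {he : r < e} {D : α → ℕ → Prop}

theorem Ctx.ext_var : (Γ.var r e hr he D).Ext Prod.fst Γ :=
  ⟨fun _ => rfl, by simp only [Ctx.var]; omega, fun _ _ h => h.1⟩

theorem Ctx.Ext.var {Θ : Ctx γ} {φ : α → γ} (h : Γ.Ext φ Θ) :
    (Γ.var r e hr he D).Ext (fun x => φ x.1) Θ :=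
  Ctx.ext_var.trans h

theorem PComp.snd : PComp (Γ.var r e hr he D) (fun x => x.2) :=
  .expr (.reg r) fun _ _ h => h.2.1

theorem PComp.wk {f : α → ℕ} (hf : PComp Γ f) : PComp (Γ.var r e hr he D) (fun x => f x.1) :=
  hf.ext Ctx.ext_var

theorem PDec.wk {P : α → Prop} (hf : PDec Γ P) : PDec (Γ.var r e hr he D) (fun x => P x.1) :=
  hf.ext Ctx.ext_var

theorem PBdd.wk {f : α → ℕ} (hf : PBdd Γ f) : PBdd (Γ.var r e hr he D) (fun x => f x.1) :=
  hf.ext Ctx.ext_var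

end var

/-- The function of `α` and of a number below `b` is computable in polynomial time. -/
def PComp₁ (Γ : Ctx α) (D : α → ℕ → Prop) (g : α → ℕ → ℕ) : Prop :=
  ∀ r e hr he, PComp (Γ.var r e hr he D) (fun x => g x.1 x.2)

/-- The predicate of `α` and of a number below `b` is decidable in polynomial time. -/
def PDec₁ (Γ : Ctx α) (D : α → ℕ → Prop) (P : α → ℕ → Prop) : Prop :=
  ∀ r e hr he, PDec (Γ.var r e hr he D) (fun x => P x.1 x.2)

section loops

variable {Γ : Ctx α} {b f₀ : α → ℕ}

/-- Primitive recursion over a range of polynomial length. -/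
theorem PComp.natRec {f : α → ℕ → ℕ → ℕ} (hb : PComp Γ b) (hb' : PBdd Γ b) (h₀ : PComp Γ f₀)
    (hf : ∀ r e hr he, PComp₁ (Γ.var r e hr he fun a i => i < b a)
      (fun x y => y = Nat.rec (f₀ x.1) (f x.1) x.2) (fun x y => f x.1 x.2 y)) :
    PComp Γ (fun a => Nat.rec (f₀ a) (f a) (b a)) := by
  intro d hd
  obtain ⟨c₀, p₀, hc₀⟩ := h₀ d hd
  obtain ⟨c₁, p₁, hc₁⟩ := hb (d + 1) (by omega)
  -- Register layout: `d` holds the accumulator, `d + 1` the round, `d + 2` the bound, `d + 3` a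
  -- copy of the accumulator as argument of the step, and `d + 4` its result. The step has to work
  -- only for the values that really occur in the recursion, which lets callers bound its argument.
  obtain ⟨c, p, hc⟩ := hf (d + 1) (d + 3) (by omega) (by omega) (d + 3) (d + 4)
    (by simp [Ctx.var]) (by omega) (d + 4) (by simp [Ctx.var])
  obtain ⟨q, hq⟩ := hb'
  let body : Program := .seq (.assign (d + 3) (.reg d)) (.seq c
    (.seq (.assign d (.reg (d + 4))) (.assign (d + 1) (.add (.reg (d + 1)) (.lit 1)))))
  let ex : Expr := .sub (.reg (d + 2)) (.reg (d + 1))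
  refine ⟨.seq c₀ (.seq c₁ (.seq (.assign (d + 2) (.reg (d + 1)))
    (.seq (.assign (d + 1) (.lit 0)) (.loop ex body)))),
    -- The constant `8` is the time of the three assignments in the body: `2 + 2 + 4`.
    p₀ + (p₁ + (Polynomial.C 2 + (Polynomial.C 2 +
      (q + 1) * (Polynomial.C (ex.time + 1) + (p + Polynomial.C 8))))), fun a m hm => ?_⟩
  obtain ⟨t, m', hr, ht, h1, h2, h3⟩ := hc₀ a m hm
  obtain ⟨t', m'', hr', ht', h1', h2', h3'⟩ := hc₁ a m'
    (Γ.stable (fun x hx => h1 x (by omega)) (fun k _ => by rw [h2]) hm)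
  have hloop := Runs.repeat (e := ex) (c := body)
    (I := fun i s => (∀ x < d, s.reg x = m.reg x) ∧ s.arr = m.arr ∧
      s.reg d = Nat.rec (f₀ a) (f a) i ∧ s.reg (d + 1) = i ∧ s.reg (d + 2) = b a)
    (b a) (p.eval (Γ.size a) + 8) ?_ ?_
    (m := ⟨Function.update (Function.update m''.reg (d + 2) (m''.reg (d + 1))) (d + 1) 0, m''.arr⟩) ?_
  · obtain ⟨t3, m3, hr3, ht3, hI1, hI2, hI3, -, -⟩ := hloop
    refine ⟨_, m3, hr.seq (hr'.seq ((Runs.assign _ _ _).seq ((Runs.assign _ _ _).seq hr3))), ?_,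
      hI1, hI2, hI3⟩
    have hb := hq a m hm
    simp only [Polynomial.eval_add, Polynomial.eval_mul, Polynomial.eval_C, Polynomial.eval_one,
      Expr.time]
    have : (b a + 1) * (ex.time + 1 + (p.eval (Γ.size a) + 8))
      ≤ (q.eval (Γ.size a) + 1) * (ex.time + 1 + (p.eval (Γ.size a) + 8)) := by gcongr
    omega
  · rintro i hi s ⟨s1, s2, s3, s4, s5⟩
    refine ⟨by simp [ex, Expr.eval, s4, s5]; omega, ?_⟩
    obtain ⟨t4, m4, hr4, ht4, h41, h42, h43⟩ := hc ((a, i), Nat.rec (f₀ a) (f a) i)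
      ⟨Function.update s.reg (d + 3) (s.reg d), s.arr⟩
      ⟨⟨Γ.stable (fun x hx => by
          rw [← s1 x (by omega)]
          exact Function.update_of_ne (by omega) _ _) (fun k _ => by rw [← s2]) hm,
        by simp [s4], hi⟩, by simp [s3], rfl⟩
    refine ⟨_, _, (Runs.assign _ _ _).seq (hr4.seq ((Runs.assign _ _ _).seq
      (Runs.assign _ _ _))), ?_, ?_, h42.trans s2, ?_, ?_, ?_⟩
    · simp only [Expr.time, Ctx.var] at ht4 ⊢
      omega
    · intro x hx
      have := h41 x (by omega)
      simp only
      rw [Function.update_of_ne (by omega), Function.update_of_ne (by omega), this]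
      simp only
      rw [Function.update_of_ne (by omega), s1 x hx]
    · simp [Expr.eval, h43]
    · have := h41 (d + 1) (by omega)
      simp at this
      simp [Expr.eval, this, s4]
    · have := h41 (d + 2) (by omega)
      simp at this
      simp [this, s5]
  · rintro s ⟨s1, s2, s3, s4, s5⟩
    simp [ex, Expr.eval, s4, s5]
  · refine ⟨fun x hx => ?_, h2'.trans h2, ?_, by simp, by simp [h3']⟩
    · simp only
      rw [Function.update_of_ne (by omega), Function.update_of_ne (by omega), h1' x (by omega),
        h1 x hx]
    · simp [h1' d (by omega), h3]

theorem PComp.sum {g : α → ℕ → ℕ} (hb : PComp Γ b) (hb' : PBdd Γ b)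
    (hg : PComp₁ Γ (fun a i => i < b a) g) :
    PComp Γ (fun a => ∑ i ∈ Finset.range (b a), g a i) := by
  refine (PComp.natRec (f₀ := fun _ => 0) (f := fun a i y => y + g a i) hb hb' (.const 0)
    fun r e hr he r' e' hr' he' => PComp.snd.add (hg r e hr he).wk).congr fun a _ _ => ?_
  generalize b a = n
  induction n with
  | zero => simp
  | succ n ih => rw [Finset.sum_range_succ, ← ih]

theorem PDec.exists {P : α → ℕ → Prop} (hb : PComp Γ b) (hb' : PBdd Γ b)
    (hP : PDec₁ Γ (fun a i => i < b a) P) : PDec Γ (fun a => ∃ i < b a, P a i) := by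
  classical
  refine ⟨_, PComp.sum (g := fun a i => if P a i then 1 else 0) hb hb'
    fun r e hr he => (hP r e hr he).ite (.const 1) (.const 0), fun a m hm => ?_⟩
  simp

theorem PDec.forall {P : α → ℕ → Prop} (hb : PComp Γ b) (hb' : PBdd Γ b)
    (hP : PDec₁ Γ (fun a i => i < b a) P) : PDec Γ (fun a => ∀ i < b a, P a i) :=
  (PDec.exists (P := fun a i => ¬ P a i) hb hb' fun r e hr he => (hP r e hr he).not).not.congr
    fun a _ _ => by push Not; rfl

theorem PComp₁.ext {Δ : Ctx β} {φ : β → α} {D : α → ℕ → Prop} {g : α → ℕ → ℕ}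
    (hg : PComp₁ Γ D g) (h : Δ.Ext φ Γ) :
    PComp₁ Δ (fun b i => D (φ b) i) (fun b i => g (φ b) i) := fun r e hr he =>
  (hg r e (h.depth.trans hr) he).ext (φ := fun x : β × ℕ => (φ x.1, x.2))
    (Δ := Δ.var r e hr he fun b i => D (φ b) i)
    ⟨fun x => h.size x.1, le_rfl, fun x m hm => ⟨h.rep x.1 m hm.1, hm.2⟩⟩

theorem PDec₁.ext {Δ : Ctx β} {φ : β → α} {D : α → ℕ → Prop} {P : α → ℕ → Prop}
    (hg : PDec₁ Γ D P) (h : Δ.Ext φ Γ) :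
    PDec₁ Δ (fun b i => D (φ b) i) (fun b i => P (φ b) i) := fun r e hr he =>
  (hg r e (h.depth.trans hr) he).ext (φ := fun x : β × ℕ => (φ x.1, x.2))
    (Δ := Δ.var r e hr he fun b i => D (φ b) i)
    ⟨fun x => h.size x.1, le_rfl, fun x m hm => ⟨h.rep x.1 m hm.1, hm.2⟩⟩

/-- Substitution of a computed value. -/
theorem PComp.subst {D : α → ℕ → Prop} {g : α → ℕ → ℕ} {v : α → ℕ} (hv : PComp Γ v)
    (hg : PComp₁ Γ D g) (hD : ∀ a m, Γ.Rep a m → D a (v a)) : PComp Γ (fun a => g a (v a)) := by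
  intro d hd
  obtain ⟨c, p, hc⟩ := hv d hd
  obtain ⟨c', p', hc'⟩ := hg d (d + 1) hd (by omega) (d + 1) le_rfl
  refine ⟨.seq c (.seq c' (.assign d (.reg (d + 1)))), p + (p' + Polynomial.C 2), fun a m hm => ?_⟩
  obtain ⟨t, m', hr, ht, h1, h2, h3⟩ := hc a m hm
  obtain ⟨t', m'', hr', ht', h1', h2', h3'⟩ := hc' (a, v a) m'
    ⟨Γ.stable (fun x hx => h1 x (by omega)) (fun k _ => by rw [h2]) hm, h3, hD a m hm⟩
  refine ⟨_, _, hr.seq (hr'.seq (Runs.assign _ _ _)), ?_, fun x hx => ?_, h2'.trans h2, ?_⟩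
  · simp only [Polynomial.eval_add, Polynomial.eval_C, Expr.time, Ctx.var] at ht' ⊢
    omega
  · simpa [Function.update_of_ne hx.ne] using (h1' x (by omega)).trans (h1 x hx)
  · simpa [Expr.eval] using h3'

theorem PDec.subst {D : α → ℕ → Prop} {P : α → ℕ → Prop} {v : α → ℕ} (hv : PComp Γ v)
    (hP : PDec₁ Γ D P) (hD : ∀ a m, Γ.Rep a m → D a (v a)) : PDec Γ (fun a => P a (v a)) := by
  classical
  exact ⟨_, hv.subst (g := fun a i => if P a i then 1 else 0)
    (fun r e hr he => (hP r e hr he).ite (.const 1) (.const 0)) hD, fun a m hm => by simp⟩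

theorem PComp.findGreatest {P : α → ℕ → Prop} [∀ a, DecidablePred (P a)] (hb : PComp Γ b)
    (hb' : PBdd Γ b) (hP : PDec₁ Γ (fun a i => i ≤ b a) P) :
    PComp Γ (fun a => Nat.findGreatest (P a) (b a)) := by
  -- `Nat.findGreatest` tests only positive numbers and returns `0` by default, so round `i` tests
  -- `i + 1`.
  have hP' : PDec₁ Γ (fun a i => i < b a) (fun a i => P a (i + 1)) := fun r e hr he =>
    PDec.subst (PComp.snd.add (.const 1)) (hP.ext Ctx.ext_var) fun a m hm => hm.2.2
  refine (PComp.natRec (f₀ := fun _ => 0) (f := fun a i y => if P a (i + 1) then i + 1 else y) hb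
    hb' (.const 0) fun r e hr he r' e' hr' he' => ?_).congr fun a _ _ => ?_
  · exact (hP' r e hr he).wk.ite (PComp.snd.add (.const 1)).wk PComp.snd
  · generalize b a = n
    induction n with
    | zero => simp
    | succ n ih => rw [Nat.findGreatest_succ, ← ih]

/-- Repeated addition; only the factor that controls the loop has to be polynomially bounded. -/
theorem PComp.mul {f g : α → ℕ} (hf : PComp Γ f) (hg : PComp Γ g) (hf' : PBdd Γ f) :
    PComp Γ (fun a => f a * g a) :=
  (PComp.sum (g := fun a _ => g a) hf hf' fun _ _ _ _ => hg.wk).congr fun a _ _ => by simp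

theorem PComp.pow {f : α → ℕ} (hf : PComp Γ f) (hf' : PBdd Γ f) (k : ℕ) :
    PComp Γ (fun a => f a ^ k) := by
  induction k with
  | zero => simpa using PComp.const 1
  | succ k ih => exact (hf.mul ih hf').congr fun a _ _ => by ring

/-- The quotient is the greatest `q ≤ f` with `q * g ≤ f`. Divisor `0` is treated apart: there every
`q` qualifies, whereas the quotient is `0` by convention. -/
theorem PComp.div {f g : α → ℕ} (hf : PComp Γ f) (hg : PComp Γ g) (hf' : PBdd Γ f) :
    PComp Γ (fun a => f a / g a) := by
  refine (PDec.ite (P := fun a => g a = 0) (.eq hg (.const 0)) (.const 0)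
    (PComp.findGreatest (P := fun a q => q * g a ≤ f a) hf hf' fun r e hr he =>
      .le (PComp.snd.mul hg.wk (hf'.wk.mono fun a m hm => hm.2.2)) hf.wk)).congr fun a m hm => ?_
  split_ifs with h
  · simp [h]
  · have h0 : 0 < g a := by omega
    rw [Nat.findGreatest_eq_iff]
    exact ⟨Nat.div_le_self _ _, fun _ => Nat.div_mul_le_self _ _, fun n hn _ => by
      rw [not_le]; exact (Nat.div_lt_iff_lt_mul h0).1 hn⟩

theorem PComp.mod {f g : α → ℕ} (hf : PComp Γ f) (hg : PComp Γ g) (hf' : PBdd Γ f) :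
    PComp Γ (fun a => f a % g a) :=
  (hf.sub (PComp.mul (hf.div hg hf') hg (hf'.mono fun _ _ _ => Nat.div_le_self _ _))).congr
    fun a _ _ => by
      have := Nat.mod_add_div (f a) (g a)
      rw [mul_comm] at this
      omega

/-- Iteration of a function a polynomial number of times. -/
theorem PComp.iterate {F : α → ℕ → ℕ} (hb : PComp Γ b) (hb' : PBdd Γ b) (h₀ : PComp Γ f₀)
    (hF : PComp₁ Γ (fun _ _ => True) F) : PComp Γ (fun a => (F a)^[b a] (f₀ a)) := by
  refine (PComp.natRec (f := fun a _ y => F a y) hb hb' h₀ fun r e hr he => ?_).congr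
    fun a _ _ => ?_
  · refine fun r' e' hr' he' => (hF r' e' (hr.trans (he.le.trans hr')) he').ext
      (φ := fun x : (α × ℕ) × ℕ => (x.1.1, x.2)) (Δ := (Γ.var r e hr he _).var r' e' hr' he' _)
      ⟨fun x => rfl, le_rfl, fun x m hm => ⟨hm.1.1, hm.2.1, trivial⟩⟩
  · generalize b a = n
    induction n with
    | zero => simp
    | succ n ih => rw [Function.iterate_succ_apply', ← ih]

end loops

/-! ### Tables -/

/-- The context during the computation of entry `i` of a table of `f` in array `k`: the entries
before it are known. -/
def Ctx.tab (Γ : Ctx α) (k : ℕ) (N : α → ℕ) (f : α → ℕ → ℕ) (r e : ℕ) (hr : Γ.depth ≤ r)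
    (he : r < e) : Ctx (α × ℕ) where
  size x := Γ.size x.1
  depth := e
  used := insert k Γ.used
  Rep x m := (Γ.Rep x.1 m ∧ m.reg r = x.2 ∧ x.2 < N x.1) ∧ ∀ j < x.2, m.arr k j = f x.1 j
  stable := by
    rintro a m m' h h' ⟨⟨h1, h2, h3⟩, h4⟩
    refine ⟨⟨Γ.stable (fun x hx => h x (by omega)) (fun j hj => h' j (by simp [hj])) h1,
      (h r he).trans h2, h3⟩, ?_⟩
    rwa [h' k (by simp)]

/-- The context extended by the table of the first `N` values of `f` in array `k`. -/
def Ctx.table (Γ : Ctx α) (k : ℕ) (N : α → ℕ) (f : α → ℕ → ℕ) : Ctx α where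
  size := Γ.size
  depth := Γ.depth
  used := insert k Γ.used
  Rep a m := Γ.Rep a m ∧ ∀ j < N a, m.arr k j = f a j
  stable := by
    rintro a m m' h h' ⟨h1, h4⟩
    refine ⟨Γ.stable h (fun j hj => h' j (by simp [hj])) h1, ?_⟩
    rwa [h' k (by simp)]

/-- Some program establishes the context `Γ'` from the context `Γ` in polynomial time. -/
def PRun (Γ Γ' : Ctx α) : Prop :=
  ∃ (c : Program) (p : Polynomial ℕ), ∀ a m, Γ.Rep a m →
    ∃ t m', Runs c m t m' ∧ t ≤ p.eval (Γ.size a) ∧ Γ'.Rep a m'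

theorem PRun.trans {Γ Γ' Γ'' : Ctx α} (h : PRun Γ Γ') (hs : ∀ a, Γ'.size a = Γ.size a)
    (h' : PRun Γ' Γ'') : PRun Γ Γ'' := by
  obtain ⟨c, p, hc⟩ := h
  obtain ⟨c', p', hc'⟩ := h'
  refine ⟨.seq c c', p + p', fun a m hm => ?_⟩
  obtain ⟨t, m', hr, ht, hm'⟩ := hc a m hm
  obtain ⟨t', m'', hr', ht', hm''⟩ := hc' a m' hm'
  refine ⟨_, _, hr.seq hr', ?_, hm''⟩
  rw [hs] at ht'
  simpa using add_le_add ht ht'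

theorem PRun.table {Γ : Ctx α} {k : ℕ} {N : α → ℕ} {f : α → ℕ → ℕ} (hk : k ∉ Γ.used)
    (hN : PComp Γ N) (hN' : PBdd Γ N)
    (hf : ∀ r e hr he, PComp (Γ.tab k N f r e hr he) (fun x => f x.1 x.2)) :
    PRun Γ (Γ.table k N f) := by
  set d := Γ.depth with hd
  obtain ⟨c₁, p₁, hc₁⟩ := hN d le_rfl
  obtain ⟨c, p, hc⟩ := hf (d + 1) (d + 2) (by omega) (by omega) (d + 2) le_rfl
  obtain ⟨q, hq⟩ := hN'
  -- Here `d` holds the length of the table, `d + 1` the index and `d + 2` the new entry.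
  let body : Program := .seq c (.seq (.write k (.reg (d + 1)) (.reg (d + 2)))
    (.assign (d + 1) (.add (.reg (d + 1)) (.lit 1))))
  let ex : Expr := .sub (.reg d) (.reg (d + 1))
  refine ⟨.seq c₁ (.seq (.assign (d + 1) (.lit 0)) (.loop ex body)),
    p₁ + (Polynomial.C 2 + (q + 1) * (Polynomial.C (ex.time + 1) + (p + Polynomial.C 8))),
    fun a m hm => ?_⟩
  obtain ⟨t, m', hr, ht, h1, h2, h3⟩ := hc₁ a m hm
  have hloop := Runs.repeat (e := ex) (c := body)
    (I := fun i s => (∀ x < d, s.reg x = m.reg x) ∧ (∀ j, j ≠ k → s.arr j = m.arr j) ∧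
      s.reg d = N a ∧ s.reg (d + 1) = i ∧ ∀ j < i, s.arr k j = f a j)
    (N a) (p.eval (Γ.size a) + 8) ?_ ?_
    (m := ⟨Function.update m'.reg (d + 1) 0, m'.arr⟩) ?_
  · obtain ⟨t3, m3, hr3, ht3, hI1, hI2, -, -, hI3⟩ := hloop
    refine ⟨_, m3, hr.seq ((Runs.assign _ _ _).seq hr3), ?_,
      Γ.stable hI1 (fun j hj => hI2 j (by rintro rfl; exact hk hj)) hm, hI3⟩
    have hb := hq a m hm
    simp only [Polynomial.eval_add, Polynomial.eval_mul, Polynomial.eval_C, Polynomial.eval_one,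
      Expr.time]
    have : (N a + 1) * (ex.time + 1 + (p.eval (Γ.size a) + 8))
      ≤ (q.eval (Γ.size a) + 1) * (ex.time + 1 + (p.eval (Γ.size a) + 8)) := by gcongr
    omega
  · rintro i hi s ⟨s1, s2, s3, s4, s5⟩
    refine ⟨by simp [ex, Expr.eval, s3, s4]; omega, ?_⟩
    obtain ⟨t4, m4, hr4, ht4, h41, h42, h43⟩ := hc (a, i) s
      ⟨⟨Γ.stable s1 (fun j hj => s2 j (by rintro rfl; exact hk hj)) hm, s4, hi⟩, s5⟩
    refine ⟨_, _, hr4.seq ((Runs.write _ _ _ _).seq (Runs.assign _ _ _)), ?_, ?_, ?_, ?_, ?_, ?_⟩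
    · simp only [Expr.time, Ctx.tab] at ht4 ⊢
      omega
    · intro x hx
      simp only
      rw [Function.update_of_ne (by omega), h41 x (by omega), s1 x hx]
    · intro j hj
      simp [Function.update_of_ne hj, h42, s2 j hj]
    · simp [h41 d (by omega), s3]
    · simp [Expr.eval, h41 (d + 1) (by omega), s4]
    · intro j hj
      simp only [Expr.eval, h42, h43, h41 (d + 1) (by omega), s4, Function.update_self]
      rcases eq_or_ne j i with rfl | hji
      · simp
      · rw [Function.update_of_ne hji, s5 j (by omega)]
  · rintro s ⟨s1, s2, s3, s4, s5⟩
    simp [ex, Expr.eval, s3, s4]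
  · refine ⟨fun x hx => ?_, fun j _ => by rw [h2], by simp [h3], by simp, by simp⟩
    simp only
    rw [Function.update_of_ne (by omega), h1 x (by omega)]

end BSP

namespace BSP

/-! ### Blocks of consecutive positions -/

/-- The interval `[a, b)` of positions below `n` is a maximal run in which every position except
the first one satisfies `cont`. -/
structure IsBlock (cont : ℕ → Prop) (n a b : ℕ) : Prop where
  lt : a < b
  le : b ≤ n
  first : ¬ cont a
  run : ∀ j, a < j → j < b → cont j
  last : b < n → ¬ cont b

/-- The block of `i` starts at the last position up to `i` that does not continue, and ends before
the first later one, or at `n`. -/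
theorem exists_isBlock {cont : ℕ → Prop} {n : ℕ} (h0 : ¬ cont 0) {i : ℕ} (hi : i < n) :
    ∃ a b, IsBlock cont n a b ∧ a ≤ i ∧ i < b := by
  classical
  have hex : ∃ j, i < j ∧ (n ≤ j ∨ ¬ cont j) := ⟨n, hi, .inl le_rfl⟩
  have hb := Nat.find_spec hex
  have hmin : ∀ j < Nat.find hex, ¬ (i < j ∧ (n ≤ j ∨ ¬ cont j)) := fun j => Nat.find_min hex
  have hle : Nat.find hex ≤ n := Nat.find_min' hex ⟨hi, .inl le_rfl⟩
  have ha : ¬ cont (Nat.findGreatest (fun j => ¬ cont j) i) :=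
    Nat.findGreatest_spec (P := fun j => ¬ cont j) (Nat.zero_le i) h0
  have hai := Nat.findGreatest_le (P := fun j => ¬ cont j) i
  refine ⟨_, _, ⟨by omega, hle, ha, fun j h1 h2 => ?_, fun h => ?_⟩, hai, hb.1⟩
  · rcases le_or_gt j i with hji | hji
    · simpa using Nat.findGreatest_is_greatest h1 hji
    · by_contra hc
      exact hmin j h2 ⟨hji, .inr hc⟩
  · exact hb.2.resolve_left (by omega)

theorem IsBlock.unique {cont : ℕ → Prop} {n a b a' b' i : ℕ} (h : IsBlock cont n a b)
    (h' : IsBlock cont n a' b') (h1 : a ≤ i) (h2 : i < b) (h1' : a' ≤ i) (h2' : i < b') :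
    a = a' ∧ b = b' := by
  obtain rfl : a = a' := by
    by_contra hne
    rcases lt_or_gt_of_ne hne with hlt | hlt
    · exact h'.first (h.run _ hlt (by omega))
    · exact h.first (h'.run _ hlt (by omega))
  refine ⟨rfl, ?_⟩
  by_contra hne
  have := h.le
  have := h'.le
  rcases lt_or_gt_of_ne hne with hlt | hlt
  · exact h.last (by omega) (h'.run _ (by omega) hlt)
  · exact h'.last (by omega) (h.run _ (by omega) hlt)

/-! ### Wrapping blocks around processors -/

/-- The processor of position `i` of the block `[a, b)` in the wrap-around schedule for `T` time
slots: the blocks fill the time slots of one processor after the other, and a block that reaches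
over the end of a processor starts on the next processor. -/
def wrapProc (T a b i : ℕ) : ℕ :=
  if (b - 1) / T * T ≤ a ∨ i - a < b - (b - 1) / T * T then (b - 1) / T else (b - 1) / T - 1

/-- The time slot of position `i` of the block `[a, b)` in the wrap-around schedule. -/
def wrapTime (T a b i : ℕ) : ℕ :=
  if (b - 1) / T * T ≤ a then i - (b - 1) / T * T
  else if i - a < b - (b - 1) / T * T then i - a else T - (b - i)

/-- Here `(b - 1) / T` is the processor of the last slot of the block and `(b - 1) / T * T` its
first slot. The block is split exactly if it starts before that slot. These facts reduce the
following lemmas to linear arithmetic. -/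
theorem wrap_bounds {T a b i : ℕ} (hT : b - a ≤ T) (h1 : a ≤ i) (h2 : i < b) :
     (b - 1) / T * T ≤ b - 1 ∧ b - 1 < (b - 1) / T * T + T ∧
    (a < (b - 1) / T * T → 1 ≤ (b - 1) / T ∧
      ((b - 1) / T - 1) * T + T = (b - 1) / T * T) := by
  have hT0 : 0 < T := by omega
  have := Nat.div_add_mod' (b - 1) T
  have := Nat.mod_lt (b - 1) hT0
  refine ⟨by omega, by omega, fun h => ?_⟩
  obtain ⟨k, hk⟩ : ∃ k, (b - 1) / T = k + 1 :=
    Nat.exists_eq_succ_of_ne_zero fun h0 => by simp [h0] at h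
  rw [hk]
  exact ⟨by omega, by simp [Nat.add_mul]⟩

theorem wrapTime_lt {T a b i : ℕ} (hT : b - a ≤ T) (h1 : a ≤ i) (h2 : i < b) :
     wrapTime T a b i < T := by
  obtain ⟨h3, h4, h5⟩ := wrap_bounds hT h1 h2
  unfold wrapTime
  split_ifs <;> omega

theorem wrapProc_le (T a b i : ℕ) : wrapProc T a b i ≤ (b - 1) / T := by
  unfold wrapProc
  split_ifs
  exacts [le_rfl, Nat.sub_le _ _]

/-- An unsplit block keeps its slots. In a split block the early nodes use the part on the last
processor, which lies at the beginning of time, and the late nodes the end of the processor before: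
a cyclic shift. In both cases the block stays within its own slots, so different blocks cannot
collide. -/
theorem wrap_slot {T a b i : ℕ} (hT : b - a ≤ T) (h1 : a ≤ i) (h2 : i < b) :
     (a ≤ wrapProc T a b i * T + wrapTime T a b i ∧
    wrapProc T a b i * T + wrapTime T a b i < b) ∧
    ((b - 1) / T * T ≤ a → wrapProc T a b i * T + wrapTime T a b i = i) ∧
    (a < (b - 1) / T * T → i - a < b - (b - 1) / T * T →
      wrapProc T a b i * T + wrapTime T a b i = i - a + (b - 1) / T * T) ∧
    (a < (b - 1) / T * T → ¬ i - a < b - (b - 1) / T * T →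
      wrapProc T a b i * T + wrapTime T a b i + b = i + (b - 1) / T * T) := by
  obtain ⟨h3, h4, h5⟩ := wrap_bounds hT h1 h2
  unfold wrapProc wrapTime
  split_ifs <;> omega

/-- Two consecutive positions are processed in this order; if they are on different processors,
then the block contains the first slot `k * T` of the processor `k` of the former position, and
the end of this part of the block separates them in time. -/
theorem wrap_succ {T a b i : ℕ} (hT : b - a ≤ T) (h1 : a ≤ i) (h2 : i < b)
    (h3 : i + 1 < b) : wrapTime T a b i < wrapTime T a b (i + 1) ∧
    (wrapProc T a b i ≠ wrapProc T a b (i + 1) →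
      a ≤ wrapProc T a b i * T ∧ wrapProc T a b i * T < b ∧
      wrapTime T a b i < b - wrapProc T a b i * T ∧
      b - wrapProc T a b i * T ≤ wrapTime T a b (i + 1) ∧
      i + 1 + wrapProc T a b i * T = a + b ∧
      wrapProc T a b (i + 1) + 1 = wrapProc T a b i) := by
  obtain ⟨h4, h5, h6⟩ := wrap_bounds hT h1 h2
  unfold wrapProc wrapTime
  split_ifs <;> refine ⟨by omega, fun h => ?_⟩ <;> omega

/-- The identity and a cyclic shift are injective. -/
theorem wrap_injective {T a b i j : ℕ} (hT : b - a ≤ T) (h1 : a ≤ i) (h2 : i < b) (h1' : a ≤ j)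
    (h2' : j < b) (h : wrapProc T a b i * T + wrapTime T a b i
      = wrapProc T a b j * T + wrapTime T a b j) : i = j := by
  obtain ⟨h4, h5, h6⟩ := wrap_slot hT h1 h2
  obtain ⟨h4', h5', h6'⟩ := wrap_slot hT h1' h2'
  by_cases hc : (b - 1) / T * T ≤ a
  · omega
  · by_cases hi : i - a < b - (b - 1) / T * T <;> by_cases hj : j - a < b - (b - 1) / T * T <;>
      omega

end BSP

namespace BSP

/-! ### Validity, work and communication of arbitrary schedules. -/

namespace Schedule

variable {V : Type*} {P : ℕ} {G : Digraph V} {σ : Schedule V P} {M : CommModel}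

theorem ValidDirect.validFree (h : σ.ValidDirect G) : σ.ValidFree G := by
  refine ⟨fun u v huv => ?_, fun v p₁ p₂ s hm => ?_⟩
  · by_cases hp : σ.π u = σ.π v
    · exact .inl ⟨hp, (h.1 u v huv).1 hp⟩
    · obtain ⟨s, hs, hm⟩ := (h.1 u v huv).2 hp
      exact .inr ⟨_, s, hs, hm⟩
  · obtain ⟨rfl, hs⟩ := h.2 v p₁ p₂ s hm
    exact .inl ⟨rfl, hs⟩

/-- Direct validity is the strongest and free validity the weakest requirement. So schedules are
constructed for the former and lower bounds proved for the latter, which serves all four models at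
once. -/
theorem ValidDirect.valid (h : σ.ValidDirect G) (M : CommModel) : σ.Valid M G := by
  cases M
  exacts [h, h, h.validFree, h.validFree]

theorem Valid.validFree (h : σ.Valid M G) : σ.ValidFree G := by
  cases M
  exacts [ValidDirect.validFree h, ValidDirect.validFree h, h, h]

/-- By induction on supersteps: the sender computed the value by then, or received it in an earlier
communication step, which came after its computation. -/
theorem ValidFree.le_of_mem (h : σ.ValidFree G) (s : Fin σ.S) :
    ∀ v p₁ p₂, (v, p₁, p₂, s) ∈ σ.Γ → σ.τ v ≤ s := by
  induction s using WellFoundedLT.induction with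
  | ind s ih =>
    intro v p₁ p₂ hm
    rcases h.2 v p₁ p₂ s hm with h | ⟨p', s', hs, hm'⟩
    · exact h.2
    · exact (ih s' hs _ _ _ hm').trans hs.le

/-- A value that arrives by communication is usable only strictly after the superstep of its
computation, so inside one superstep it must be local. -/
theorem ValidFree.edge (h : σ.ValidFree G) {u v : V} (huv : G.Adj u v) :
    σ.τ u ≤ σ.τ v ∧ (σ.τ u = σ.τ v → σ.π u = σ.π v) := by
  rcases h.1 u v huv with h | ⟨p', s', hs, hm⟩
  · exact ⟨h.2, fun _ => h.1⟩
  · have := (h.le_of_mem s' _ _ _ hm).trans_lt hs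
    exact ⟨this.le, fun h => absurd h this.ne⟩

theorem ValidFree.reach (h : σ.ValidFree G) {u v : V} (huv : Relation.ReflTransGen G.Adj u v) :
    σ.τ u ≤ σ.τ v ∧ (σ.τ u = σ.τ v → σ.π u = σ.π v) := by
  induction huv with
  | refl => simp
  | tail _ hvw ih =>
    have := h.edge hvw
    exact ⟨ih.1.trans this.1, fun he => (ih.2 (le_antisymm ih.1 (he ▸ this.1))).trans
      (this.2 (le_antisymm this.1 (he ▸ ih.1)))⟩

variable [Fintype V] [DecidableEq V]

/-- The sum of the work costs of all supersteps. -/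
def totalWork (σ : Schedule V P) : ℕ :=
  ∑ s, Finset.univ.sup fun p => σ.workCost s p

/-- The communication cost of a superstep. -/
def commCost (M : CommModel) (σ : Schedule V P) (s : Fin σ.S) : ℕ :=
  Finset.univ.sup fun p => max (σ.sentCost M s p) (σ.recCost s p)

theorem cost_eq (M : CommModel) (g L : ℕ) (σ : Schedule V P) :
    σ.cost M g L = σ.totalWork + g * ∑ s, σ.commCost M s + σ.S * L := by
  simp [cost, stepCost, totalWork, commCost, Finset.sum_add_distrib, Finset.mul_sum]

theorem workCost_le_sup (σ : Schedule V P) (s : Fin σ.S) (p : Fin P) :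
    σ.workCost s p ≤ Finset.univ.sup fun p => σ.workCost s p :=
  Finset.le_sup (f := fun p => σ.workCost s p) (Finset.mem_univ p)

theorem card_step_eq (σ : Schedule V P) (s : Fin σ.S) :
    (Finset.univ.filter fun v => σ.τ v = s).card = ∑ p, σ.workCost s p := by
  rw [Finset.card_eq_sum_card_fiberwise (f := σ.π) (t := Finset.univ) (by simp)]
  refine Finset.sum_congr rfl fun p _ => ?_
  rw [workCost, Finset.filter_filter]
  congr 1
  ext v
  simp [and_comm]

theorem card_eq_sum_card_step (σ : Schedule V P) (X : Finset V) :
    X.card = ∑ s, (X.filter fun v => σ.τ v = s).card :=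
  Finset.card_eq_sum_card_fiberwise (f := σ.τ) (t := Finset.univ) (by simp)

theorem sum_workCost_le (σ : Schedule V P) (s : Fin σ.S) :
    ∑ p, σ.workCost s p ≤ P * Finset.univ.sup fun p => σ.workCost s p := by
  refine (Finset.sum_le_card_nsmul _ _ _ fun p _ => σ.workCost_le_sup s p).trans ?_
  simp

/-- In each superstep every processor does at most the maximal load. -/
theorem card_le_mul_totalWork (σ : Schedule V P) : Fintype.card V ≤ P * σ.totalWork := by
  rw [← Finset.card_univ, σ.card_eq_sum_card_step, totalWork, Finset.mul_sum]
  refine Finset.sum_le_sum fun s _ => ?_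
  rw [σ.card_step_eq]
  exact σ.sum_workCost_le s

/-- If any two nodes of a set that are computed in the same superstep are computed on the same
processor, then the size of the set is a lower bound for the work. -/
theorem card_le_totalWork (σ : Schedule V P) (X : Finset V)
    (h : ∀ u ∈ X, ∀ v ∈ X, σ.τ u = σ.τ v → σ.π u = σ.π v) : X.card ≤ σ.totalWork := by
  rw [σ.card_eq_sum_card_step, totalWork]
  refine Finset.sum_le_sum fun s _ => ?_
  rcases Finset.eq_empty_or_nonempty (X.filter fun v => σ.τ v = s) with he | ⟨v, hv⟩
  · simp [he]
  · refine le_trans (Finset.card_le_card fun u hu => ?_) (σ.workCost_le_sup s (σ.π v))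
    simp only [Finset.mem_filter, Finset.mem_univ, true_and] at hu hv ⊢
    exact ⟨h u hu.1 v hv.1 (hu.2.trans hv.2.symm), hu.2⟩

/-- All nodes in the superstep of the root are on the processor of the root. So that superstep, of
maximal load `1 + k`, handles at most `1 + k` nodes instead of `P * (1 + k)`; removing the root
leaves `k ≤ P * k`. -/
theorem card_le_of_root (hσ : σ.ValidFree G) {v₀ : V}
    (h₀ : ∀ v, Relation.ReflTransGen G.Adj v₀ v) :
    1 ≤ σ.totalWork ∧ Fintype.card V - 1 ≤ P * (σ.totalWork - 1) := by
  have hP : 0 < P := (σ.π v₀).pos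
  set s₀ := σ.τ v₀ with hs₀
  set m : Fin σ.S → ℕ := fun s => Finset.univ.sup fun p => σ.workCost s p with hm
  have h1 : 1 ≤ m s₀ := by
    refine le_trans ?_ (σ.workCost_le_sup s₀ (σ.π v₀))
    exact Finset.card_pos.2 ⟨v₀, by simp [hs₀]⟩
  have h2 : (Finset.univ.filter fun v => σ.τ v = s₀).card ≤ m s₀ := by
    refine le_trans (Finset.card_le_card fun v hv => ?_) (σ.workCost_le_sup s₀ (σ.π v₀))
    simp only [Finset.mem_filter, Finset.mem_univ, true_and] at hv ⊢
    exact ⟨((hσ.reach (h₀ v)).2 hv.symm).symm, hv⟩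
  have h3 : σ.totalWork = m s₀ + ∑ s ∈ Finset.univ.erase s₀, m s :=
    (Finset.add_sum_erase _ _ (Finset.mem_univ s₀)).symm
  have h4 : Fintype.card V ≤ m s₀ + P * ∑ s ∈ Finset.univ.erase s₀, m s := by
    rw [← Finset.card_univ, σ.card_eq_sum_card_step, Finset.mul_sum,
      ← Finset.add_sum_erase _ _ (Finset.mem_univ s₀)]
    refine add_le_add h2 (Finset.sum_le_sum fun s _ => ?_)
    rw [σ.card_step_eq]
    exact σ.sum_workCost_le s
  refine ⟨by omega, ?_⟩
  rw [h3]
  obtain ⟨k, hk⟩ := Nat.exists_eq_add_of_le h1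
  rw [hk] at h4 ⊢
  have : 1 + k + ∑ s ∈ Finset.univ.erase s₀, m s - 1 = k + ∑ s ∈ Finset.univ.erase s₀, m s := by
    omega
  rw [this, Nat.mul_add]
  have : k ≤ P * k := Nat.le_mul_of_pos_left k hP
  omega

/-- If every processor computes at most one node per time unit, and supersteps consist of time
units, then the work is at most the number of time units. -/
theorem totalWork_le (σ : Schedule V P) (T : ℕ) (time : V → ℕ) (step : ℕ → ℕ)
    (hinj : ∀ u v, σ.π u = σ.π v → time u = time v → u = v) (hT : ∀ v, time v < T)
    (hstep : ∀ v, (σ.τ v : ℕ) = step (time v)) : σ.totalWork ≤ T := by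
  calc σ.totalWork
      -- The nodes of one processor in superstep `s` have distinct times among those that belong to
      -- `s`; for different `s` these sets of times are disjoint.
      ≤ ∑ s : Fin σ.S, ((Finset.range T).filter fun t => step t = s).card := by
        refine Finset.sum_le_sum fun s _ => Finset.sup_le fun p _ => ?_
        refine Finset.card_le_card_of_injOn time (fun v hv => ?_) fun u hu v hv huv => ?_
        · simp only [Finset.coe_filter, Finset.mem_univ, true_and, Set.mem_ofPred_eq] at hv
          simp [hT v, ← hstep, hv.2]
        · simp only [Finset.coe_filter, Finset.mem_univ, true_and, Set.mem_ofPred_eq] at hu hv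
          exact hinj u v (hu.1.trans hv.1.symm) huv
    _ = (Finset.univ.biUnion fun s : Fin σ.S =>
          (Finset.range T).filter fun t => step t = s).card := by
        rw [Finset.card_biUnion]
        intro s _ s' _ hs
        rw [Function.onFun, Finset.disjoint_left]
        intro t ht ht'
        simp only [Finset.mem_filter] at ht ht'
        exact hs (Fin.ext (ht.2.symm.trans ht'.2))
    _ ≤ T := by
        refine (Finset.card_le_card (t := Finset.range T) fun t ht => ?_).trans (by simp)
        simp only [Finset.mem_biUnion, Finset.mem_filter] at ht
        exact ht.choose_spec.2.1

theorem recCost_le (σ : Schedule V P) (s : Fin σ.S) (p : Fin P) : σ.recCost s p ≤ σ.Γ.card :=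
  Finset.card_le_card (Finset.filter_subset _ _)

theorem sentCost_le (M : CommModel) (σ : Schedule V P) (s : Fin σ.S) (p : Fin P) :
    σ.sentCost M s p ≤ σ.Γ.card := by
  have h1 : (σ.Γ.filter fun c => c.2.1 = p ∧ c.2.2.2 = s).card ≤ σ.Γ.card :=
    Finset.card_le_card (Finset.filter_subset _ _)
  have h2 : (Finset.univ.filter fun v => ∃ p', (v, p, p', s) ∈ σ.Γ).card ≤ σ.Γ.card := by
    refine (Finset.card_le_card fun v hv => ?_).trans (Finset.card_image_le (f := fun c => c.1))
    simp only [Finset.mem_filter, Finset.mem_univ, true_and] at hv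
    obtain ⟨p', hp⟩ := hv
    exact Finset.mem_image.2 ⟨_, hp, rfl⟩
  cases M
  exacts [h1, h2, h1, h2]

theorem commCost_le (M : CommModel) (σ : Schedule V P) (s : Fin σ.S) :
    σ.commCost M s ≤ σ.Γ.card :=
  Finset.sup_le fun p _ => max_le (σ.sentCost_le M s p) (σ.recCost_le s p)

/-- The supersteps with communication. -/
def commSteps (σ : Schedule V P) : Finset (Fin σ.S) :=
  σ.Γ.image fun c => c.2.2.2

/-- A superstep with communication has a processor that receives something, so its communication
cost is at least `1`. -/
theorem card_commSteps_le (M : CommModel) (σ : Schedule V P) :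
    σ.commSteps.card ≤ ∑ s, σ.commCost M s := by
  calc σ.commSteps.card = ∑ s ∈ σ.commSteps, 1 := by simp
    _ ≤ ∑ s ∈ σ.commSteps, σ.commCost M s := by
        refine Finset.sum_le_sum fun s hs => ?_
        obtain ⟨c, hc, rfl⟩ := Finset.mem_image.1 hs
        refine le_trans ?_ (Finset.le_sup (Finset.mem_univ c.2.2.1))
        refine le_max_of_le_right (Finset.card_pos.2 ⟨c, by simp [hc]⟩)
    _ ≤ _ := Finset.sum_le_sum_of_subset (Finset.subset_univ _)

/-! ### Merging supersteps. -/

/-- Renumbering the supersteps. -/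
abbrev relabel (σ : Schedule V P) {K : ℕ} (f : Fin σ.S → Fin K) : Schedule V P where
  S := K
  π := σ.π
  τ v := f (σ.τ v)
  Γ := σ.Γ.image fun c => (c.1, c.2.1, c.2.2.1, f c.2.2.2)

theorem mem_relabel {K : ℕ} {f : Fin σ.S → Fin K} {v : V} {p₁ p₂ : Fin P} {s : Fin K} :
    (v, p₁, p₂, s) ∈ (σ.relabel f).Γ ↔ ∃ s', (v, p₁, p₂, s') ∈ σ.Γ ∧ f s' = s := by
  refine Finset.mem_image.trans ⟨?_, ?_⟩
  · simp only [Prod.mk.injEq]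
    rintro ⟨⟨_, _, _, s'⟩, h, rfl, rfl, rfl, rfl⟩
    exact ⟨s', h, rfl⟩
  · rintro ⟨s', h, rfl⟩
    exact ⟨_, h, rfl⟩

/-- Merging is harmless unless it puts a transfer and a later use into the same superstep;
strictness after each superstep with communication prevents this. -/
theorem Valid.relabel (h : σ.Valid M G) {K : ℕ} {f : Fin σ.S → Fin K} (hf : Monotone f)
    (hf' : ∀ s ∈ σ.commSteps, ∀ s', s < s' → f s < f s') : (σ.relabel f).Valid M G := by
  have hlt : ∀ {v p₁ p₂ s}, (v, p₁, p₂, s) ∈ σ.Γ → ∀ s', s < s' → f s < f s' :=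
    fun hm => hf' _ (Finset.mem_image_of_mem (fun c => c.2.2.2) hm)
  have hD : σ.ValidDirect G → (σ.relabel f).ValidDirect G := by
    refine fun h => ⟨fun u v huv => ⟨fun hp => hf ((h.1 u v huv).1 hp), fun hp => ?_⟩,
      fun v p₁ p₂ s hm => ?_⟩
    · obtain ⟨s, hs, hm⟩ := (h.1 u v huv).2 hp
      exact ⟨f s, hlt hm _ hs, mem_relabel.2 ⟨s, hm, rfl⟩⟩
    · obtain ⟨s', hm', rfl⟩ := mem_relabel.1 hm
      exact ⟨(h.2 _ _ _ _ hm').1, hf (h.2 _ _ _ _ hm').2⟩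
  have hpres : ∀ v p s, σ.Present v p s → (σ.relabel f).Present v p (f s) := by
    rintro v p s (⟨h1, h2⟩ | ⟨p', s', hs, hm⟩)
    · exact .inl ⟨h1, hf h2⟩
    · exact .inr ⟨p', f s', hlt hm _ hs, mem_relabel.2 ⟨s', hm, rfl⟩⟩
  have hF : σ.ValidFree G → (σ.relabel f).ValidFree G := by
    refine fun h => ⟨fun u v huv => hpres _ _ _ (h.1 u v huv), fun v p₁ p₂ s hm => ?_⟩
    obtain ⟨s', hm', rfl⟩ := mem_relabel.1 hm
    exact hpres _ _ _ (h.2 _ _ _ _ hm')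
  cases M
  exacts [hD h, hD h, hF h, hF h]

theorem card_filter_relabel_le (σ : Schedule V P) {K : ℕ} (f : Fin σ.S → Fin K) (j : Fin K)
    (q : V × Fin P × Fin P → Prop) [DecidablePred q] :
    ((σ.relabel f).Γ.filter fun c => q (c.1, c.2.1, c.2.2.1) ∧ c.2.2.2 = j).card ≤
      ∑ s with f s = j,
        (σ.Γ.filter fun c => q (c.1, c.2.1, c.2.2.1) ∧ c.2.2.2 = s).card := by
  refine le_trans ?_ Finset.card_biUnion_le
  refine le_trans (Finset.card_le_card (t := Finset.image
    (fun c => (c.1, c.2.1, c.2.2.1, f c.2.2.2)) _) ?_) Finset.card_image_le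
  rintro ⟨v, p₁, p₂, s⟩ hc
  obtain ⟨hm₁, hq, rfl⟩ := Finset.mem_filter.1 hc
  obtain ⟨s', hm, rfl⟩ := mem_relabel.1 hm₁
  refine Finset.mem_image.2 ⟨(v, p₁, p₂, s'), ?_, rfl⟩
  simp [hm, hq]

/-- Loads and message counts are subadditive under merging, and the maximum of a sum is at most the
sum of the maxima. The latency is set to `0`, the only case in which merging is used. -/
theorem stepCost_relabel_le (M : CommModel) (g : ℕ) (σ : Schedule V P) {K : ℕ}
    (f : Fin σ.S → Fin K) (j : Fin K) :
    (σ.relabel f).stepCost M g 0 j ≤ ∑ s with f s = j, σ.stepCost M g 0 s := by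
  have hw : ∀ p, (σ.relabel f).workCost j p ≤ ∑ s with f s = j, σ.workCost s p := by
    intro p
    refine le_trans (Finset.card_le_card fun v hv => ?_) Finset.card_biUnion_le
    simp only [relabel, Finset.mem_filter, Finset.mem_univ, true_and] at hv
    simp [hv.1, hv.2]
  have hr : ∀ p, (σ.relabel f).recCost j p ≤ ∑ s with f s = j, σ.recCost s p := fun p =>
    σ.card_filter_relabel_le f j fun c => c.2.2 = p
  have hs : ∀ p, (σ.relabel f).sentCost M j p ≤ ∑ s with f s = j, σ.sentCost M s p := by
    intro p
    have h1 := σ.card_filter_relabel_le f j fun c => c.2.1 = p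
    have h2 : (Finset.univ.filter fun v => ∃ p', (v, p, p', j) ∈ (σ.relabel f).Γ).card ≤
        ∑ s with f s = j, (Finset.univ.filter fun v => ∃ p', (v, p, p', s) ∈ σ.Γ).card := by
      refine le_trans (Finset.card_le_card fun v hv => ?_) Finset.card_biUnion_le
      obtain ⟨-, p', hv⟩ := Finset.mem_filter.1 hv
      obtain ⟨s', hm, hs⟩ := mem_relabel.1 hv
      simp only [Finset.mem_biUnion, Finset.mem_filter, Finset.mem_univ, true_and]
      exact ⟨s', hs, p', hm⟩
    cases M
    exacts [h1, h2, h1, h2]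
  simp only [stepCost, add_zero, Finset.sum_add_distrib, ← Finset.mul_sum]
  gcongr
  · refine Finset.sup_le fun p _ => (hw p).trans (Finset.sum_le_sum fun s _ => ?_)
    exact σ.workCost_le_sup s p
  · refine Finset.sup_le fun p _ => max_le ((hs p).trans ?_) ((hr p).trans ?_) <;>
      refine Finset.sum_le_sum fun s _ => le_trans ?_ (Finset.le_sup (Finset.mem_univ p))
    exacts [le_max_left _ _, le_max_right _ _]

/-- Supersteps without communication can be merged with the next superstep. -/
theorem Valid.exists_compress (h : σ.Valid M G) (g : ℕ) : ∃ σ' : Schedule V P, σ'.Valid M G ∧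
    σ'.S = σ.commSteps.card + 1 ∧ σ'.cost M g 0 ≤ σ.cost M g 0 := by
  -- The new number of `s` counts the supersteps with communication strictly before `s`. It
  -- increases exactly after each of these.
  let f : Fin σ.S → Fin (σ.commSteps.card + 1) := fun s =>
    ⟨(σ.commSteps.filter fun s' => s' < s).card,
      Nat.lt_succ_of_le (Finset.card_le_card (Finset.filter_subset _ _))⟩
  refine ⟨σ.relabel f, h.relabel (fun s s' hs => ?_) (fun s hm s' hs => ?_), rfl, ?_⟩
  · refine Finset.card_le_card fun x hx => ?_
    simp only [Finset.mem_filter] at hx ⊢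
    exact ⟨hx.1, hx.2.trans_le hs⟩
  · refine Finset.card_lt_card ⟨fun x hx => ?_, fun hsub => ?_⟩
    · simp only [Finset.mem_filter] at hx ⊢
      exact ⟨hx.1, hx.2.trans hs⟩
    · simpa using hsub (Finset.mem_filter.2 ⟨hm, hs⟩)
  · refine (Finset.sum_le_sum fun j _ => σ.stepCost_relabel_le M g f j).trans ?_
    exact (Finset.sum_fiberwise _ _ _).le

end Schedule

end BSP

/-! ### Chain orders: lower bounds on the work, and the wrap-around schedule. -/

namespace BSP

/-- The nodes of `G` are numbered by `r` such that an edge either leads from a node to the next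
one, when the latter satisfies `cont`, or, if `t₀ = 1`, from the first node to any other node that
does not satisfy `cont`. -/
structure ChainOrder {V : Type*} (G : Digraph V) (n t₀ : ℕ) (r : V → ℕ) (cont : ℕ → Prop) :
    Prop where
  le_one : t₀ ≤ 1
  inj : Function.Injective r
  lt : ∀ v, r v < n
  surj : ∀ i < n, ∃ v, r v = i
  not_cont : ∀ i ≤ t₀, ¬ cont i
  adj : ∀ u v, G.Adj u v ↔
    (cont (r v) ∧ r u + 1 = r v) ∨ (t₀ = 1 ∧ ¬ cont (r v) ∧ 0 < r v ∧ r u = 0)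

namespace ChainOrder

variable {V : Type*} {G : Digraph V} {n t₀ : ℕ} {r : V → ℕ} {cont : ℕ → Prop}

theorem card_eq (o : ChainOrder G n t₀ r cont) [Fintype V] : Fintype.card V = n := by
  have : Function.Bijective fun v => (⟨r v, o.lt v⟩ : Fin n) :=
    ⟨fun u v h => o.inj (Fin.mk.inj_iff.1 h), fun i => by
      obtain ⟨v, hv⟩ := o.surj i i.2
      exact ⟨v, Fin.ext hv⟩⟩
  simpa using Fintype.card_of_bijective this

theorem reach_of_block (o : ChainOrder G n t₀ r cont) {a b : ℕ} (hb : IsBlock cont n a b) {u v : V}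
    (h1 : a ≤ r u)
    (h2 : r u ≤ r v) (h3 : r v < b) : Relation.ReflTransGen G.Adj u v := by
  obtain ⟨d, hd⟩ := Nat.exists_eq_add_of_le h2
  induction d generalizing v with
  | zero => rw [o.inj hd]
  | succ d ih =>
    obtain ⟨w, hw⟩ := o.surj (r u + d) (by have := hb.le; omega)
    exact (ih (by omega) (by omega) hw).tail
      ((o.adj w v).2 (.inl ⟨hb.run _ (by omega) h3, by omega⟩))

theorem reach_of_root (o : ChainOrder G n t₀ r cont) (h : t₀ = 1) {u v : V} (hu : r u = 0) :
    Relation.ReflTransGen G.Adj u v := by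
  obtain ⟨a, b, hb, h1, h2⟩ := exists_isBlock (o.not_cont 0 (by omega)) (o.lt v)
  obtain ⟨w, hw⟩ := o.surj a (by have := hb.le; omega)
  have hwv := o.reach_of_block hb hw.ge (hw.trans_le h1) h2
  rcases Nat.eq_zero_or_pos a with ha | ha
  · rwa [o.inj (hu.trans (hw.trans ha).symm)]
  · exact hwv.head ((o.adj u w).2 (.inr ⟨h, by rw [hw]; exact hb.first, by omega, hu⟩))

/-- Position `t₀` starts a new block, so no block contains both the root and a later position when
`t₀ = 1`. -/
theorem le_first (o : ChainOrder G n t₀ r cont) {a b i : ℕ} (hb : IsBlock cont n a b)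
    (h2 : i < b) (h3 : t₀ ≤ i) : t₀ ≤ a := by
  by_contra h
  exact o.not_cont t₀ le_rfl (hb.run _ (by omega) (by omega))

variable [Fintype V] [DecidableEq V] {P : ℕ}

/-- Lower bounds for the work of a valid schedule. -/
theorem bounds (o : ChainOrder G n t₀ r cont) {σ : Schedule V P} (h : σ.ValidFree G) :
    (0 < n → t₀ ≤ σ.totalWork) ∧ n - t₀ ≤ P * (σ.totalWork - t₀) ∧
      ∀ a b, IsBlock cont n a b → t₀ ≤ a → b - a ≤ σ.totalWork - t₀ := by
  have hle := o.le_one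
  -- Nodes that are pairwise comparable under reachability share a processor whenever they share a
  -- superstep.
  have hX : ∀ X : Finset V, (∀ u ∈ X, ∀ v ∈ X, r u ≤ r v → Relation.ReflTransGen G.Adj u v) →
      X.card ≤ σ.totalWork := by
    refine fun X hX => σ.card_le_totalWork X fun u hu v hv huv => ?_
    rcases le_total (r u) (r v) with hle | hle
    · exact (h.reach (hX u hu v hv hle)).2 huv
    · exact ((h.reach (hX v hv u hu hle)).2 huv.symm).symm
  have hcard : ∀ s : Finset ℕ, (∀ i ∈ s, i < n) →
      s.card = (Finset.univ.filter fun v => r v ∈ s).card := by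
    intro s hs
    rw [← Finset.card_image_of_injective _ o.inj]
    congr 1
    ext i
    simp only [Finset.mem_image, Finset.mem_filter, Finset.mem_univ, true_and]
    constructor
    · intro hi
      obtain ⟨v, rfl⟩ := o.surj i (hs i hi)
      exact ⟨v, hi, rfl⟩
    · rintro ⟨v, hv, rfl⟩
      exact hv
  refine ⟨fun hn => ?_, ?_, fun a b hb hta => ?_⟩
  · obtain ⟨v, -⟩ := o.surj 0 (by omega)
    refine hle.trans (le_trans ?_ (hX {v} ?_))
    · simp
    · simp only [Finset.mem_singleton]
      rintro u rfl v rfl _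
      exact .refl
  · rcases Nat.eq_zero_or_pos t₀ with ht | ht
    · simpa [ht, o.card_eq] using σ.card_le_mul_totalWork
    · obtain rfl : t₀ = 1 := by omega
      rcases Nat.eq_zero_or_pos n with hn | hn
      · simp [hn]
      · obtain ⟨v₀, hv₀⟩ := o.surj 0 hn
        simpa [o.card_eq] using (σ.card_le_of_root h fun v => o.reach_of_root rfl (v := v) hv₀).2
  · have hbn := hb.le
    have hab := hb.lt
    have hd : Disjoint (Finset.range t₀) (Finset.Ico a b) := by
      rw [Finset.disjoint_left]
      intro i h1 h2
      simp only [Finset.mem_range, Finset.mem_Ico] at h1 h2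
      omega
    -- The root, if present, followed by one chain is totally ordered by reachability.
    have h1 : t₀ + (b - a) = (Finset.range t₀ ∪ Finset.Ico a b).card := by
      rw [Finset.card_union_of_disjoint hd]; simp
    rw [hcard _ (fun i hi => by
      simp only [Finset.mem_union, Finset.mem_range, Finset.mem_Ico] at hi; omega)] at h1
    have := h1.trans_le (hX _ fun u hu v hv huv => ?_)
    · omega
    · simp only [Finset.mem_union, Finset.mem_range, Finset.mem_Ico, Finset.mem_filter,
        Finset.mem_univ, true_and] at hu hv
      by_cases ht : r u < t₀
      · exact o.reach_of_root (by omega) (by omega)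
      · exact o.reach_of_block hb (by omega) huv (by omega)

/-- The wrap-around schedule. -/
theorem exists_wrap (o : ChainOrder G n t₀ r cont) (hP : 1 ≤ P) (T : ℕ) (hN : n - t₀ ≤ P * T)
    (hT : ∀ a b, IsBlock cont n a b → t₀ ≤ a → b - a ≤ T) :
    ∃ σ : Schedule V P, σ.ValidDirect G ∧ σ.S = P + 2 ∧ σ.totalWork ≤ T + t₀ ∧
      σ.Γ.card ≤ 2 * P := by
  classical
  have hle := o.le_one
  have hex : ∀ i, ∃ a b, i < n → IsBlock cont n a b ∧ a ≤ i ∧ i < b := fun i => by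
    by_cases hi : i < n
    · obtain ⟨a, b, h⟩ := exists_isBlock (o.not_cont 0 (by omega)) hi
      exact ⟨a, b, fun _ => h⟩
    · exact ⟨0, 0, fun h => absurd h hi⟩
  choose A B hAB using hex
  -- Blocks relative to the first position after the root.
  set p : V → ℕ := fun v => wrapProc T (A (r v) - t₀) (B (r v) - t₀) (r v - t₀) with hp
  set t : V → ℕ := fun v => wrapTime T (A (r v) - t₀) (B (r v) - t₀) (r v - t₀) with ht
  -- If the block over slot `k * T` is split there, its early part occupies processor `k` before
  -- time `cut k`, and its late part runs on processor `k - 1` from `cut k` on. A superstep boundary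
  -- at `cut k` thus leaves room for the transfer.
  set cut : ℕ → ℕ := fun k => B (k * T + t₀) - t₀ - k * T with hcut
  have hblk : ∀ v, t₀ ≤ r v → IsBlock cont n (A (r v)) (B (r v)) ∧ t₀ ≤ A (r v) ∧
      A (r v) ≤ r v ∧ r v < B (r v) ∧ B (r v) ≤ n ∧
      (B (r v) - t₀) - (A (r v) - t₀) ≤ T := by
    intro v hv
    obtain ⟨h1, h2, h3⟩ := hAB (r v) (o.lt v)
    have h4 := o.le_first h1 h3 hv
    have h5 := hT _ _ h1 h4
    exact ⟨h1, h4, h2, h3, h1.le, by omega⟩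
  have hpP : ∀ v, t₀ ≤ r v → p v < P := by
    intro v hv
    obtain ⟨-, h1, h2, h3, h4, h5⟩ := hblk v hv
    refine (wrapProc_le _ _ _ _).trans_lt ?_
    rw [Nat.div_lt_iff_lt_mul (by omega)]
    omega
  have htT : ∀ v, t₀ ≤ r v → t v < T := by
    intro v hv
    obtain ⟨-, h1, h2, h3, h4, h5⟩ := hblk v hv
    exact wrapTime_lt h5 (by omega) (by omega)
  have hinj : ∀ u v, t₀ ≤ r u → t₀ ≤ r v → p u = p v → t u = t v → u = v := by
    intro u v hu hv h1 h2
    obtain ⟨hb, hb1, hb2, hb3, hb4, hb5⟩ := hblk u hu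
    obtain ⟨hb', hb1', hb2', hb3', hb4', hb5'⟩ := hblk v hv
    obtain ⟨⟨h3, h4⟩, -⟩ := wrap_slot (i := r u - t₀) hb5 (by omega) (by omega)
    obtain ⟨⟨h3', h4'⟩, -⟩ := wrap_slot (i := r v - t₀) hb5' (by omega) (by omega)
    simp only [hp, ht] at h1 h2
    have he : ∀ {x y x' y' : ℕ}, x = x' → y = y' → x * T + y = x' * T + y' := by
      rintro _ _ _ _ rfl rfl; rfl
    have hs := he h1 h2
    -- A common slot lies in the blocks of both nodes, so these blocks coincide.
    obtain ⟨hA, hB⟩ := hb.unique hb' (i := wrapProc T (A (r u) - t₀) (B (r u) - t₀) (r u - t₀) * T +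
      wrapTime T (A (r u) - t₀) (B (r u) - t₀) (r u - t₀) + t₀) (by omega) (by omega) (by omega)
      (by omega)
    rw [← hA, ← hB] at hs hb5'
    rw [← hA] at hb2'
    rw [← hB] at hb3'
    have := wrap_injective hb5 (by omega) (by omega) (by omega) (by omega) hs
    exact o.inj (by omega)
  have hsucc : ∀ u v, t₀ ≤ r u → cont (r v) → r u + 1 = r v → t u < t v ∧
      (p u ≠ p v → t u < cut (p u) ∧ cut (p u) ≤ t v ∧ p v + 1 = p u ∧
        p u * T + t₀ < n ∧ r u + 1 + p u * T = A (p u * T + t₀) + B (p u * T + t₀) - t₀) := by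
    intro u v hu hc huv
    obtain ⟨hb, hb1, hb2, hb3, hb4, hb5⟩ := hblk u hu
    obtain ⟨hb', hb1', hb2', hb3', hb4', hb5'⟩ := hblk v (by omega)
    have hlt : r u + 1 < B (r u) := by
      by_contra hlt
      have hBe : B (r u) = r v := by omega
      exact hb.last (by have := o.lt v; omega) (hBe ▸ hc)
    obtain ⟨hA, hB⟩ := hb.unique hb' (i := r v) (by omega) (by omega) hb2' hb3'
    obtain ⟨h1, h2⟩ := wrap_succ (i := r u - t₀) hb5 (by omega) (by omega) (by omega)
    have hi : r u - t₀ + 1 = r v - t₀ := by omega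
    rw [hi] at h1 h2
    have htv : t v = wrapTime T (A (r u) - t₀) (B (r u) - t₀) (r v - t₀) := by
      simp only [ht, hA, hB]
    have hpv : p v = wrapProc T (A (r u) - t₀) (B (r u) - t₀) (r v - t₀) := by
      simp only [hp, hA, hB]
    rw [← htv] at h1 h2
    rw [← hpv] at h2
    refine ⟨h1, fun hne => ?_⟩
    obtain ⟨h3, h4, h5, h6, h7, h8⟩ := h2 hne
    change _ ≤ p u * T at h3
    change p u * T < _ at h4
    change t u < _ - p u * T at h5
    change _ - p u * T ≤ _ at h6
    change _ + p u * T = _ at h7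
    change _ = p u at h8
    have hlt : p u * T + t₀ < n := by omega
    obtain ⟨hb'', h1', h2'⟩ := hAB _ hlt
    obtain ⟨hA', hB'⟩ := hb.unique hb'' (i := p u * T + t₀) (by omega) (by omega) h1' h2'
    simp only [hcut]
    rw [← hB', ← hA']
    exact ⟨h5, h6, h8, hlt, by omega⟩
  -- The supersteps are separated by the cuts.
  set step : ℕ → ℕ := fun x => ((Finset.range P).filter fun k => cut k ≤ x).card with hstep
  have hstepP : ∀ x, step x ≤ P := fun x =>
    (Finset.card_le_card (Finset.filter_subset _ _)).trans (by simp)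
  have hstepm : ∀ x y, x ≤ y → step x ≤ step y := fun x y hxy =>
    Finset.card_le_card fun k hk => by
      simp only [Finset.mem_filter] at hk ⊢
      exact ⟨hk.1, hk.2.trans hxy⟩
  have hsteps : ∀ x y k, k < P → x < cut k → cut k ≤ y → step x < step y := by
    intro x y k hk h1 h2
    refine Finset.card_lt_card ⟨fun j hj => ?_, fun hsub => ?_⟩
    · simp only [Finset.mem_filter] at hj ⊢
      exact ⟨hj.1, by omega⟩
    · have := hsub (Finset.mem_filter.2 ⟨Finset.mem_range.2 hk, h2⟩)
      simp only [Finset.mem_filter] at this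
      omega
  let π : V → Fin P := fun v => if h : t₀ ≤ r v then ⟨p v, hpP v h⟩ else ⟨0, hP⟩
  -- A root occupies superstep `0` alone and shifts everything else by `t₀ ≤ 1`. With up to `P`
  -- cuts, this gives `P + 2` supersteps.
  let τ : V → Fin (P + 2) := fun v => if t₀ ≤ r v then ⟨t₀ + step (t v), by
    have := hstepP (t v); omega⟩ else ⟨0, by omega⟩
  have hπ : ∀ v, t₀ ≤ r v → (π v : ℕ) = p v := fun v h => by simp [π, h]
  have hτ : ∀ v, t₀ ≤ r v → (τ v : ℕ) = t₀ + step (t v) := fun v h => by simp [τ, h]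
  have hτ0 : ∀ v, ¬ t₀ ≤ r v → (τ v : ℕ) = 0 := fun v h => by simp [τ, h]
  have hedge : ∀ u v, G.Adj u v → τ u ≤ τ v ∧ (π u ≠ π v → τ u < τ v) := by
    intro u v huv
    rcases (o.adj u v).1 huv with ⟨hc, he⟩ | ⟨h1, hc, hv, hu⟩
    · have hu : t₀ ≤ r u := by
        by_contra hu
        exact o.not_cont (r v) (by omega) hc
      obtain ⟨h1, h2⟩ := hsucc u v hu hc he
      refine ⟨?_, fun hne => ?_⟩
      · rw [Fin.le_def, hτ u hu, hτ v (by omega)]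
        have := hstepm _ _ h1.le
        omega
      · have hne' : p u ≠ p v := by
          rw [← hπ u hu, ← hπ v (by omega)]
          exact fun h => hne (Fin.ext h)
        obtain ⟨h3, h4, -⟩ := h2 hne'
        rw [Fin.lt_def, hτ u hu, hτ v (by omega)]
        have := hsteps _ _ _ (hpP u hu) h3 h4
        omega
    · have : τ u < τ v := by
        rw [Fin.lt_def, hτ0 u (by omega), hτ v (by omega)]
        omega
      exact ⟨this.le, fun _ => this⟩
  -- Each value is sent to the processors of its remote successors in the superstep of its
  -- computation.
  let σ : Schedule V P := ⟨P + 2, π, τ, Finset.univ.filter fun c =>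
    ∃ v, G.Adj c.1 v ∧ π c.1 ≠ π v ∧ c.2.1 = π c.1 ∧ c.2.2.1 = π v ∧ c.2.2.2 = τ c.1⟩
  have hmem : ∀ c, c ∈ σ.Γ ↔
    ∃ v, G.Adj c.1 v ∧ π c.1 ≠ π v ∧ c.2.1 = π c.1 ∧ c.2.2.1 = π v ∧ c.2.2.2 = τ c.1 := fun c =>
    Finset.mem_filter.trans (by simp)
  refine ⟨σ, ⟨fun u v huv => ⟨fun _ => (hedge u v huv).1, fun hne => ?_⟩,
    fun v p₁ p₂ s hm => ?_⟩, rfl, ?_, ?_⟩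
  · exact ⟨τ u, (hedge u v huv).2 hne, (hmem _).2 ⟨v, huv, hne, rfl, rfl, rfl⟩⟩
  · obtain ⟨w, -, -, h1, -, h2⟩ := (hmem _).1 hm
    exact ⟨h1, h2.ge⟩
  · refine σ.totalWork_le _ (fun v => if t₀ ≤ r v then t₀ + t v else 0)
      (fun x => if x < t₀ then 0 else t₀ + step (x - t₀)) (fun u v h1 h2 => ?_) (fun v => ?_)
      fun v => ?_
    · by_cases hu : t₀ ≤ r u <;> by_cases hv : t₀ ≤ r v <;> simp only [hu, hv, if_true, if_false]
        at h2
      · refine hinj u v hu hv ?_ (by omega)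
        rw [← hπ u hu, ← hπ v hv]
        exact congrArg Fin.val h1
      · omega
      · omega
      · exact o.inj (by omega)
    · by_cases hv : t₀ ≤ r v
      · have := htT v hv
        simp only [hv, if_true]
        omega
      · simp only [hv, if_false]
        omega
    · by_cases hv : t₀ ≤ r v
      · simp only [hv, if_true]
        rw [if_neg (by omega), Nat.add_sub_cancel_left]
        exact hτ v hv
      · simp only [hv, if_false]
        rw [if_pos (by omega)]
        exact hτ0 v hv
  -- A communication step of the root is charged to its target, any other one to its source. Each is
  -- charged at most once, hence `2 * P`.
  · have hcard : Fintype.card (Bool × Fin P) = 2 * P := by simp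
    rw [← hcard, ← Finset.card_univ]
    refine Finset.card_le_card_of_injOn
      (fun c => if t₀ ≤ r c.1 then (true, c.2.1) else (false, c.2.2.1)) (by simp) ?_
    rintro ⟨u, p₁, p₂, s⟩ hm ⟨u', p₁', p₂', s'⟩ hm' heq
    replace hm := (hmem _).1 hm
    replace hm' := (hmem _).1 hm'
    dsimp only at hm hm' heq
    obtain ⟨v, huv, hne, rfl, rfl, rfl⟩ := hm
    obtain ⟨v', huv', hne', rfl, rfl, rfl⟩ := hm'
    -- The source processor determines the sender: it is the last node of the early part of the
    -- block over its first slot. The target is the processor before it.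
    have key : ∀ u v, t₀ ≤ r u → G.Adj u v → π u ≠ π v → (π v : ℕ) + 1 = π u ∧
        r u + 1 + π u * T = A (π u * T + t₀) + B (π u * T + t₀) - t₀ := by
      intro u v hu huv hne
      rcases (o.adj u v).1 huv with ⟨hc, he⟩ | ⟨h1, hc, hv, h0⟩
      · have hne' : p u ≠ p v := by
          rw [← hπ u hu, ← hπ v (by omega)]
          exact fun h => hne (Fin.ext h)
        obtain ⟨-, -, h1, -, h2⟩ := (hsucc u v hu hc he).2 hne'
        rw [hπ u hu, hπ v (by omega)]
        exact ⟨h1, h2⟩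
      · omega
    by_cases hu : t₀ ≤ r u <;> by_cases hu' : t₀ ≤ r u' <;>
      simp only [hu, hu', if_true, if_false, Prod.mk.injEq, true_and, Bool.true_eq_false,
        Bool.false_eq_true, false_and] at heq
    · obtain ⟨h1, h2⟩ := key u v hu huv hne
      obtain ⟨h1', h2'⟩ := key u' v' hu' huv' hne'
      rw [heq] at h1 h2
      obtain rfl : u = u' := o.inj (by omega)
      have : π v = π v' := Fin.ext (by omega)
      simp [this]
    · obtain rfl : u = u' := o.inj (by omega)
      simp [heq]

/-- Some optimal schedule has a bounded number of supersteps. -/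
theorem exists_bounded (o : ChainOrder G n t₀ r cont) (M : CommModel) (g L : ℕ) {σ : Schedule V P}
    (h : σ.Valid M G)
    (hn : 0 < n) : ∃ σ' : Schedule V P, σ'.Valid M G ∧
      σ'.S ≤ (P + 2) * (g * (2 * P) + L + 1) + 1 ∧ σ'.cost M g L ≤ σ.cost M g L := by
  have hP : 1 ≤ P := by
    obtain ⟨v, -⟩ := o.surj 0 (by omega)
    exact (σ.π v).pos
  obtain ⟨hb1, hb2, hb3⟩ := o.bounds h.validFree
  obtain ⟨σ₁, hσ₁, hS, hW, hΓ⟩ := o.exists_wrap hP (σ.totalWork - t₀) hb2 hb3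
  have hb1 := hb1 hn
  set K := (P + 2) * (g * (2 * P) + L) with hK
  have hK' : (P + 2) * (g * (2 * P) + L + 1) = K + (P + 2) := by rw [hK]; ring
  -- `K` bounds the overhead of the wrap-around schedule: `P + 2` supersteps, each with
  -- communication cost at most `2 * P` and latency `L`.
  have hc₁ : σ₁.cost M g L ≤ σ.totalWork + K := by
    have h1 : ∑ s, σ₁.commCost M s ≤ (P + 2) * (2 * P) := by
      refine (Finset.sum_le_card_nsmul _ _ (2 * P) fun s _ =>
        (σ₁.commCost_le M s).trans hΓ).trans ?_
      simp [hS]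
    have h4 : σ₁.S * L = (P + 2) * L := by rw [hS]
    rw [Schedule.cost_eq]
    have h2 := Nat.mul_le_mul_left g h1
    have h3 : K = g * ((P + 2) * (2 * P)) + (P + 2) * L := by rw [hK]; ring
    omega
  have hc := σ.cost_eq M g L
  -- Either the wrap-around schedule is no worse than `σ`, or communication and latency of `σ`
  -- together cost less than `K`.
  by_cases hlarge : σ.totalWork + K ≤ σ.cost M g L
  · exact ⟨σ₁, hσ₁.valid M, by omega, hc₁.trans hlarge⟩
  rcases Nat.eq_zero_or_pos L with rfl | hL
  · rcases Nat.eq_zero_or_pos g with rfl | hg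
    -- Without communication price and latency `K = 0`, and the cost is the work, which contradicts
    -- the second alternative.
    · simp at hK
      omega
    · obtain ⟨σ', h1, h2, h3⟩ := h.exists_compress g
      refine ⟨σ', h1, ?_, h3⟩
      have h4 := σ.card_commSteps_le M
      have h5 : ∑ s, σ.commCost M s ≤ g * ∑ s, σ.commCost M s := Nat.le_mul_of_pos_left _ hg
      omega
  · refine ⟨σ, h, ?_, le_rfl⟩
    have : σ.S ≤ σ.S * L := Nat.le_mul_of_pos_right _ hL
    omega

end ChainOrder

end BSP

namespace BSP

/-! ### Numbering the nodes along the chains -/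

section order

open Classical in
/-- The predecessor of `v` with respect to the edges `E`, or `v` itself if there is none. -/
noncomputable def chainPred (n : ℕ) (E : ℕ → ℕ → Prop) (v : ℕ) : ℕ :=
  if ∃ u < n, E u v then Nat.findGreatest (fun u => E u v) n else v

/-- The first node of the chain of `v`. -/
noncomputable def chainHead (n : ℕ) (E : ℕ → ℕ → Prop) (v : ℕ) : ℕ :=
  (chainPred n E)^[n] v

open Classical in
/-- The position of `v` in its chain. -/
noncomputable def chainDepth (n : ℕ) (E : ℕ → ℕ → Prop) (v : ℕ) : ℕ :=
  ∑ j ∈ Finset.range n, if ∃ u < n, E u ((chainPred n E)^[j] v) then 1 else 0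

/-- The key by which the nodes are sorted. -/
noncomputable def chainKey (n : ℕ) (E : ℕ → ℕ → Prop) (root v : ℕ) : ℕ :=
  if v = root then 0 else chainHead n E v * (n + 1) + chainDepth n E v + 1

/-- The position of `v` in the order of the keys. -/
noncomputable def chainRank (n : ℕ) (E : ℕ → ℕ → Prop) (root v : ℕ) : ℕ :=
  ∑ u ∈ Finset.range n, if chainKey n E root u < chainKey n E root v then 1 else 0

open Classical in
/-- The node at position `i`. -/
noncomputable def chainNode (n : ℕ) (E : ℕ → ℕ → Prop) (root i : ℕ) : ℕ :=
  Nat.findGreatest (fun v => v < n ∧ chainRank n E root v = i) n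

/-- The edges `E` on the numbers below `n` form chains that do not contain `root`. -/
structure IsChains (n : ℕ) (E : ℕ → ℕ → Prop) (root : ℕ) : Prop where
  left_lt : ∀ {u v}, E u v → u < n
  right_lt : ∀ {u v}, E u v → v < n
  left_ne : ∀ {u v}, E u v → u ≠ root
  right_ne : ∀ {u v}, E u v → v ≠ root
  left_unique : ∀ {u u' v}, E u v → E u' v → u = u'
  right_unique : ∀ {u v v'}, E u v → E u v' → v = v'
  acyclic : ∀ v, ¬ Relation.TransGen E v v

namespace IsChains

variable {n root u v i : ℕ} {E : ℕ → ℕ → Prop}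

theorem pred_eq (h : IsChains n E root) (huv : E u v) : chainPred n E v = u := by
  classical
  have : E (Nat.findGreatest (fun u => E u v) n) v :=
    Nat.findGreatest_spec (P := fun u => E u v) (h.left_lt huv).le huv
  rw [chainPred, if_pos ⟨u, h.left_lt huv, huv⟩]
  exact h.left_unique this huv

theorem pred_eq_self (hv : ¬ ∃ u < n, E u v) : chainPred n E v = v := if_neg hv

theorem iterate_eq_self (hv : ¬ ∃ u < n, E u v) (j : ℕ) : (chainPred n E)^[j] v = v :=
  Function.iterate_fixed (pred_eq_self hv) j

/-- Otherwise all `n + 1` iterates would have predecessors; by pigeonhole two of them agree, and the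
edges between them form a cycle. -/
theorem not_edge_iterate (h : IsChains n E root) (v : ℕ) :
    ¬ ∃ u < n, E u ((chainPred n E)^[n] v) := by
  intro hex
  set x : ℕ → ℕ := fun j => (chainPred n E)^[j] v with hx
  have hstep : ∀ j, (∃ u < n, E u (x j)) → E (x (j + 1)) (x j) := by
    rintro j ⟨u, -, hu⟩
    have : x (j + 1) = chainPred n E (x j) := Function.iterate_succ_apply' _ _ _
    rwa [this, h.pred_eq hu]
  have hall : ∀ j ≤ n, ∃ u < n, E u (x j) := by
    intro j hj
    by_contra hne
    have : x n = x j := by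
      obtain ⟨k, hk⟩ := Nat.exists_eq_add_of_le' hj
      have : ∀ m, m = k + j → x m = x j := by
        rintro _ rfl
        simp only [hx]
        rw [Function.iterate_add_apply]
        exact iterate_eq_self hne k
      exact this n hk
    rw [← this] at hne
    exact hne hex
  have hlt : ∀ j : Fin (n + 1), x j < n := fun j =>
    h.right_lt (hall j (Nat.lt_succ_iff.1 j.2)).choose_spec.2
  obtain ⟨i, j, hij, he⟩ := Fintype.exists_ne_map_eq_of_card_lt
    (fun j : Fin (n + 1) => (⟨x j, hlt j⟩ : Fin n)) (by simp)
  have hchain : ∀ a d, a + d ≤ n → Relation.TransGen E (x (a + d + 1)) (x a) := by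
    intro a d
    induction d with
    | zero => exact fun ha => .single (hstep a (hall a ha))
    | succ d ih =>
      exact fun ha => (Relation.TransGen.single (hstep _ (hall _ ha))).trans (ih (by omega))
  have key : ∀ a b, a < b → b ≤ n → x a = x b → False := by
    intro a b hab hb he
    obtain ⟨d, rfl⟩ := Nat.exists_eq_add_of_lt hab
    have := hchain a d (by omega)
    rw [he] at this
    exact h.acyclic _ this
  have he' : x i = x j := Fin.mk.inj_iff.1 he
  rcases lt_or_gt_of_ne hij with hlt | hlt
  · exact key i j hlt (by omega) he'
  · exact key j i hlt (by omega) he'.symm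

/-- The `n`th iterate is a fixed point, so one more application of the predecessor does not matter.
-/
theorem head_eq (h : IsChains n E root) (huv : E u v) : chainHead n E v = chainHead n E u := by
  have h1 := pred_eq_self (h.not_edge_iterate v)
  rw [← Function.iterate_succ_apply' (chainPred n E), Function.iterate_succ_apply,
    h.pred_eq huv] at h1
  exact h1.symm

theorem depth_eq (h : IsChains n E root) (huv : E u v) :
    chainDepth n E v = chainDepth n E u + 1 := by
  classical
  -- The term for `j = n` vanishes; including it makes the sums for `u` and `v` differ by a shift of
  -- the index.
  have h1 : ∑ j ∈ Finset.range (n + 1), (if ∃ u < n, E u ((chainPred n E)^[j] v) then 1 else 0)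
      = chainDepth n E v := by
    rw [Finset.sum_range_succ, if_neg (h.not_edge_iterate v), chainDepth, add_zero]
  have hex : ∃ u < n, E u v := ⟨u, h.left_lt huv, huv⟩
  rw [← h1, Finset.sum_range_succ']
  simp only [Function.iterate_succ_apply, h.pred_eq huv, Function.iterate_zero_apply]
  rw [chainDepth]
  congr 1
  exact if_pos hex

theorem depth_le : chainDepth n E v ≤ n := by
  rw [chainDepth]
  refine (Finset.sum_le_card_nsmul _ _ 1 fun j _ => ?_).trans (by simp)
  split_ifs <;> omega

/-- Induction on the depth: the predecessors coincide, and a node has at most one successor in its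
chain. At depth `0` a node is its own head. -/
theorem eq_of_head_eq (h : IsChains n E root) (hd : chainDepth n E u = chainDepth n E v)
    (hh : chainHead n E u = chainHead n E v) : u = v := by
  classical
  have h0 : ∀ w, (¬ ∃ x < n, E x w) → chainDepth n E w = 0 ∧ chainHead n E w = w := fun w hw => by
    refine ⟨Finset.sum_eq_zero fun j _ => ?_, iterate_eq_self hw n⟩
    rw [iterate_eq_self hw, if_neg hw]
  induction hk : chainDepth n E u generalizing u v with
  | zero =>
    have h1 : ∀ w, chainDepth n E w = 0 → chainHead n E w = w := fun w hw => by
      refine (h0 w ?_).2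
      rintro ⟨x, -, hx⟩
      have := h.depth_eq hx
      omega
    rw [← h1 u hk, hh, h1 v (by omega)]
  | succ k ih =>
    have h1 : ∀ w, chainDepth n E w = k + 1 → ∃ x, E x w := fun w hw => by
      by_contra hne
      have := (h0 w fun ⟨x, _, hx⟩ => hne ⟨x, hx⟩).1
      omega
    obtain ⟨u', hu⟩ := h1 u hk
    obtain ⟨v', hv⟩ := h1 v (by omega)
    have h2 := h.depth_eq hu
    have h3 := h.depth_eq hv
    have h4 := h.head_eq hu
    have h5 := h.head_eq hv
    obtain rfl := ih (u := u') (v := v') (by omega) (by rw [← h4, ← h5, hh]) (by omega)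
    exact h.right_unique hu hv

/-- Apart from the root, which comes first, a key encodes the pair of head and depth in base `n +
1`; the depth is at most `n`. -/
theorem key_inj (h : IsChains n E root) (huv : chainKey n E root u = chainKey n E root v) :
    u = v := by
  unfold chainKey at huv
  split_ifs at huv with h1 h2 h2
  · rw [h1, h2]
  · have hu := depth_le (n := n) (E := E) (v := u)
    have hv := depth_le (n := n) (E := E) (v := v)
    have huv' : chainDepth n E u + (n + 1) * chainHead n E u
        = chainDepth n E v + (n + 1) * chainHead n E v := by
      rw [mul_comm (n + 1), mul_comm (n + 1)]; omega
    refine h.eq_of_head_eq ?_ ?_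
    · have := congrArg (· % (n + 1)) huv'
      simpa [Nat.add_mul_mod_self_left, Nat.mod_eq_of_lt (Nat.lt_succ_of_le hu),
        Nat.mod_eq_of_lt (Nat.lt_succ_of_le hv)] using this
    · have := congrArg (· / (n + 1)) huv'
      simpa [Nat.add_mul_div_left, Nat.div_eq_of_lt (Nat.lt_succ_of_le hu),
        Nat.div_eq_of_lt (Nat.lt_succ_of_le hv)] using this

theorem key_succ (h : IsChains n E root) (huv : E u v) :
    chainKey n E root v = chainKey n E root u + 1 := by
  rw [chainKey, chainKey, if_neg (h.left_ne huv), if_neg (h.right_ne huv), h.head_eq huv,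
    h.depth_eq huv]
  omega

theorem rank_eq_card (n : ℕ) (E : ℕ → ℕ → Prop) (root v : ℕ) : chainRank n E root v =
    ((Finset.range n).filter fun u => chainKey n E root u < chainKey n E root v).card := by
  rw [Finset.card_filter]
  rfl

theorem rank_lt_rank (hu : u < n) (huv : chainKey n E root u < chainKey n E root v) :
    chainRank n E root u < chainRank n E root v := by
  rw [rank_eq_card, rank_eq_card]
  refine Finset.card_lt_card ⟨fun x hx => ?_, fun hsub => ?_⟩
  · simp only [Finset.mem_filter] at hx ⊢
    exact ⟨hx.1, hx.2.trans huv⟩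
  · have := hsub (Finset.mem_filter.2 ⟨Finset.mem_range.2 hu, huv⟩)
    simp at this

theorem rank_lt (hv : v < n) : chainRank n E root v < n := by
  rw [rank_eq_card]
  refine (Finset.card_lt_card (t := Finset.range n) ⟨Finset.filter_subset _ _, fun hsub => ?_⟩
    ).trans_eq (by simp)
  have := hsub (Finset.mem_range.2 hv)
  simp at this

theorem rank_inj (h : IsChains n E root) (hu : u < n) (hv : v < n)
    (huv : chainRank n E root u = chainRank n E root v) : u = v := by
  refine h.key_inj (root := root) ?_
  by_contra hne
  rcases lt_or_gt_of_ne hne with hlt | hlt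
  · exact (rank_lt_rank hu hlt).ne huv
  · exact (rank_lt_rank hv hlt).ne huv.symm

theorem exists_rank_eq (h : IsChains n E root) (hi : i < n) :
    ∃ v < n, chainRank n E root v = i := by
  have hinj : Function.Injective fun v : Fin n => (⟨chainRank n E root v, rank_lt v.2⟩ : Fin n) :=
    fun u v huv => Fin.ext (h.rank_inj u.2 v.2 (Fin.mk.inj_iff.1 huv))
  obtain ⟨v, hv⟩ := Finite.surjective_of_injective hinj ⟨i, hi⟩
  exact ⟨v, v.2, Fin.mk.inj_iff.1 hv⟩

/-- Consecutive nodes of a chain have consecutive keys, and keys are distinct, so only `u` is added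
to the nodes counted. Hence sorting by keys lists every chain contiguously. -/
theorem rank_succ (h : IsChains n E root) (huv : E u v) :
    chainRank n E root v = chainRank n E root u + 1 := by
  rw [rank_eq_card, rank_eq_card, h.key_succ huv, ← Finset.card_insert_of_notMem
    (a := u) (by simp)]
  congr 1
  ext x
  simp only [Finset.mem_filter, Finset.mem_range, Finset.mem_insert]
  constructor
  · rintro ⟨hx, hlt⟩
    rcases (Nat.lt_succ_iff.1 hlt).lt_or_eq with hlt | he
    · exact .inr ⟨hx, hlt⟩
    · exact .inl (h.key_inj he)
  · rintro (rfl | ⟨hx, hlt⟩)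
    · exact ⟨h.left_lt huv, by omega⟩
    · exact ⟨hx, by omega⟩

theorem rank_root (n : ℕ) (E : ℕ → ℕ → Prop) (root : ℕ) : chainRank n E root root = 0 := by
  simp [chainRank, chainKey]

theorem node_spec (h : IsChains n E root) (hi : i < n) :
    chainNode n E root i < n ∧ chainRank n E root (chainNode n E root i) = i := by
  classical
  obtain ⟨v, hv, hr⟩ := h.exists_rank_eq hi
  exact Nat.findGreatest_spec (P := fun v => v < n ∧ chainRank n E root v = i) hv.le ⟨hv, hr⟩

theorem node_rank (h : IsChains n E root) (hv : v < n) :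
    chainNode n E root (chainRank n E root v) = v :=
  h.rank_inj (h.node_spec (rank_lt hv)).1 hv (h.node_spec (rank_lt hv)).2

end IsChains

/-- The adjacency of a graph on `Fin n` as a relation of natural numbers. -/
def adjNat {n : ℕ} (G : Digraph (Fin n)) (u v : ℕ) : Prop :=
  ∃ (hu : u < n) (hv : v < n), G.Adj ⟨u, hu⟩ ⟨v, hv⟩

open Classical in
/-- The node without incoming edges, if `t₀ = 1`, and otherwise no node. -/
noncomputable def rootNode (t₀ : ℕ) {n : ℕ} (G : Digraph (Fin n)) : ℕ :=
  if t₀ = 1 then Nat.findGreatest (fun v => v < n ∧ ¬ ∃ u < n, adjNat G u v) n else n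

/-- The edges within the chains. -/
def chainAdj (t₀ : ℕ) {n : ℕ} (G : Digraph (Fin n)) (u v : ℕ) : Prop :=
  adjNat G u v ∧ u ≠ rootNode t₀ G

/-- The position of a node. -/
noncomputable def nodeRank (t₀ : ℕ) {n : ℕ} (G : Digraph (Fin n)) (v : ℕ) : ℕ :=
  chainRank n (chainAdj t₀ G) (rootNode t₀ G) v

/-- The node at a position. -/
noncomputable def nodeAt (t₀ : ℕ) {n : ℕ} (G : Digraph (Fin n)) (i : ℕ) : ℕ :=
  chainNode n (chainAdj t₀ G) (rootNode t₀ G) i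

/-- The node at position `i` has a predecessor in its chain. -/
def contAt (t₀ : ℕ) {n : ℕ} (G : Digraph (Fin n)) (i : ℕ) : Prop :=
  i < n ∧ ∃ u < n, chainAdj t₀ G u (nodeAt t₀ G i)

theorem chainOrder_of_isChains {t₀ n : ℕ} {G : Digraph (Fin n)} (ht : t₀ ≤ 1)
    (h : IsChains n (chainAdj t₀ G) (rootNode t₀ G)) (hr : t₀ = 1 → rootNode t₀ G < n)
    (hadj : ∀ u v, adjNat G u v ↔ chainAdj t₀ G u v ∨ (t₀ = 1 ∧ v < n ∧
      (¬ ∃ u < n, chainAdj t₀ G u v) ∧ v ≠ rootNode t₀ G ∧ u = rootNode t₀ G)) :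
    ChainOrder G n t₀ (fun v => nodeRank t₀ G v) (contAt t₀ G) := by
  have hcont : ∀ v : Fin n, contAt t₀ G (nodeRank t₀ G v) ↔ ∃ u < n, chainAdj t₀ G u v :=
    fun v => by
      rw [contAt, nodeAt, nodeRank, h.node_rank v.2]
      simp [IsChains.rank_lt v.2]
  refine ⟨ht, fun u v huv => Fin.ext (h.rank_inj u.2 v.2 huv), fun v => IsChains.rank_lt v.2,
    fun i hi => ?_, fun i hi => ?_, fun u v => ?_⟩
  · obtain ⟨v, hv, hvi⟩ := h.exists_rank_eq hi
    exact ⟨⟨v, hv⟩, hvi⟩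
  -- A predecessor has rank `i - 1`, so `i = t₀ = 1` and the predecessor is the root; but chain
  -- edges avoid the root.
  · rintro ⟨hin, u, hu, he⟩
    have h1 := h.rank_succ he
    rw [nodeAt, (h.node_spec hin).2] at h1
    refine h.left_ne he (h.rank_inj hu (hr (by omega)) ?_)
    rw [IsChains.rank_root]
    omega
  · have h1 : G.Adj u v ↔ adjNat G u v := by simp [adjNat]
    rw [h1, hadj, hcont]
    refine or_congr ⟨fun he => ⟨⟨u, u.2, he⟩, (h.rank_succ he).symm⟩, ?_⟩
      ⟨fun ⟨h1, h2, h3, h4, h5⟩ => ⟨h1, h3, ?_, ?_⟩, fun ⟨h1, h2, h3, h4⟩ => ⟨h1, v.2, h2, ?_, ?_⟩⟩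
    · rintro ⟨⟨u', hu', he⟩, hs⟩
      have := h.rank_succ he
      simp only [nodeRank] at hs
      rwa [h.rank_inj u.2 hu' (by omega)]
    · rw [Nat.pos_iff_ne_zero]
      intro h0
      exact h4 (h.rank_inj v.2 (hr h1) (h0.trans (IsChains.rank_root _ _ _).symm))
    · simp only [nodeRank]
      rw [h5, IsChains.rank_root]
    · intro hv
      simp only [nodeRank] at h3
      rw [hv, IsChains.rank_root] at h3
      omega
    · exact h.rank_inj u.2 (hr h1) (h4.trans (IsChains.rank_root _ _ _).symm)

theorem chainOrder_of_isChainDAG {n : ℕ} {G : Digraph (Fin n)} (hG : IsChainDAG G) :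
    ChainOrder G n 0 (fun v => nodeRank 0 G v) (contAt 0 G) := by
  obtain ⟨h1, h2, h3⟩ := hG
  have hroot : rootNode 0 G = n := by simp [rootNode]
  have hch : ∀ {u v}, chainAdj 0 G u v ↔ adjNat G u v := by
    intro u v
    rw [chainAdj, hroot]
    exact and_iff_left_of_imp fun ⟨hu, _⟩ => hu.ne
  refine chainOrder_of_isChains (by omega) ?_ (by simp) (by simp [hch])
  rw [hroot]
  refine ⟨fun h => (hch.1 h).1, fun h => (hch.1 h).2.1, fun h => (hch.1 h).1.ne,
    fun h => (hch.1 h).2.1.ne, fun h h' => ?_, fun h h' => ?_, fun v hv => ?_⟩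
  · obtain ⟨hu, hv, h⟩ := hch.1 h
    obtain ⟨hu', _, h'⟩ := hch.1 h'
    exact Fin.mk.inj_iff.1 (Set.encard_le_one_iff.1 (h2 _) _ _ h h')
  · obtain ⟨hu, hv, h⟩ := hch.1 h
    obtain ⟨_, hv', h'⟩ := hch.1 h'
    exact Fin.mk.inj_iff.1 (Set.encard_le_one_iff.1 (h3 _) _ _ h h')
  · have key : ∀ u w, Relation.TransGen (chainAdj 0 G) u w → ∃ (hu : u < n) (hw : w < n),
        Relation.TransGen G.Adj ⟨u, hu⟩ ⟨w, hw⟩ := by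
      intro u w huw
      induction huw with
      | single h =>
        obtain ⟨hu, hv, h⟩ := hch.1 h
        exact ⟨hu, hv, .single h⟩
      | tail _ h ih =>
        obtain ⟨_, hv, h⟩ := hch.1 h
        exact ⟨ih.1, hv, ih.2.2.tail h⟩
    obtain ⟨_, _, h⟩ := key v v hv
    exact h1 _ h

theorem chainOrder_of_isConnectedChainDAG {n : ℕ} {G : Digraph (Fin n)}
    (hG : IsConnectedChainDAG G) :
    ChainOrder G n 1 (fun v => nodeRank 1 G v) (contAt 1 G) := by
  classical
  obtain ⟨v₀, ⟨h1, h2, h3⟩, h4, h5⟩ := hG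
  -- The node `v₀` is the only one without incoming edges: a node that is first in its chain has an
  -- edge from `v₀`.
  have hin : ∀ v : Fin n, v ≠ v₀ → ∃ u, G.Adj u v := by
    intro v hv
    by_contra hne
    push Not at hne
    exact hne v₀ ((h5 ⟨v, hv⟩).2 fun u => hne u)
  have hroot : rootNode 1 G = v₀ := by
    have : rootNode 1 G < n ∧ ¬ ∃ u < n, adjNat G u (rootNode 1 G) := by
      rw [rootNode, if_pos rfl]
      exact Nat.findGreatest_spec (P := fun v => v < n ∧ ¬ ∃ u < n, adjNat G u v) v₀.2.le
        ⟨v₀.2, fun ⟨u, hu, hu', hv, h⟩ => h4 _ h⟩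
    by_contra hne
    obtain ⟨u, hu⟩ := hin ⟨_, this.1⟩ fun h => hne (congrArg Fin.val h)
    exact this.2 ⟨u, u.2, u.2, this.1, hu⟩
  have hch : ∀ {u v}, chainAdj 1 G u v → ∃ (hu : u < n) (hv : v < n) (hu' : (⟨u, hu⟩ : Fin n) ≠ v₀)
      (hv' : (⟨v, hv⟩ : Fin n) ≠ v₀), (deleteNode G v₀).Adj ⟨⟨u, hu⟩, hu'⟩ ⟨⟨v, hv⟩, hv'⟩ := by
    rintro u v ⟨⟨hu, hv, h⟩, hne⟩
    rw [hroot] at hne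
    exact ⟨hu, hv, fun h => hne (congrArg Fin.val h), fun h' => h4 _ (h' ▸ h), h⟩
  refine chainOrder_of_isChains le_rfl ?_ (fun _ => hroot ▸ v₀.2) fun u v => ?_
  · refine ⟨fun h => (hch h).1, fun h => (hch h).2.1, fun h => h.2, fun h he => ?_, fun h h' => ?_,
      fun h h' => ?_, fun v hv => ?_⟩
    · obtain ⟨_, _, _, hv, _⟩ := hch h
      exact hv (Fin.ext (he.trans hroot))
    · obtain ⟨_, _, _, _, h⟩ := hch h
      obtain ⟨_, _, _, _, h'⟩ := hch h'
      have := Set.encard_le_one_iff.1 (h2 _) _ _ h h'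
      simpa using this
    · obtain ⟨_, _, _, _, h⟩ := hch h
      obtain ⟨_, _, _, _, h'⟩ := hch h'
      have := Set.encard_le_one_iff.1 (h3 _) _ _ h h'
      simpa using this
    · have key : ∀ u w, Relation.TransGen (chainAdj 1 G) u w → ∃ (hu : u < n) (hw : w < n)
          (hu' : (⟨u, hu⟩ : Fin n) ≠ v₀) (hw' : (⟨w, hw⟩ : Fin n) ≠ v₀),
          Relation.TransGen (deleteNode G v₀).Adj ⟨⟨u, hu⟩, hu'⟩ ⟨⟨w, hw⟩, hw'⟩ := by
        intro u w huw
        induction huw with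
        | single h =>
          obtain ⟨hu, hv, hu', hv', h⟩ := hch h
          exact ⟨hu, hv, hu', hv', .single h⟩
        | tail _ h ih =>
          obtain ⟨_, hv, _, hv', h⟩ := hch h
          exact ⟨ih.1, hv, ih.2.2.1, hv', ih.2.2.2.2.tail h⟩
      obtain ⟨_, _, _, _, h⟩ := key v v hv
      exact h1 _ h
  · simp only [hroot, true_and]
    constructor
    · rintro ⟨hu, hv, h⟩
      by_cases hne : u = v₀
      · have hv₀ : (⟨v, hv⟩ : Fin n) ≠ v₀ := fun h' => h4 _ (h' ▸ h)
        have : (⟨u, hu⟩ : Fin n) = v₀ := Fin.ext hne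
        rw [this] at h
        refine .inr ⟨hv, ?_, fun h' => hv₀ (Fin.ext h'), hne⟩
        rintro ⟨w, hw, he⟩
        obtain ⟨_, _, _, _, he⟩ := hch he
        exact (h5 ⟨_, hv₀⟩).1 h _ he
      · exact .inl ⟨⟨hu, hv, h⟩, by rwa [hroot]⟩
    · rintro (h | ⟨hv, hex, hne, rfl⟩)
      · exact h.1
      · have hv₀ : (⟨v, hv⟩ : Fin n) ≠ v₀ := fun h' => hne (congrArg Fin.val h')
        refine ⟨v₀.2, hv, (h5 ⟨_, hv₀⟩).2 fun w hw => hex ⟨w, w.1.2, ⟨w.1.2, hv, hw⟩, ?_⟩⟩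
        rw [hroot]
        exact fun h => w.2 (Fin.ext h)

end order

end BSP

namespace BSP

/-! ### Schedules as families of choices -/

/-- The part of a schedule with at most `T` supersteps that concerns one node: its processor, its
superstep and the communication steps that send its output. -/
abbrev Choice (P T : ℕ) : Type :=
  Fin P × Fin T × Finset (Fin P × Fin P × Fin T)

namespace Choice

variable {P T : ℕ}

/-- The output of the node is present on processor `p` in superstep `s`. -/
def Present (c : Choice P T) (p : Fin P) (s : Fin T) : Prop :=
  (c.1 = p ∧ c.2.1 ≤ s) ∨ ∃ p' s', s' < s ∧ (p', p, s') ∈ c.2.2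

/-- The communication steps of the node are admissible. -/
def CommValid (M : CommModel) (c : Choice P T) : Prop :=
  match M with
  | .DS | .DB => ∀ p₁ p₂ s, (p₁, p₂, s) ∈ c.2.2 → p₁ = c.1 ∧ c.2.1 ≤ s
  | .FS | .FB => ∀ p₁ p₂ s, (p₁, p₂, s) ∈ c.2.2 → c.Present p₁ s

/-- The requirement for an edge between two nodes. -/
def EdgeValid (M : CommModel) (c c' : Choice P T) : Prop :=
  match M with
  | .DS | .DB => (c.1 = c'.1 → c.2.1 ≤ c'.2.1) ∧
      (c.1 ≠ c'.1 → ∃ s, s < c'.2.1 ∧ (c.1, c'.1, s) ∈ c.2.2)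
  | .FS | .FB => c.Present c'.1 c'.2.1

/-- Only the first `S` supersteps are used. -/
def Fits (S : ℕ) (c : Choice P T) : Prop :=
  (c.2.1 : ℕ) < S ∧ ∀ γ ∈ c.2.2, (γ.2.2 : ℕ) < S

/-- The contribution of the node to the work, to the send cost and to the receive cost of
processor `j.2.2` in superstep `j.2.1`, for `j.1 = 0, 1, 2`. -/
def weight (M : CommModel) (c : Choice P T) (j : Fin 3 × Fin T × Fin P) : ℕ :=
  if j.1 = 0 then if c.1 = j.2.2 ∧ c.2.1 = j.2.1 then 1 else 0
  else if j.1 = 1 then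
    match M with
    | .DS | .FS => (c.2.2.filter fun γ => γ.1 = j.2.2 ∧ γ.2.2 = j.2.1).card
    | .DB | .FB => if ∃ p', (j.2.2, p', j.2.1) ∈ c.2.2 then 1 else 0
  else (c.2.2.filter fun γ => γ.2.1 = j.2.2 ∧ γ.2.2 = j.2.1).card

/-- A node has at most `P * P * T` possible communication steps; the extra `1` covers indicators. -/
theorem weight_le (M : CommModel) (c : Choice P T) (j : Fin 3 × Fin T × Fin P) :
    c.weight M j ≤ P * P * T + 1 := by
  have h : ∀ q : Fin P × Fin P × Fin T → Prop, ∀ [DecidablePred q],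
      (c.2.2.filter q).card ≤ P * P * T + 1 := fun q _ =>
    ((Finset.card_le_univ _).trans (by simp [mul_assoc])).trans (Nat.le_succ _)
  unfold weight
  cases M <;> simp only <;> split_ifs <;> first | exact h _ | omega

end Choice

/-- The cost of a schedule with `S` supersteps, in terms of the total contributions of its
nodes. -/
def costOf {P T : ℕ} (g L S : ℕ) (x : Fin 3 × Fin T × Fin P → ℕ) : ℕ :=
  ∑ s : Fin T, if (s : ℕ) < S then (Finset.univ.sup fun p => x (0, s, p)) +
    g * (Finset.univ.sup fun p => max (x (1, s, p)) (x (2, s, p))) + L else 0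

namespace Schedule

variable {V : Type*} [Fintype V] [DecidableEq V] {P T : ℕ}

/-- The schedule given by a family of choices. -/
abbrev ofChoices (S : ℕ) (hS : S ≤ T) (c : V → Choice P T) (hc : ∀ v, (c v).Fits S) :
    Schedule V P where
  S := S
  π v := (c v).1
  τ v := ⟨(c v).2.1, (hc v).1⟩
  Γ := Finset.univ.filter fun x => (x.2.1, x.2.2.1, Fin.castLE hS x.2.2.2) ∈ (c x.1).2.2

variable {S : ℕ} {hS : S ≤ T} {c : V → Choice P T} {hc : ∀ v, (c v).Fits S}

theorem mem_ofChoices {v : V} {p₁ p₂ : Fin P} {s : Fin S} :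
    (v, p₁, p₂, s) ∈ (ofChoices S hS c hc).Γ ↔ (p₁, p₂, Fin.castLE hS s) ∈ (c v).2.2 :=
  Finset.mem_filter.trans (by simp)

theorem exists_mem_ofChoices {v : V} {p₁ p₂ : Fin P} {s : Fin T} (h : (p₁, p₂, s) ∈ (c v).2.2) :
    ∃ s' : Fin S, Fin.castLE hS s' = s ∧ (v, p₁, p₂, s') ∈ (ofChoices S hS c hc).Γ :=
  ⟨⟨s, (hc v).2 _ h⟩, rfl, mem_ofChoices.2 h⟩

theorem present_ofChoices {v : V} {p : Fin P} {s : Fin S} :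
    (ofChoices S hS c hc).Present v p s ↔ (c v).Present p (Fin.castLE hS s) := by
  refine or_congr Iff.rfl ⟨fun ⟨p', s', hs, hm⟩ => ⟨p', _, hs, mem_ofChoices.1 hm⟩, ?_⟩
  rintro ⟨p', s', hs, hm⟩
  obtain ⟨s', rfl, hm'⟩ := exists_mem_ofChoices (hS := hS) (hc := hc) hm
  exact ⟨p', s', hs, hm'⟩

/-- Presence of a value concerns only the choice of its own node, so validity splits into conditions
on single nodes and on the two ends of each edge. This locality makes dynamic programming possible.
-/
theorem valid_ofChoices {M : CommModel} {G : Digraph V} : (ofChoices S hS c hc).Valid M G ↔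
    (∀ u v, G.Adj u v → (c u).EdgeValid M (c v)) ∧ ∀ v, (c v).CommValid M := by
  have hD : (ofChoices S hS c hc).ValidDirect G ↔
      (∀ u v, G.Adj u v → ((c u).1 = (c v).1 → (c u).2.1 ≤ (c v).2.1) ∧
        ((c u).1 ≠ (c v).1 → ∃ s, s < (c v).2.1 ∧ ((c u).1, (c v).1, s) ∈ (c u).2.2)) ∧
      ∀ v p₁ p₂ s, (p₁, p₂, s) ∈ (c v).2.2 → p₁ = (c v).1 ∧ (c v).2.1 ≤ s := by
    refine and_congr (forall₃_congr fun u v _ => and_congr Iff.rfl (forall_congr' fun _ => ?_))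
      (forall₃_congr fun v p₁ p₂ => ?_)
    · constructor
      · rintro ⟨s, hs, hm⟩
        exact ⟨_, hs, mem_ofChoices.1 hm⟩
      · rintro ⟨s, hs, hm⟩
        obtain ⟨s, rfl, hm'⟩ := exists_mem_ofChoices (hS := hS) (hc := hc) hm
        exact ⟨s, hs, hm'⟩
    · constructor
      · intro h s hm
        obtain ⟨s, rfl, hm'⟩ := exists_mem_ofChoices (hS := hS) (hc := hc) hm
        exact h s hm'
      · exact fun h s hm => h _ (mem_ofChoices.1 hm)
  have hF : (ofChoices S hS c hc).ValidFree G ↔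
      (∀ u v, G.Adj u v → (c u).Present (c v).1 (c v).2.1) ∧
      ∀ v p₁ p₂ s, (p₁, p₂, s) ∈ (c v).2.2 → (c v).Present p₁ s := by
    refine and_congr (forall₃_congr fun u v _ => present_ofChoices)
      (forall₃_congr fun v p₁ p₂ => ?_)
    constructor
    · intro h s hm
      obtain ⟨s, rfl, hm'⟩ := exists_mem_ofChoices (hS := hS) (hc := hc) hm
      exact present_ofChoices.1 (h s hm')
    · exact fun h s hm => present_ofChoices.2 (h _ (mem_ofChoices.1 hm))
  cases M
  exacts [hD, hD, hF, hF]

theorem card_filter_ofChoices (s : Fin S) (q : Fin P × Fin P → Prop) [DecidablePred q] :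
    ((ofChoices S hS c hc).Γ.filter fun x => q (x.2.1, x.2.2.1) ∧ x.2.2.2 = s).card =
      ∑ v, ((c v).2.2.filter fun γ => q (γ.1, γ.2.1) ∧ γ.2.2 = Fin.castLE hS s).card := by
  rw [Finset.card_eq_sum_card_fiberwise (f := fun x => x.1) (t := Finset.univ) (by simp)]
  refine Finset.sum_congr rfl fun v _ => ?_
  refine Finset.card_bij (fun x _ => (x.2.1, x.2.2.1, Fin.castLE hS x.2.2.2)) ?_ ?_ ?_
  · rintro ⟨v', p₁, p₂, s'⟩ hx
    obtain ⟨hx₁, rfl⟩ := Finset.mem_filter.1 hx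
    obtain ⟨hx₂, hq, rfl⟩ := Finset.mem_filter.1 hx₁
    exact Finset.mem_filter.2 ⟨mem_ofChoices.1 hx₂, hq, rfl⟩
  · rintro ⟨v₁, p₁, p₂, s₁⟩ h₁ ⟨v₂, p₁', p₂', s₂⟩ h₂ heq
    obtain ⟨-, rfl⟩ := Finset.mem_filter.1 h₁
    obtain ⟨-, h⟩ := Finset.mem_filter.1 h₂
    dsimp only at h heq
    simp only [Prod.mk.injEq, Fin.castLE_inj] at heq ⊢
    exact ⟨h.symm, heq⟩
  · rintro ⟨p₁, p₂, s'⟩ hx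
    obtain ⟨hx, hq, rfl⟩ := Finset.mem_filter.1 hx
    exact ⟨(v, p₁, p₂, s), Finset.mem_filter.2 ⟨Finset.mem_filter.2
      ⟨mem_ofChoices.2 hx, hq, rfl⟩, rfl⟩, rfl⟩

theorem workCost_ofChoices (M : CommModel) (s : Fin S) (p : Fin P) :
    (ofChoices S hS c hc).workCost s p = ∑ v, (c v).weight M (0, Fin.castLE hS s, p) := by
  simp only [Choice.weight, if_true]
  rw [workCost, Finset.card_filter]
  refine Finset.sum_congr rfl fun v _ => ?_
  simp [Fin.ext_iff]

theorem recCost_ofChoices (M : CommModel) (s : Fin S) (p : Fin P) :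
    (ofChoices S hS c hc).recCost s p = ∑ v, (c v).weight M (2, Fin.castLE hS s, p) :=
  card_filter_ofChoices s fun x => x.2 = p

theorem sentCost_ofChoices (M : CommModel) (s : Fin S) (p : Fin P) :
    (ofChoices S hS c hc).sentCost M s p = ∑ v, (c v).weight M (1, Fin.castLE hS s, p) := by
  have h1 := card_filter_ofChoices (hS := hS) (hc := hc) s fun x => x.1 = p
  have h2 : (Finset.univ.filter fun v => ∃ p', (v, p, p', s) ∈ (ofChoices S hS c hc).Γ).card =
      ∑ v, if ∃ p', (p, p', Fin.castLE hS s) ∈ (c v).2.2 then 1 else 0 := by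
    rw [Finset.card_filter]
    refine Finset.sum_congr rfl fun v _ => if_congr ?_ rfl rfl
    exact exists_congr fun p' => mem_ofChoices
  cases M
  exacts [h1, h2, h1, h2]

/-- All loads are additive over nodes, so the cost depends on the family of choices only through the
totals in the counters. -/
theorem cost_ofChoices (M : CommModel) (g L : ℕ) : (ofChoices S hS c hc).cost M g L =
    costOf g L S fun j => ∑ v, (c v).weight M j := by
  rw [costOf, ← Finset.sum_filter]
  refine Finset.sum_bij (fun s _ => Fin.castLE hS s) (fun s _ => ?_) (fun s _ s' _ h => ?_)
    (fun s hs => ?_) fun s _ => ?_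
  · exact Finset.mem_filter.2 ⟨Finset.mem_univ _, s.2⟩
  · exact Fin.castLE_injective hS h
  · exact ⟨⟨s, (Finset.mem_filter.1 hs).2⟩, Finset.mem_univ _, rfl⟩
  · simp only [stepCost, workCost_ofChoices M, recCost_ofChoices M, sentCost_ofChoices]

/-- The dynamic program loses no schedule that has at most `T` supersteps. -/
theorem exists_ofChoices (σ : Schedule V P) (hS : σ.S ≤ T) :
    ∃ (c : V → Choice P T) (hc : ∀ v, (c v).Fits σ.S), ofChoices σ.S hS c hc = σ := by
  classical
  refine ⟨fun v => (σ.π v, Fin.castLE hS (σ.τ v), Finset.univ.filter fun γ =>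
    ∃ h : (γ.2.2 : ℕ) < σ.S, (v, γ.1, γ.2.1, ⟨γ.2.2, h⟩) ∈ σ.Γ), fun v => ⟨(σ.τ v).2, ?_⟩, ?_⟩
  · intro γ hγ
    exact (Finset.mem_filter.1 hγ).2.1
  · obtain ⟨S, π, τ, Γ⟩ := σ
    simp only [ofChoices, Schedule.mk.injEq, heq_eq_eq, true_and]
    refine ⟨rfl, ?_⟩
    ext ⟨v, p₁, p₂, s⟩
    simp

end Schedule

/-! ### Dynamic programming -/

/-- A number below `K` for which `f` is minimal. -/
def argmin (K : ℕ) (f : ℕ → ℕ) : ℕ :=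
  Nat.findGreatest (fun c => ∀ c' < K, f c ≤ f c') (K - 1)

theorem argmin_lt {K : ℕ} (hK : 0 < K) (f : ℕ → ℕ) : argmin K f < K := by
  have := Nat.findGreatest_le (P := fun c => ∀ c' < K, f c ≤ f c') (K - 1)
  unfold argmin
  omega

theorem argmin_le {K : ℕ} (f : ℕ → ℕ) {c : ℕ} (hc : c < K) : f (argmin K f) ≤ f c := by
  obtain ⟨a, ha, h⟩ := Finset.exists_min_image (Finset.range K) f
    ⟨c, Finset.mem_range.2 hc⟩
  have hle : a ≤ K - 1 := by have := Finset.mem_range.1 ha; omega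
  exact Nat.findGreatest_spec (P := fun c => ∀ c' < K, f c ≤ f c') hle
    (fun c' hc' => h c' (Finset.mem_range.2 hc')) c hc

/-- A decision problem with `n` steps: in step `i`, the decision `c < K` leads from state `x` to
state `next x c` at the price `pen i x c`, and ending in state `x` costs `fin x`. -/
structure Decision where
  n : ℕ
  K : ℕ
  next : ℕ → ℕ → ℕ
  pen : ℕ → ℕ → ℕ → ℕ
  fin : ℕ → ℕ

namespace Decision

/-- The least possible cost of the last `j` steps, from state `x`. -/
def val (D : Decision) : ℕ → ℕ → ℕ
  | 0, x => D.fin x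
  | j + 1, x =>
    D.pen (D.n - 1 - j) x
        (argmin D.K fun c => D.pen (D.n - 1 - j) x c + D.val j (D.next x c)) +
      D.val j (D.next x (argmin D.K fun c => D.pen (D.n - 1 - j) x c + D.val j (D.next x c)))

/-- An optimal decision in step `i` and state `x`. -/
def best (D : Decision) (i x : ℕ) : ℕ :=
  argmin D.K fun c => D.pen i x c + D.val (D.n - 1 - i) (D.next x c)

/-- The state before step `i` under the decisions `d`. -/
def state (D : Decision) (x₀ : ℕ) (d : ℕ → ℕ) : ℕ → ℕ
  | 0 => x₀
  | i + 1 => D.next (D.state x₀ d i) (d i)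

/-- The state before step `i` under optimal decisions. -/
def bestState (D : Decision) (x₀ : ℕ) : ℕ → ℕ
  | 0 => x₀
  | i + 1 => D.next (D.bestState x₀ i) (D.best i (D.bestState x₀ i))

/-- The cost of the decisions `d`. -/
def cost (D : Decision) (x₀ : ℕ) (d : ℕ → ℕ) : ℕ :=
  ∑ i ∈ Finset.range D.n, D.pen i (D.state x₀ d i) (d i) + D.fin (D.state x₀ d D.n)

variable {D : Decision}

/-- Backward induction: in every state the minimizing decision is at least as good as that of `d`.
-/
theorem val_le (d : ℕ → ℕ) (hd : ∀ i, d i < D.K) (x₀ j : ℕ) (hj : j ≤ D.n) :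
    D.val j (D.state x₀ d (D.n - j)) ≤
      ∑ i ∈ Finset.Ico (D.n - j) D.n, D.pen i (D.state x₀ d i) (d i) +
        D.fin (D.state x₀ d D.n) := by
  induction j with
  | zero => simp [val]
  | succ j ih =>
    have h1 : D.n - 1 - j = D.n - (j + 1) := by omega
    have h2 : D.n - (j + 1) + 1 = D.n - j := by omega
    rw [Finset.sum_eq_sum_Ico_succ_bot (by omega), h2, val, h1, add_assoc]
    refine (argmin_le (fun c => D.pen (D.n - (j + 1)) _ c + D.val j (D.next _ c))
      (hd (D.n - (j + 1)))).trans (add_le_add le_rfl ?_)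
    have h3 : D.next (D.state x₀ d (D.n - (j + 1))) (d (D.n - (j + 1)))
        = D.state x₀ d (D.n - j) := by rw [← h2]; rfl
    rw [h3]
    exact ih (by omega)

theorem state_best (x₀ i : ℕ) :
    D.state x₀ (fun i => D.best i (D.bestState x₀ i)) i = D.bestState x₀ i := by
  induction i with
  | zero => rfl
  | succ i ih => rw [state, ih, bestState]

theorem val_best (x₀ j : ℕ) (hj : j ≤ D.n) :
    D.val j (D.bestState x₀ (D.n - j)) =
      ∑ i ∈ Finset.Ico (D.n - j) D.n, D.pen i (D.bestState x₀ i) (D.best i (D.bestState x₀ i)) +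
        D.fin (D.bestState x₀ D.n) := by
  induction j with
  | zero => simp [val]
  | succ j ih =>
    have h1 : D.n - 1 - j = D.n - (j + 1) := by omega
    have h2 : D.n - (j + 1) + 1 = D.n - j := by omega
    have h4 : D.n - 1 - (D.n - (j + 1)) = j := by omega
    rw [Finset.sum_eq_sum_Ico_succ_bot (by omega), h2, add_assoc, ← ih (by omega), ← h2,
      bestState, val, h1, best, h4]

/-- The optimal decisions have minimal cost. -/
theorem cost_best_le (x₀ : ℕ) (d : ℕ → ℕ) (hd : ∀ i, d i < D.K) :
    D.cost x₀ (fun i => D.best i (D.bestState x₀ i)) ≤ D.cost x₀ d := by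
  have h1 := val_best (D := D) x₀ D.n le_rfl
  have h2 := val_le d hd x₀ D.n le_rfl
  simp only [Nat.sub_self, ← Finset.range_eq_Ico] at h1 h2
  simp only [cost, state_best]
  exact h1.symm.trans_le h2

end Decision

end BSP

namespace BSP

/-! ### Scheduling as a decision problem -/

/-- The control states: the number of supersteps, the choice for the first node and the choice for
the current node. -/
abbrev Control (P T : ℕ) : Type :=
  Fin (T + 1) × Choice P T × Choice P T

section control

variable (P T : ℕ)

/-- The number of control states. -/
def numControls : ℕ := Fintype.card (Control P T)

/-- The number of counters. -/
def numCounters : ℕ := Fintype.card (Fin 3 × Fin T × Fin P)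

/-- All counters stay below this base. -/
def base (n : ℕ) : ℕ := n * (P * P * T + 1) + 1

/-- The number of codes for the contents of the counters. -/
def numCodes (n : ℕ) : ℕ := base P T n ^ numCounters P T

variable {P T}

/-- The number of a counter. -/
noncomputable def counter (j : Fin 3 × Fin T × Fin P) : Fin (numCounters P T) :=
  Fintype.equivFin _ j

/-- The number of a control state. -/
noncomputable def encode (q : Control P T) : ℕ := Fintype.equivFin _ q

theorem numCodes_pos (n : ℕ) : 0 < numCodes P T n := pow_pos (by unfold base; omega) _

variable [NeZero P] [NeZero T]

theorem numControls_pos : 0 < numControls P T := Fintype.card_pos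

/-- The control state with a given number. -/
noncomputable def decode (P T : ℕ) [NeZero P] [NeZero T] (q : ℕ) : Control P T :=
  (Fintype.equivFin _).symm ⟨q % numControls P T, Nat.mod_lt _ numControls_pos⟩

/-- The initial control state. -/
noncomputable def initControl (P T : ℕ) [NeZero P] [NeZero T] : ℕ :=
  encode (P := P) (T := T) (0, (0, 0, ∅), (0, 0, ∅))

theorem encode_lt (q : Control P T) : encode q < numControls P T := (Fintype.equivFin _ q).2

theorem decode_encode (q : Control P T) : decode P T (encode q) = q := by
  have : (⟨encode q % numControls P T, Nat.mod_lt _ numControls_pos⟩ : Fin (numControls P T)) =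
    Fintype.equivFin _ q := Fin.ext (Nat.mod_eq_of_lt (encode_lt q))
  exact (congrArg (Fintype.equivFin (Control P T)).symm this).trans (Equiv.symm_apply_apply _ _)

/-- The contribution of a control state to the code of the counters. -/
noncomputable def codeWeight (M : CommModel) (P T : ℕ) [NeZero P] [NeZero T] (n q : ℕ) : ℕ :=
  ∑ j, (decode P T q).2.2.weight M j * base P T n ^ (counter j : ℕ)

/-- The control state `q'` may follow `q` at a position of kind `k`: the first position has kind
`3`; a node with a predecessor in its chain has kind `1`, other successors of the first node have
kind `2`. -/
def Allowed (M : CommModel) (P T : ℕ) [NeZero P] [NeZero T] (k q q' : ℕ) : Prop :=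
  (decode P T q').2.2.Fits (decode P T q').1 ∧ (decode P T q').2.2.CommValid M ∧
    (k = 3 → (decode P T q').2.1 = (decode P T q').2.2) ∧
    (k ≠ 3 → (decode P T q').1 = (decode P T q).1 ∧ (decode P T q').2.1 = (decode P T q).2.1) ∧
    (k = 1 → (decode P T q).2.2.EdgeValid M (decode P T q').2.2) ∧
    (k = 2 → (decode P T q).2.1.EdgeValid M (decode P T q').2.2)

end control

open Classical in
/-- The kind of a position. -/
noncomputable def kindOf (t₀ : ℕ) (cont : ℕ → Prop) (i : ℕ) : ℕ :=
  if i = 0 then 3 else if cont i then 1 else if t₀ = 1 then 2 else 0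

open Classical in
/-- The decision problem of choosing a control state for each position. A state is a pair of a
control state and a code of counters. -/
noncomputable def scheduling (M : CommModel) (P T g L : ℕ) [NeZero P] [NeZero T] (n t₀ : ℕ)
    (cont : ℕ → Prop) : Decision where
  n := n
  K := numControls P T
  -- The reduction keeps every state in range; for codes that arise from at most `n` nodes it
  -- changes nothing.
  next x c := c * numCodes P T n + (x % numCodes P T n + codeWeight M P T n c) % numCodes P T n
  -- A single penalty exceeds `n + L`, the cost bound for the schedule that runs everything on one
  -- processor in one superstep.
  pen i x c := if Allowed M P T (kindOf t₀ cont i) (x / numCodes P T n) c then 0 else n + L + 1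
  fin x := costOf (P := P) (T := T) g L (decode P T (x / numCodes P T n)).1
    fun j => x % numCodes P T n / base P T n ^ (counter j : ℕ) % base P T n

/-- The initial state. -/
noncomputable def initState (P T : ℕ) [NeZero P] [NeZero T] (n : ℕ) : ℕ :=
  initControl P T * numCodes P T n

/-- Uniqueness of digits in base `B`, taken from Mathlib's equivalence `finFunctionFinEquiv`. -/
theorem digits_eq {ι : Type*} [Fintype ι] {D B : ℕ} (e : ι ≃ Fin D) (y : ι → ℕ)
    (hy : ∀ j, y j < B) : ∑ j, y j * B ^ (e j : ℕ) < B ^ D ∧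
      ∀ i, (∑ j, y j * B ^ (e j : ℕ)) / B ^ (e i : ℕ) % B = y i := by
  set f : Fin D → Fin B := fun k => ⟨y (e.symm k), hy _⟩ with hf
  have h : ((finFunctionFinEquiv f : Fin (B ^ D)) : ℕ) = ∑ j, y j * B ^ (e j : ℕ) := by
    rw [finFunctionFinEquiv_apply, ← e.sum_comp]
    simp [hf]
  refine ⟨h ▸ (finFunctionFinEquiv f).2, fun i => ?_⟩
  rw [← h]
  have := congrArg (fun F => ((F (e i) : Fin B) : ℕ)) (finFunctionFinEquiv.symm_apply_apply f)
  simpa [hf, finFunctionFinEquiv] using this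

section scheduling

variable {M : CommModel} {P T g L n t₀ : ℕ} [NeZero P] [NeZero T] {cont : ℕ → Prop}

theorem state_scheduling (d : ℕ → ℕ) (i : ℕ) :
    (scheduling M P T g L n t₀ cont).state (initState P T n) d i =
      (if i = 0 then initControl P T else d (i - 1)) *
        numCodes P T n + (∑ k ∈ Finset.range i, codeWeight M P T n (d k)) % numCodes P T n := by
  induction i with
  | zero => simp [Decision.state, initState]
  | succ i ih =>
    have hmod : ∀ a m y w : ℕ, ((a * m + y % m) % m + w) % m = (y + w) % m := fun a m y w => by
      rw [Nat.mul_comm, Nat.mul_add_mod, Nat.mod_mod, Nat.mod_add_mod]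
    rw [Decision.state, ih, Finset.sum_range_succ, if_neg (Nat.succ_ne_zero i),
      Nat.add_sub_cancel]
    exact congrArg _ (hmod _ _ _ _)

theorem state_div (d : ℕ → ℕ) (i : ℕ) :
    (scheduling M P T g L n t₀ cont).state (initState P T n) d i / numCodes P T n =
      if i = 0 then initControl P T else d (i - 1) := by
  rw [state_scheduling, mul_comm, Nat.mul_add_div (numCodes_pos n),
    Nat.div_eq_of_lt (Nat.mod_lt _ (numCodes_pos n)), add_zero]

theorem fin_scheduling (x : ℕ) : (scheduling M P T g L n t₀ cont).fin x =
    costOf (P := P) (T := T) g L (decode P T (x / numCodes P T n)).1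
      fun j => x % numCodes P T n / base P T n ^ (counter j : ℕ) % base P T n :=
  rfl

theorem cost_scheduling (x₀ : ℕ) (d : ℕ → ℕ) : (scheduling M P T g L n t₀ cont).cost x₀ d =
    ∑ i ∈ Finset.range n, (scheduling M P T g L n t₀ cont).pen i
      ((scheduling M P T g L n t₀ cont).state x₀ d i) (d i) +
      (scheduling M P T g L n t₀ cont).fin ((scheduling M P T g L n t₀ cont).state x₀ d n) :=
  rfl

/-- Each counter stays below the base, so no carries occur and the digits of the code are the true
totals. -/
theorem fin_state (d : ℕ → ℕ) : (scheduling M P T g L n t₀ cont).fin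
    ((scheduling M P T g L n t₀ cont).state (initState P T n) d n) =
    costOf (P := P) g L (decode P T (if n = 0 then
      initControl P T else d (n - 1))).1 fun j =>
        ∑ k ∈ Finset.range n, (decode P T (d k)).2.2.weight M j := by
  have hsum : ∑ k ∈ Finset.range n, codeWeight M P T n (d k) =
      ∑ j, (∑ k ∈ Finset.range n, (decode P T (d k)).2.2.weight M j) *
        base P T n ^ (counter j : ℕ) := by
    simp only [codeWeight, Finset.sum_mul]
    exact Finset.sum_comm
  obtain ⟨h1, h2⟩ := digits_eq (B := base P T n) (Fintype.equivFin (Fin 3 × Fin T × Fin P))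
    (fun j => ∑ k ∈ Finset.range n, (decode P T (d k)).2.2.weight M j) fun j => by
      refine Nat.lt_succ_of_le ((Finset.sum_le_card_nsmul _ _ _ fun k _ =>
        Choice.weight_le M _ j).trans ?_)
      simp
  have h3 : (scheduling M P T g L n t₀ cont).state (initState P T n) d n % numCodes P T n =
      ∑ k ∈ Finset.range n, codeWeight M P T n (d k) := by
    rw [state_scheduling, Nat.mul_comm, Nat.mul_add_mod, Nat.mod_mod]
    exact Nat.mod_eq_of_lt (hsum ▸ h1)
  rw [fin_scheduling, state_div, h3, hsum]
  congr 1
  exact funext h2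

theorem pen_scheduling (d : ℕ → ℕ) (i : ℕ) : (scheduling M P T g L n t₀ cont).pen i
    ((scheduling M P T g L n t₀ cont).state (initState P T n) d i) (d i) = 0 ↔
    Allowed M P T (kindOf t₀ cont i) (if i = 0 then
      initControl P T else d (i - 1)) (d i) := by
  rw [← state_div (M := M) (g := g) (L := L) (t₀ := t₀) (cont := cont) (n := n) d i]
  simp [scheduling]

theorem pen_le_iff (i x c : ℕ) : (scheduling M P T g L n t₀ cont).pen i x c ≤ n + L ↔
    (scheduling M P T g L n t₀ cont).pen i x c = 0 := by
  simp only [scheduling]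
  split_ifs <;> simp

end scheduling

/-! ### From decisions to schedules and back. -/

namespace ChainOrder

variable {V : Type*} [Fintype V] [DecidableEq V] {G : Digraph V} {M : CommModel}
  {P T g L n t₀ : ℕ} [NeZero P] [NeZero T] {r : V → ℕ} {cont : ℕ → Prop}

theorem sum_range (o : ChainOrder G n t₀ r cont) (f : ℕ → ℕ) :
    ∑ k ∈ Finset.range n, f k = ∑ v, f (r v) := by
  refine (Finset.sum_bij (fun v _ => r v) (fun v _ => ?_) (fun u _ v _ h => o.inj h)
    (fun i hi => ?_) fun v _ => rfl).symm
  · exact Finset.mem_range.2 (o.lt v)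
  · obtain ⟨v, hv⟩ := o.surj i (Finset.mem_range.1 hi)
    exact ⟨v, Finset.mem_univ _, hv⟩

/-- Decisions without penalty give a valid schedule. -/
theorem valid_of_allowed (o : ChainOrder G n t₀ r cont) (hn : 0 < n) (d : ℕ → ℕ)
    (hd : ∀ i < n, Allowed M P T (kindOf t₀ cont i) (if i = 0 then
      initControl P T else d (i - 1)) (d i)) :
    ∃ hc : ∀ v, (decode P T (d (r v))).2.2.Fits (decode P T (d (n - 1))).1,
      (Schedule.ofChoices _ (Nat.lt_succ_iff.1 (decode P T (d (n - 1))).1.2) _ hc).Valid M G := by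
  -- The number of supersteps and the choice of the first node are guessed at position `0` and then
  -- only copied.
  have hconst : ∀ i < n, (decode P T (d i)).1 = (decode P T (d 0)).1 ∧
      (decode P T (d i)).2.1 = (decode P T (d 0)).2.2 := by
    intro i
    induction i with
    | zero => exact fun h => ⟨rfl, (hd 0 h).2.2.1 (by simp [kindOf])⟩
    | succ i ih =>
      intro h
      have h1 := (hd (i + 1) h).2.2.2.1 (by unfold kindOf; split_ifs <;> simp_all)
      simp only [Nat.add_eq_zero_iff, one_ne_zero, and_false, if_false, Nat.add_sub_cancel] at h1
      rw [h1.1, h1.2]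
      exact ih (by omega)
  have hS : ∀ v, (decode P T (d (r v))).1 = (decode P T (d (n - 1))).1 := fun v => by
    rw [(hconst _ (o.lt v)).1, (hconst (n - 1) (by omega)).1]
  refine ⟨fun v => hS v ▸ (hd _ (o.lt v)).1, Schedule.valid_ofChoices.2
    ⟨fun u v huv => ?_, fun v => (hd _ (o.lt v)).2.1⟩⟩
  have h1 := (hd _ (o.lt v)).2.2.2.2
  rcases (o.adj u v).1 huv with ⟨hc, he⟩ | ⟨ht, hc, hv, hu⟩
  · have := h1.1 (by rw [kindOf, if_neg (by omega), if_pos hc])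
    rwa [if_neg (by omega), ← he, Nat.add_sub_cancel, he] at this
  · have := h1.2 (by simp [kindOf, hc, ht, hv.ne'])
    rwa [if_neg (by omega), (hconst (r v - 1) (by have := o.lt v; omega)).2, ← hu] at this

/-- A valid schedule gives decisions without penalty. -/
theorem exists_allowed (o : ChainOrder G n t₀ r cont) (hn : 0 < n) {σ : Schedule V P}
    (hσ : σ.Valid M G) (hS : σ.S ≤ T) : ∃ d : ℕ → ℕ, (∀ i, d i < numControls P T) ∧
      (∀ i < n, Allowed M P T (kindOf t₀ cont i) (if i = 0 then
        initControl P T else d (i - 1)) (d i)) ∧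
      costOf g L (decode P T (d (n - 1))).1 (fun j => ∑ k ∈ Finset.range n,
        (decode P T (d k)).2.2.weight M j) = σ.cost M g L := by
  obtain ⟨c, hc, he⟩ := σ.exists_ofChoices hS
  have hex : ∀ i, ∃ v, i < n → r v = i := fun i => by
    by_cases hi : i < n
    · obtain ⟨v, hv⟩ := o.surj i hi
      exact ⟨v, fun _ => hv⟩
    · obtain ⟨v, -⟩ := o.surj 0 hn
      exact ⟨v, fun h => absurd h hi⟩
  choose w hw using hex
  have hwr : ∀ v, w (r v) = v := fun v => o.inj (hw _ (o.lt v))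
  have hdec : ∀ i, decode P T (encode (⟨σ.S, Nat.lt_succ_of_le hS⟩, c (w 0), c (w i)))
      = (⟨σ.S, Nat.lt_succ_of_le hS⟩, c (w 0), c (w i)) := fun i => decode_encode _
  rw [← he] at hσ
  obtain ⟨h1, h2⟩ := Schedule.valid_ofChoices.1 hσ
  refine ⟨fun i => encode (⟨σ.S, Nat.lt_succ_of_le hS⟩, c (w 0), c (w i)), fun i => encode_lt _,
    fun i hi => ?_, ?_⟩
  · unfold Allowed
    rw [hdec]
    refine ⟨hc _, h2 _, fun hk => ?_, fun hk => ?_, fun hk => ?_, fun hk => ?_⟩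
    all_goals
      unfold kindOf at hk
      by_cases hi0 : i = 0
    · rw [hi0]
    · split_ifs at hk <;> omega
    · exact absurd (if_pos hi0) hk
    · rw [if_neg hi0, hdec]
      exact ⟨rfl, rfl⟩
    · simp [hi0] at hk
    · have hcont : cont i := by
        by_contra h
        simp only [hi0, h, if_false] at hk
        split_ifs at hk <;> omega
      rw [if_neg hi0, hdec]
      refine h1 _ _ ((o.adj _ _).2 (.inl ?_))
      rw [hw i hi, hw (i - 1) (by omega)]
      exact ⟨hcont, by omega⟩
    · simp [hi0] at hk
    · rw [if_neg hi0, hdec]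
      refine h1 _ _ ((o.adj _ _).2 (.inr ?_))
      rw [hw i hi, hw 0 hn]
      split_ifs at hk with hcont ht
      · omega
      · exact ⟨ht, hcont, by omega, rfl⟩
  · simp only [hdec]
    rw [← congrArg (Schedule.cost M g L) he, Schedule.cost_ofChoices]
    congr 1
    funext j
    rw [o.sum_range]
    simp only [hwr]

/-- Everything on processor `0` in one superstep: a reference schedule that rules out penalties in
the optimum. -/
theorem exists_cost_le (o : ChainOrder G n t₀ r cont) (M : CommModel) (g L : ℕ) (hP : 0 < P) :
    ∃ σ : Schedule V P, σ.Valid M G ∧ σ.S ≤ 1 ∧ σ.cost M g L ≤ n + L := by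
  let σ : Schedule V P := ⟨1, fun _ => ⟨0, hP⟩, fun _ => 0, ∅⟩
  have hσ : σ.ValidDirect G := ⟨fun u v _ => ⟨fun _ => le_rfl, fun h => absurd rfl h⟩,
    fun v p₁ p₂ s h => absurd h (Finset.notMem_empty _)⟩
  refine ⟨σ, hσ.valid M, le_rfl, ?_⟩
  have h1 : σ.totalWork ≤ n := σ.totalWork_le n r (fun _ => 0) (fun u v _ h => o.inj h) o.lt
    fun v => rfl
  have h2 : ∀ s, σ.commCost M s = 0 := fun s => Nat.le_zero.1 (σ.commCost_le M s)
  rw [Schedule.cost_eq]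
  simp only [h2, Finset.sum_const_zero, mul_zero, add_zero]
  have : σ.S * L = L := one_mul L
  omega

/-- The optimal decisions give an optimal schedule. -/
theorem isOptimal_best (o : ChainOrder G n t₀ r cont)
    (hT : (P + 2) * (g * (2 * P) + L + 1) + 1 ≤ T) {D : Decision}
    (hD : D = scheduling M P T g L n t₀ cont) {d : ℕ → ℕ}
    (hd : ∀ i, d i = D.best i (D.bestState (initState P T n) i)) :
    ∃ hc : ∀ v, (decode P T (d (r v))).2.2.Fits
        (decode P T (D.bestState (initState P T n) n / numCodes P T n)).1,
      (Schedule.ofChoices _ (Nat.lt_succ_iff.1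
        (decode P T (D.bestState (initState P T n) n / numCodes P T n)).1.2) _ hc).IsOptimal
          M g L G := by
  have hd' : d = fun i => D.best i (D.bestState (initState P T n) i) := funext hd
  have hstate : ∀ i, D.bestState (initState P T n) i = D.state (initState P T n) d i := fun i => by
    rw [hd', Decision.state_best]
  rw [hstate, hD, state_div]
  -- Without nodes the initial control state is also the last one; its number of supersteps is `0`,
  -- so the cost is `0`.
  rcases Nat.eq_zero_or_pos n with hn | hn
  · have hV : IsEmpty V := ⟨fun v => by have := o.lt v; omega⟩
    refine ⟨fun v => hV.elim v, Schedule.valid_ofChoices.2 ⟨fun v => hV.elim v,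
      fun v => hV.elim v⟩, fun σ _ => ?_⟩
    rw [Schedule.cost_ofChoices, if_pos hn, initControl, decode_encode]
    simp [costOf]
  have hmin : ∀ d', (∀ i, d' i < numControls P T) →
      D.cost (initState P T n) d ≤ D.cost (initState P T n) d' := fun d' h => by
    rw [hd']
    exact Decision.cost_best_le _ d' (by rw [hD]; exact h)
  have hcost : ∀ d', (∀ i < n, Allowed M P T (kindOf t₀ cont i) (if i = 0 then
      initControl P T else d' (i - 1)) (d' i)) →
      D.cost (initState P T n) d' = costOf (P := P) g L (decode P T (d' (n - 1))).1 fun j =>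
        ∑ k ∈ Finset.range n, (decode P T (d' k)).2.2.weight M j := by
    intro d' h
    rw [hD, cost_scheduling, fin_state, if_neg hn.ne', Finset.sum_eq_zero, zero_add]
    exact fun i hi => (pen_scheduling d' i).2 (h i (Finset.mem_range.1 hi))
  have hle : ∀ σ : Schedule V P, σ.Valid M G → σ.S ≤ T →
      D.cost (initState P T n) d ≤ σ.cost M g L := by
    intro σ hσ hS
    obtain ⟨d', h1, h2, h3⟩ := o.exists_allowed (g := g) (L := L) hn hσ hS
    rw [← h3, ← hcost d' h2]
    exact hmin d' h1
  -- One penalty is at most the total, which is at most `n + L` by comparison with the one-superstep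
  -- schedule; so it is `0`.
  have hallowed : ∀ i < n, Allowed M P T (kindOf t₀ cont i) (if i = 0 then
      initControl P T else d (i - 1)) (d i) := by
    intro i hi
    rw [← pen_scheduling (g := g) (L := L) (n := n), ← pen_le_iff, ← hD]
    obtain ⟨σ, h1, h2, h3⟩ := o.exists_cost_le (P := P) M g L (NeZero.pos P)
    refine le_trans (le_trans ?_ (hle σ h1 (by omega))) h3
    refine le_trans ?_ (Nat.le_add_right _ _)
    have hDn : D.n = n := by rw [hD]; rfl
    exact Finset.single_le_sum (f := fun i => D.pen i (D.state (initState P T n) d i) (d i))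
      (fun _ _ => Nat.zero_le _) (Finset.mem_range.2 (hDn.symm ▸ hi))
  rw [if_neg hn.ne']
  obtain ⟨hc, hvalid⟩ := o.valid_of_allowed hn d hallowed
  refine ⟨hc, hvalid, fun σ hσ => ?_⟩
  -- Only here optimality passes from at most `T` supersteps to arbitrarily many.
  obtain ⟨σ', h1, h2, h3⟩ := o.exists_bounded M g L hσ hn
  refine le_trans ?_ ((hle σ' h1 (h2.trans hT)).trans h3)
  rw [Schedule.cost_ofChoices, hcost d hallowed]
  simp only [o.sum_range, le_refl]

end ChainOrder

end BSP

namespace BSP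

/-! ### Reading the input -/

/-- An instance of the scheduling problem: a graph with a list of its edges. -/
structure Inst where
  n : ℕ
  G : Digraph (Fin n)
  E : List (Fin n × Fin n)
  lists : ListsEdges G E

/-- Array `0` holds the input word. -/
def inputCtx : Ctx Inst where
  size I := I.n
  depth := 0
  used := {0}
  Rep I m := ∀ i, m.arr 0 i = (inputWord I.n I.E).getD i 0
  stable := fun _ h hm i => by rw [h 0 rfl, hm i]

theorem getD_flatMap {α β : Type*} {f : α → List β} {c : ℕ} (hf : ∀ a, (f a).length = c)
    (l : List α) (k j : ℕ) (hk : k < l.length) (hj : j < c) (x : β) :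
    (l.flatMap f).getD (c * k + j) x = (f l[k]).getD j x := by
  induction l generalizing k with
  | nil => simp at hk
  | cons a l ih =>
    rw [List.flatMap_cons]
    cases k with
    | zero =>
      rw [List.getD_append _ _ _ _ (by simpa [hf] using hj)]
      simp
    | succ k =>
      rw [List.getD_append_right _ _ _ _ (by rw [hf, Nat.mul_succ]; omega)]
      have : c * (k + 1) + j - (f a).length = c * k + j := by
        rw [hf, Nat.mul_succ]; omega
      rw [this]
      exact ih k (by simpa using hk)

/-- Edge `i` occupies two entries after the two header entries, so adjacency can be tested by
scanning the input. -/
theorem Inst.adjNat_iff (I : Inst) (u v : ℕ) : adjNat I.G u v ↔ ∃ i < I.E.length,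
    (inputWord I.n I.E).getD (2 * i + 2) 0 = u ∧ (inputWord I.n I.E).getD (2 * i + 3) 0 = v := by
  have hget : ∀ i (h : i < I.E.length), (inputWord I.n I.E).getD (2 * i + 2) 0 = I.E[i].1 ∧
      (inputWord I.n I.E).getD (2 * i + 3) 0 = I.E[i].2 := fun i h => by
    have := getD_flatMap (f := fun e : Fin I.n × Fin I.n => [(e.1 : ℕ), (e.2 : ℕ)]) (c := 2)
      (fun _ => rfl) I.E i
    exact ⟨this 0 h (by omega) 0, this 1 h (by omega) 0⟩
  constructor
  · rintro ⟨hu, hv, h⟩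
    obtain ⟨i, hi, he⟩ := List.mem_iff_getElem.1 ((I.lists.2 _ _).2 h)
    exact ⟨i, hi, by rw [(hget i hi).1, he], by rw [(hget i hi).2, he]⟩
  · rintro ⟨i, hi, rfl, rfl⟩
    rw [(hget i hi).1, (hget i hi).2]
    exact ⟨_, _, (I.lists.2 _ _).1 (List.getElem_mem hi)⟩

theorem Inst.length_le (I : Inst) : I.E.length ≤ I.n * I.n := by
  simpa using I.lists.1.length_le_card

section graph

variable {β : Type} {Δ : Ctx β} {φ : β → Inst} {u v i : β → ℕ}

theorem PComp.inputWord (e : Δ.Ext φ inputCtx) (hi : PComp Δ i) :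
    PComp Δ (fun b => (inputWord (φ b).n (φ b).E).getD (i b) 0) :=
  hi.read 0 fun b m hm => e.rep b m hm (i b)

theorem PComp.nodes (e : Δ.Ext φ inputCtx) : PComp Δ (fun b => (φ b).n) :=
  PComp.inputWord e (.const 0)

theorem PBdd.nodes (e : Δ.Ext φ inputCtx) : PBdd Δ (fun b => (φ b).n) :=
  PBdd.size.mono fun b _ _ => (e.size b).le

theorem PComp.length (e : Δ.Ext φ inputCtx) : PComp Δ (fun b => (φ b).E.length) :=
  PComp.inputWord e (.const 1)

theorem PBdd.length (e : Δ.Ext φ inputCtx) : PBdd Δ (fun b => (φ b).E.length) :=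
  ((PBdd.nodes e).mul (PBdd.nodes e)).mono fun b _ _ => (φ b).length_le

theorem PDec.adjNat (e : Δ.Ext φ inputCtx) (hu : PComp Δ u) (hv : PComp Δ v) :
    PDec Δ (fun b => adjNat (φ b).G (u b) (v b)) := by
  refine (PDec.exists (P := fun b i => (BSP.inputWord (φ b).n (φ b).E).getD (2 * i + 2) 0 = u b ∧
    (BSP.inputWord (φ b).n (φ b).E).getD (2 * i + 3) 0 = v b) (PComp.length e) (PBdd.length e)
    fun r e' hr he => ?_).congr fun b _ _ => ((φ b).adjNat_iff _ _).symm
  exact (PDec.eq (PComp.inputWord e.var ((PComp.snd.constMul 2).add (.const 2))) hu.wk).and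
    (PDec.eq (PComp.inputWord e.var ((PComp.snd.constMul 2).add (.const 3))) hv.wk)

theorem PComp.rootNode (e : Δ.Ext φ inputCtx) (t₀ : ℕ) :
    PComp Δ (fun b => rootNode t₀ (φ b).G) := by
  classical
  unfold BSP.rootNode
  refine (PDec.const (t₀ = 1)).ite ?_ (PComp.nodes e)
  refine PComp.findGreatest (PComp.nodes e) (PBdd.nodes e) fun r e' hr he => ?_
  refine (PDec.lt PComp.snd (PComp.nodes e.var)).and (PDec.not ?_)
  refine PDec.exists (PComp.nodes e.var) (PBdd.nodes e.var) fun r e' hr he => ?_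
  exact PDec.adjNat e.var.var PComp.snd PComp.snd.wk

theorem PDec.chainAdj (e : Δ.Ext φ inputCtx) (t₀ : ℕ) (hu : PComp Δ u) (hv : PComp Δ v) :
    PDec Δ (fun b => chainAdj t₀ (φ b).G (u b) (v b)) :=
  (PDec.adjNat e hu hv).and (PDec.eq hu (PComp.rootNode e t₀)).not

theorem PDec.hasPred (e : Δ.Ext φ inputCtx) (t₀ : ℕ) (hv : PComp Δ v) :
    PDec Δ (fun b => ∃ u < (φ b).n, BSP.chainAdj t₀ (φ b).G u (v b)) :=
  PDec.exists (PComp.nodes e) (PBdd.nodes e) fun _ _ _ _ => PDec.chainAdj e.var t₀ PComp.snd hv.wk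

theorem PComp.chainPred (e : Δ.Ext φ inputCtx) (t₀ : ℕ) (hv : PComp Δ v) :
    PComp Δ (fun b => chainPred (φ b).n (chainAdj t₀ (φ b).G) (v b)) := by
  classical
  unfold BSP.chainPred
  refine (PDec.hasPred e t₀ hv).ite ?_ hv
  exact PComp.findGreatest (PComp.nodes e) (PBdd.nodes e) fun r e' hr he =>
    PDec.chainAdj e.var t₀ PComp.snd hv.wk

theorem PComp.chainHead (e : Δ.Ext φ inputCtx) (t₀ : ℕ) (hv : PComp Δ v) :
    PComp Δ (fun b => chainHead (φ b).n (chainAdj t₀ (φ b).G) (v b)) :=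
  PComp.iterate (PComp.nodes e) (PBdd.nodes e) hv fun _ _ _ _ => PComp.chainPred e.var t₀ PComp.snd

theorem PComp.chainDepth (e : Δ.Ext φ inputCtx) (t₀ : ℕ) (hv : PComp Δ v) :
    PComp Δ (fun b => chainDepth (φ b).n (chainAdj t₀ (φ b).G) (v b)) := by
  classical
  refine PComp.sum (PComp.nodes e) (PBdd.nodes e) fun r e' hr he => ?_
  refine (PDec.hasPred e.var t₀ ?_).ite (.const 1) (.const 0)
  refine PComp.iterate PComp.snd ((PBdd.nodes e.var).mono fun x m hm => hm.2.2.le) hv.wk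
    fun r e' hr he => ?_
  exact PComp.chainPred e.var.var t₀ PComp.snd

theorem PComp.chainKey (e : Δ.Ext φ inputCtx) (t₀ : ℕ) (hv : PComp Δ v) :
    PComp Δ (fun b => chainKey (φ b).n (chainAdj t₀ (φ b).G) (BSP.rootNode t₀ (φ b).G) (v b)) := by
  unfold BSP.chainKey
  refine (PDec.eq hv (PComp.rootNode e t₀)).ite (.const 0) (((PComp.mul
    ((PComp.nodes e).add (.const 1)) (PComp.chainHead e t₀ hv)
    ((PBdd.nodes e).add (.const 1))).congr fun b _ _ => mul_comm _ _).add
    (PComp.chainDepth e t₀ hv) |>.add (.const 1))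

theorem PComp.nodeRank (e : Δ.Ext φ inputCtx) (t₀ : ℕ) (hv : PComp Δ v) :
    PComp Δ (fun b => nodeRank t₀ (φ b).G (v b)) :=
  PComp.sum (PComp.nodes e) (PBdd.nodes e) fun _ _ _ _ =>
    (PDec.lt (PComp.chainKey e.var t₀ PComp.snd) (PComp.chainKey e.var t₀ hv.wk)).ite
      (.const 1) (.const 0)

theorem PComp.nodeAt (e : Δ.Ext φ inputCtx) (t₀ : ℕ) (hi : PComp Δ i) :
    PComp Δ (fun b => nodeAt t₀ (φ b).G (i b)) :=
  PComp.findGreatest (PComp.nodes e) (PBdd.nodes e) fun _ _ _ _ =>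
    (PDec.lt PComp.snd (PComp.nodes e.var)).and
      (PDec.eq (PComp.nodeRank e.var t₀ PComp.snd) hi.wk)

theorem PDec.contAt (e : Δ.Ext φ inputCtx) (t₀ : ℕ) (hi : PComp Δ i) :
    PDec Δ (fun b => contAt t₀ (φ b).G (i b)) :=
  (PDec.lt hi (PComp.nodes e)).and (PDec.hasPred e t₀ (PComp.nodeAt e t₀ hi))

theorem PComp.kindOf (e : Δ.Ext φ inputCtx) (t₀ : ℕ) (hi : PComp Δ i) :
    PComp Δ (fun b => kindOf t₀ (BSP.contAt t₀ (φ b).G) (i b)) := by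
  classical
  unfold BSP.kindOf
  exact (PDec.eq hi (.const 0)).ite (.const 3) ((PDec.contAt e t₀ hi).ite (.const 1)
    ((PDec.const (t₀ = 1)).ite (.const 2) (.const 0)))

end graph

theorem kindOf_lt (t₀ : ℕ) (cont : ℕ → Prop) (i : ℕ) : kindOf t₀ cont i < 4 := by
  unfold kindOf
  split_ifs <;> omega

theorem PComp.argmin {α : Type} {Γ : Ctx α} {K : ℕ} (hK : 0 < K) {f : α → ℕ → ℕ}
    (hf : PComp₁ Γ (fun _ c => c < K) f) : PComp Γ (fun a => argmin K (f a)) := by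
  unfold BSP.argmin
  refine PComp.findGreatest (.const _) (.const _) fun r e hr he => ?_
  refine PDec.forall (.const K) (.const K) fun r' e' hr' he' => ?_
  refine PDec.le ?_ (hf.ext (Ctx.ext_var) r' e' hr' he')
  refine PComp.wk (D := fun _ i => i < K) (Γ := Γ.var r e hr he fun _ i => i ≤ K - 1)
    (f := fun x => f x.1 x.2) ?_
  exact (hf r e hr he).ext (φ := fun x => x) (Δ := Γ.var r e hr he fun _ i => i ≤ K - 1)
    ⟨fun _ => rfl, le_rfl, fun x m hm =>
      ⟨hm.1, hm.2.1, by have := hm.2.2; dsimp only at this; omega⟩⟩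

/-! ### Computability of transitions, penalties and final costs. -/

section decision

variable {M : CommModel} {P T g L t₀ : ℕ} [NeZero P] [NeZero T]
  {β : Type} {Δ : Ctx β} {φ : β → Inst} {x c i : β → ℕ}

theorem PComp.base (e : Δ.Ext φ inputCtx) : PComp Δ (fun b => base P T (φ b).n) :=
  ((PComp.nodes e).mul (.const _) (PBdd.nodes e)).add (.const 1)

theorem PBdd.base (e : Δ.Ext φ inputCtx) : PBdd Δ (fun b => base P T (φ b).n) :=
  ((PBdd.nodes e).mul (.const _)).add (.const 1)

theorem PComp.numCodes (e : Δ.Ext φ inputCtx) : PComp Δ (fun b => numCodes P T (φ b).n) :=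
  (PComp.base e).pow (PBdd.base e) _

theorem PBdd.numCodes (e : Δ.Ext φ inputCtx) : PBdd Δ (fun b => numCodes P T (φ b).n) :=
  (PBdd.base e).pow _

theorem PBdd.finsetSum {ι : Type*} {F : ι → β → ℕ} (s : Finset ι)
    (hF : ∀ i ∈ s, PBdd Δ (F i)) : PBdd Δ (fun a => ∑ i ∈ s, F i a) := by
  classical
  induction s using Finset.induction_on with
  | empty => simpa using PBdd.const 0
  | insert i s hi ih =>
    refine ((hF i (by simp)).add (ih fun j hj => hF j (by simp [hj]))).mono fun a _ _ => ?_
    rw [Finset.sum_insert hi]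

/-- There are constantly many control states. For each, the weights are constants, and only the
powers of the base are computed. -/
theorem PComp.codeWeight (e : Δ.Ext φ inputCtx) (hc : PComp Δ c)
    (hcK : ∀ b m, Δ.Rep b m → c b < numControls P T) :
    PComp Δ (fun b => codeWeight M P T (φ b).n (c b)) :=
  PComp.cases (F := fun q b => BSP.codeWeight M P T (φ b).n q) (numControls P T) hc (fun q _ =>
    PComp.finsetSum _ fun j _ => PComp.constMul _ ((PComp.base e).pow (PBdd.base e) _)) hcK

theorem PBdd.codeWeight (e : Δ.Ext φ inputCtx) :
    PBdd Δ (fun b => codeWeight M P T (φ b).n (c b)) :=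
  (PBdd.finsetSum Finset.univ fun (j : Fin 3 × Fin T × Fin P) _ =>
    (PBdd.const (P * P * T + 1)).mul ((PBdd.base e).pow (counter j : ℕ))).mono fun _ _ _ =>
      Finset.sum_le_sum fun j _ => Nat.mul_le_mul_right _ (Choice.weight_le M _ j)

/-- The decision problem for an instance. -/
noncomputable def Inst.decision (M : CommModel) (P T g L t₀ : ℕ) [NeZero P] [NeZero T]
    (I : Inst) : Decision :=
  scheduling M P T g L I.n t₀ (contAt t₀ I.G)

/-- The number of states of the decision problem. -/
def numStates (P T n : ℕ) : ℕ := numControls P T * numCodes P T n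

theorem numStates_pos (n : ℕ) : 0 < numStates P T n :=
  Nat.mul_pos numControls_pos (numCodes_pos n)

theorem PComp.numStates (e : Δ.Ext φ inputCtx) : PComp Δ (fun b => numStates P T (φ b).n) :=
  PComp.constMul _ (PComp.numCodes e)

theorem PBdd.numStates (e : Δ.Ext φ inputCtx) : PBdd Δ (fun b => numStates P T (φ b).n) :=
  (PBdd.const _).mul (PBdd.numCodes e)

theorem Inst.next_lt (I : Inst) (x : ℕ) {c : ℕ} (hc : c < numControls P T) :
    (I.decision M P T g L t₀).next x c < numStates P T I.n := by
  have h1 : (x % numCodes P T I.n + codeWeight M P T I.n c) % numCodes P T I.n <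
    numCodes P T I.n := Nat.mod_lt _ (numCodes_pos _)
  have h2 : (c + 1) * numCodes P T I.n ≤ numControls P T * numCodes P T I.n :=
    Nat.mul_le_mul_right _ hc
  rw [Nat.add_mul, one_mul] at h2
  change c * numCodes P T I.n + _ < _
  unfold BSP.numStates
  omega

theorem div_numCodes_lt {n x : ℕ} (hx : x < numStates P T n) :
    x / numCodes P T n < numControls P T :=
  (Nat.div_lt_iff_lt_mul (numCodes_pos n)).2 hx

theorem PComp.divCodes (e : Δ.Ext φ inputCtx) (hx : PComp Δ x)
    (hxN : ∀ b m, Δ.Rep b m → x b < BSP.numStates P T (φ b).n) :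
    PComp Δ (fun b => x b / BSP.numCodes P T (φ b).n) :=
  hx.div (PComp.numCodes e) ((PBdd.numStates e).mono fun b m hm => (hxN b m hm).le)

theorem PComp.modCodes (e : Δ.Ext φ inputCtx) (hx : PComp Δ x)
    (hxN : ∀ b m, Δ.Rep b m → x b < BSP.numStates P T (φ b).n) :
    PComp Δ (fun b => x b % BSP.numCodes P T (φ b).n) :=
  hx.mod (PComp.numCodes e) ((PBdd.numStates e).mono fun b m hm => (hxN b m hm).le)

theorem PComp.next (e : Δ.Ext φ inputCtx) (hx : PComp Δ x)
    (hxN : ∀ b m, Δ.Rep b m → x b < BSP.numStates P T (φ b).n) (hc : PComp Δ c)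
    (hcK : ∀ b m, Δ.Rep b m → c b < numControls P T) :
    PComp Δ (fun b => ((φ b).decision M P T g L t₀).next (x b) (c b)) := by
  refine PComp.add (PComp.mul hc (PComp.numCodes e)
    ((PBdd.const (numControls P T)).mono fun b m hm => (hcK b m hm).le)) ?_
  refine PComp.mod ((PComp.modCodes e hx hxN).add (PComp.codeWeight e hc hcK))
    (PComp.numCodes e) (PBdd.add ?_ (PBdd.codeWeight e))
  exact (PBdd.numCodes e).mono fun b m hm => (Nat.mod_lt _ (numCodes_pos _)).le

/-- Kind, old and new control state have constant ranges; for fixed values `Allowed` is a fixed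
proposition, so the relation is hard-wired. -/
theorem PComp.pen (e : Δ.Ext φ inputCtx) (hi : PComp Δ i) (hx : PComp Δ x)
    (hxN : ∀ b m, Δ.Rep b m → x b < BSP.numStates P T (φ b).n) (hc : PComp Δ c)
    (hcK : ∀ b m, Δ.Rep b m → c b < numControls P T) :
    PComp Δ (fun b => ((φ b).decision M P T g L t₀).pen (i b) (x b) (c b)) := by
  classical
  unfold Inst.decision scheduling
  refine PDec.ite ?_ (.const 0) (((PComp.nodes e).add (.const L)).add (.const 1))
  refine PDec.cases (F := fun k b => Allowed M P T k (x b / BSP.numCodes P T (φ b).n) (c b)) 4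
    (PComp.kindOf e t₀ hi) (fun k _ => ?_) fun b _ _ => kindOf_lt _ _ _
  refine PDec.cases (F := fun q b => Allowed M P T k q (c b)) (numControls P T)
    (PComp.divCodes e hx hxN) (fun q _ => ?_) fun b m hm => div_numCodes_lt (hxN b m hm)
  exact PDec.cases (F := fun q' b => Allowed M P T k q q') (numControls P T) hc
    (fun q' _ => .const _) hcK

theorem PComp.fin (e : Δ.Ext φ inputCtx) (hx : PComp Δ x)
    (hxN : ∀ b m, Δ.Rep b m → x b < BSP.numStates P T (φ b).n) :
    PComp Δ (fun b => ((φ b).decision M P T g L t₀).fin (x b)) := by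
  have hdigit : ∀ j : Fin 3 × Fin T × Fin P, PComp Δ (fun b => x b % BSP.numCodes P T (φ b).n /
      BSP.base P T (φ b).n ^ (counter j : ℕ) % BSP.base P T (φ b).n) := fun j => by
    have hle : PBdd Δ fun b => x b % BSP.numCodes P T (φ b).n :=
      (PBdd.numCodes e).mono fun b m hm => (Nat.mod_lt _ (numCodes_pos _)).le
    exact ((PComp.modCodes e hx hxN).div ((PComp.base e).pow (PBdd.base e) _) hle).mod
      (PComp.base e) (hle.mono fun b m hm => Nat.div_le_self _ _)
  refine PComp.cases (F := fun q b => costOf (P := P) (T := T) g L (decode P T q).1 fun j =>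
    x b % BSP.numCodes P T (φ b).n / BSP.base P T (φ b).n ^ (counter j : ℕ) %
      BSP.base P T (φ b).n) (numControls P T) (PComp.divCodes e hx hxN) (fun q _ => ?_)
    fun b m hm => div_numCodes_lt (hxN b m hm)
  refine PComp.finsetSum _ fun s _ => (PDec.const _).ite ?_ (.const 0)
  exact ((PComp.finsetSup _ fun p _ => hdigit _).add (PComp.constMul g
    (PComp.finsetSup _ fun p _ => (hdigit _).max (hdigit _)))).add (.const L)

end decision

end BSP

namespace BSP

/-! ### Solving the decision problem -/

section solve

variable {M : CommModel} {P T g L t₀ : ℕ} [NeZero P] [NeZero T]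

/-- The values of the decision problem in a linear order. -/
noncomputable def valTable (M : CommModel) (P T g L t₀ : ℕ) [NeZero P] [NeZero T] (I : Inst)
    (k : ℕ) : ℕ :=
  (I.decision M P T g L t₀).val (k / numStates P T I.n) (k % numStates P T I.n)

/-- The length of the table of values. -/
def valTableSize (P T : ℕ) (I : Inst) : ℕ := numStates P T I.n * (I.n + 1)

theorem valTable_apply (I : Inst) (j : ℕ) {y : ℕ} (hy : y < numStates P T I.n) :
    valTable M P T g L t₀ I (numStates P T I.n * j + y) =
      (I.decision M P T g L t₀).val j y := by
  rw [valTable, Nat.mul_add_div (numStates_pos _), Nat.mul_add_mod, Nat.div_eq_of_lt hy,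
    Nat.mod_eq_of_lt hy, add_zero]

theorem index_lt {N j n y : ℕ} (hj : j < n) (hy : y < N) : N * j + y < N * n := by
  have : N * (j + 1) ≤ N * n := Nat.mul_le_mul_left _ hj
  rw [Nat.mul_add, mul_one] at this
  omega

section general

variable {β : Type} {Δ : Ctx β} {φ : β → Inst} {x c i j : β → ℕ}

/-- The objective that a decision minimizes. The recursion is replaced by a look-up in array `2`,
whose row `j` must already be complete. -/
theorem PComp.stepVal (e : Δ.Ext φ inputCtx) (hi : PComp Δ i) (hj : PComp Δ j) (hx : PComp Δ x)
    (hxN : ∀ b m, Δ.Rep b m → x b < BSP.numStates P T (φ b).n)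
    (htab : ∀ b m, Δ.Rep b m → ∀ y < BSP.numStates P T (φ b).n,
      m.arr 2 (BSP.numStates P T (φ b).n * j b + y) =
        ((φ b).decision M P T g L t₀).val (j b) y) :
    PComp₁ Δ (fun _ c => c < numControls P T) (fun b c =>
      ((φ b).decision M P T g L t₀).pen (i b) (x b) c +
        ((φ b).decision M P T g L t₀).val (j b)
          (((φ b).decision M P T g L t₀).next (x b) c)) := by
  intro r e' hr he
  refine PComp.add (PComp.pen e.var hi.wk hx.wk (fun b m hm => hxN b.1 m hm.1) PComp.snd
    fun b m hm => hm.2.2) ?_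
  refine PComp.read 2 (((PComp.numStates (P := P) (T := T) e.var).mul hj.wk
    (PBdd.numStates e.var)).add (PComp.next (M := M) (P := P) (T := T) (g := g) (L := L) (t₀ := t₀)
      e.var hx.wk (fun b m hm => hxN b.1 m hm.1) PComp.snd fun b m hm => hm.2.2)) fun b m hm => ?_
  exact htab b.1 m hm.1 _ (Inst.next_lt _ _ hm.2.2)

end general

/-- The rows are ordered by the number of remaining steps: row `0` contains final costs, and every
later row reads only the row before it. -/
theorem PComp.valTable (r e : ℕ) (hr he) :
    PComp (inputCtx.tab 2 (valTableSize P T) (BSP.valTable M P T g L t₀) r e hr he)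
      (fun x => BSP.valTable M P T g L t₀ x.1 x.2) := by
  set Γ := inputCtx.tab 2 (valTableSize P T) (BSP.valTable M P T g L t₀) r e hr he with hΓ
  have hext : Γ.Ext Prod.fst inputCtx :=
    ⟨fun _ => rfl, by simp [hΓ, Ctx.tab, inputCtx], fun _ _ h => h.1.1⟩
  have hk : PComp Γ (fun x => x.2) := .expr (.reg r) fun _ _ h => h.1.2.1
  have hkb : PBdd Γ (fun x => x.2) :=
    ((PBdd.numStates (P := P) (T := T) hext).mul ((PBdd.nodes hext).add (.const 1))).mono
      fun x m hm => hm.1.2.2.le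
  have hdiv : PComp Γ (fun x => x.2 / BSP.numStates P T x.1.n) := hk.div (PComp.numStates hext) hkb
  have hmod : PComp Γ (fun x => x.2 % BSP.numStates P T x.1.n) := hk.mod (PComp.numStates hext) hkb
  have hlt : ∀ x m, Γ.Rep x m → x.2 % BSP.numStates P T x.1.n < BSP.numStates P T x.1.n :=
    fun x m _ => Nat.mod_lt _ (numStates_pos _)
  have hstep := PComp.stepVal (M := M) (P := P) (T := T) (g := g) (L := L) (t₀ := t₀)
    (Δ := Γ.restrict fun x => ¬ x.2 / BSP.numStates P T x.1.n = 0) hext.restrict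
    (i := fun x => x.1.n - 1 - (x.2 / BSP.numStates P T x.1.n - 1))
    (j := fun x => x.2 / BSP.numStates P T x.1.n - 1) (x := fun x => x.2 % BSP.numStates P T x.1.n)
    ((((PComp.nodes hext).sub (.const 1)).sub (hdiv.sub (.const 1))).ext Ctx.ext_restrict)
    ((hdiv.sub (.const 1)).ext Ctx.ext_restrict) (hmod.ext Ctx.ext_restrict)
    (fun x m hm => hlt x m hm.1) fun x m hm y hy => by
      -- Every index in the previous row is smaller than the current index, so that row has been
      -- filled.
      have h1 : BSP.numStates P T x.1.n * (x.2 / BSP.numStates P T x.1.n - 1) + y < x.2 :=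
        (index_lt (Nat.sub_lt (Nat.pos_of_ne_zero hm.2) one_pos) hy).trans_le (Nat.mul_div_le _ _)
      rw [hm.1.2 _ h1, valTable_apply _ _ hy]
  refine ((PDec.eq hdiv (.const 0)).iteOn
    ((PComp.fin (M := M) (g := g) (L := L) (t₀ := t₀) hext hmod hlt).ext Ctx.ext_restrict)
    (PComp.subst (PComp.argmin numControls_pos hstep) hstep fun x m _ =>
      argmin_lt numControls_pos _)).congr fun x m _ => ?_
  unfold BSP.valTable
  split_ifs with h
  · rw [h]
    rfl
  · obtain ⟨j, hj⟩ := Nat.exists_eq_succ_of_ne_zero h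
    rw [hj]
    rfl

/-- The input together with the table of values in array `2`. -/
noncomputable def valCtx (M : CommModel) (P T g L t₀ : ℕ) [NeZero P] [NeZero T] : Ctx Inst :=
  inputCtx.table 2 (valTableSize P T) (BSP.valTable M P T g L t₀)

theorem valCtx_ext : (valCtx M P T g L t₀).Ext (fun I => I) inputCtx :=
  ⟨fun _ => rfl, le_rfl, fun _ _ h => h.1⟩

theorem PRun.valCtx : PRun inputCtx (valCtx M P T g L t₀) :=
  PRun.table (by simp [inputCtx]) ((PComp.numStates (Ctx.Ext.refl _)).mul
    ((PComp.nodes (Ctx.Ext.refl _)).add (.const 1)) (PBdd.numStates (Ctx.Ext.refl _)))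
    ((PBdd.numStates (Ctx.Ext.refl _)).mul ((PBdd.nodes (Ctx.Ext.refl _)).add (.const 1)))
    PComp.valTable

/-- The control state chosen for position `i`. -/
noncomputable def Inst.control (M : CommModel) (P T g L t₀ : ℕ) [NeZero P] [NeZero T] (I : Inst)
    (i : ℕ) : ℕ :=
  (I.decision M P T g L t₀).best i
    ((I.decision M P T g L t₀).bestState (initState P T I.n) i)

theorem Inst.best_lt (I : Inst) (i x : ℕ) :
    (I.decision M P T g L t₀).best i x < numControls P T :=
  argmin_lt numControls_pos _

theorem Inst.bestState_lt (I : Inst) (i : ℕ) :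
    (I.decision M P T g L t₀).bestState (initState P T I.n) i < numStates P T I.n := by
  cases i with
  | zero => exact Nat.mul_lt_mul_of_pos_right (encode_lt _) (numCodes_pos _)
  | succ i => exact I.next_lt _ (I.best_lt _ _)

variable {β : Type} {Δ : Ctx β} {φ : β → Inst} {x i : β → ℕ}

theorem PComp.best (e : Δ.Ext φ (BSP.valCtx M P T g L t₀)) (hi : PComp Δ i) (hx : PComp Δ x)
    (hxN : ∀ b m, Δ.Rep b m → x b < BSP.numStates P T (φ b).n) :
    PComp Δ (fun b => ((φ b).decision M P T g L t₀).best (i b) (x b)) := by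
  have e' := e.trans valCtx_ext
  refine PComp.argmin numControls_pos (PComp.stepVal e' hi
    (((PComp.nodes e').sub (.const 1)).sub hi) hx hxN fun b m hm y hy => ?_)
  have hlt : (φ b).n - 1 - i b < (φ b).n + 1 := by omega
  have hn : ((φ b).decision M P T g L t₀).n = (φ b).n := rfl
  rw [hn, (e.rep b m hm).2 _ (index_lt hlt hy), valTable_apply _ _ hy]

/-- The state is recomputed from the beginning for each query; with the values tabulated this is a
loop of length at most `n`. -/
theorem PComp.bestState (e : Δ.Ext φ (BSP.valCtx M P T g L t₀)) (hi : PComp Δ i)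
    (hin : ∀ b m, Δ.Rep b m → i b ≤ (φ b).n) :
    PComp Δ (fun b => ((φ b).decision M P T g L t₀).bestState (initState P T (φ b).n) (i b)) := by
  have e' := e.trans valCtx_ext
  have hrec : ∀ (I : Inst) k, Nat.rec (initState P T I.n) (fun i y =>
      (I.decision M P T g L t₀).next y ((I.decision M P T g L t₀).best i y)) k =
      (I.decision M P T g L t₀).bestState (initState P T I.n) k := by
    intro I k
    induction k with
    | zero => rfl
    | succ k ih => simp only [ih, Decision.bestState]
  refine (PComp.natRec (f₀ := fun b => initState P T (φ b).n) (f := fun b i y =>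
    ((φ b).decision M P T g L t₀).next y (((φ b).decision M P T g L t₀).best i y)) hi
    ((PBdd.nodes e').mono hin) (PComp.constMul _ (PComp.numCodes e'))
    fun r e₁ hr he r' e₂ hr' he' => ?_).congr fun b m _ => hrec _ _
  -- The context knows that the accumulator is a genuine state of the recursion, hence below
  -- `numStates`.
  have hlt : ∀ b m, (Ctx.var (Δ.var r e₁ hr he fun a k => k < i a) r' e₂ hr' he' fun x y =>
      y = Nat.rec (initState P T (φ x.1).n) (fun i y => ((φ x.1).decision M P T g L t₀).next y
        (((φ x.1).decision M P T g L t₀).best i y)) x.2).Rep b m →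
      b.2 < BSP.numStates P T (φ b.1.1).n := fun b m hm => by
    rw [hm.2.2, hrec]
    exact Inst.bestState_lt _ _
  refine PComp.next e'.var.var PComp.snd hlt (PComp.best e.var.var PComp.snd.wk PComp.snd hlt)
    fun b m hm => Inst.best_lt _ _ _

theorem PComp.control (e : Δ.Ext φ (BSP.valCtx M P T g L t₀)) (hi : PComp Δ i)
    (hin : ∀ b m, Δ.Rep b m → i b < (φ b).n) :
    PComp Δ (fun b => (φ b).control M P T g L t₀ (i b)) :=
  PComp.best e hi (PComp.bestState e hi fun b m hm => (hin b m hm).le)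
    fun _ _ _ => Inst.bestState_lt _ _

end solve

end BSP

namespace BSP

/-! ### Writing the output -/

open Classical in
/-- The number of `i < e` with `b i`. -/
noncomputable def countBelow (b : ℕ → Prop) (e : ℕ) : ℕ :=
  ∑ i ∈ Finset.range e, if b i then 1 else 0

open Classical in
/-- The number with `b` that is preceded by `k` others, if it is at most `N`. -/
noncomputable def nthTrue (b : ℕ → Prop) (N k : ℕ) : ℕ :=
  Nat.findGreatest (fun e => b e ∧ countBelow b e = k) N

theorem countBelow_eq_count (b : ℕ → Prop) [DecidablePred b] (e : ℕ) :
    countBelow b e = Nat.count b e := by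
  rw [Nat.count_eq_card_filter_range, Finset.card_filter, countBelow]
  exact Finset.sum_congr rfl fun i _ => by congr

/-- The count grows by steps of at most `1`, so it equals `k` at the element where it passes from
`k` to `k + 1`. -/
theorem nthTrue_spec {b : ℕ → Prop} {N k : ℕ} (hk : k < countBelow b N) :
    b (nthTrue b N k) ∧ countBelow b (nthTrue b N k) = k := by
  classical
  have hex : ∃ e ≤ N, b e ∧ countBelow b e = k := by
    induction N with
    | zero => simp [countBelow] at hk
    | succ N ih =>
      by_cases hlt : k < countBelow b N
      · obtain ⟨e, he, h⟩ := ih hlt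
        exact ⟨e, by omega, h⟩
      · have hs : countBelow b (N + 1) = countBelow b N + if b N then 1 else 0 :=
          (Finset.sum_range_succ _ _).trans (by congr)
        split_ifs at hs with hb
        · exact ⟨N, by omega, hb, by omega⟩
        · omega
  obtain ⟨e, he, h⟩ := hex
  exact Nat.findGreatest_spec (P := fun e => b e ∧ countBelow b e = k) he h

/-- A finite set, listed in the order of the codes of its elements. -/
theorem exists_list {X : Type*} [DecidableEq X] (Γ : Finset X) {code : X → ℕ}
    (hcode : Function.Injective code) {b : ℕ → Prop} (h : ∀ e, b e ↔ ∃ x ∈ Γ, code x = e) {N : ℕ}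
    (hN : ∀ e, b e → e < N) :
    ∃ C : List X, C.Nodup ∧ C.toFinset = Γ ∧ C.length = countBelow b N ∧
      ∀ (k : ℕ) (hk : k < C.length), code C[k] = nthTrue b N k := by
  classical
  have hcard : Γ.card = countBelow b N := by
    rw [countBelow, ← Finset.card_filter, ← Finset.card_image_of_injective Γ hcode]
    congr 1
    ext e
    simp only [Finset.mem_image, Finset.mem_filter, Finset.mem_range, ← h]
    exact ⟨fun he => ⟨hN e he, he⟩, fun he => he.2⟩
  have hx : ∀ k : Fin (countBelow b N), ∃ x ∈ Γ, code x = nthTrue b N k := fun k =>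
    (h _).1 (nthTrue_spec k.2).1
  choose x hx hxc using hx
  have hinj : Function.Injective x := fun k l hkl => Fin.ext <| by
    rw [← (nthTrue_spec k.2).2, ← (nthTrue_spec l.2).2, ← hxc, ← hxc, hkl]
  refine ⟨List.ofFn x, List.nodup_ofFn.2 hinj, ?_, by simp, fun k hk => by simp [hxc]⟩
  refine Finset.eq_of_subset_of_card_le (fun y hy => ?_) ?_
  · obtain ⟨k, rfl⟩ := (List.mem_ofFn' _ _).1 (List.mem_toFinset.1 hy)
    exact hx k
  · rw [List.toFinset_card_of_nodup (List.nodup_ofFn.2 hinj)]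
    simp [hcard]

section lists

variable {α : Type} {Γ : Ctx α} {N k : α → ℕ} {b : α → ℕ → Prop}

theorem PComp.countBelow (hN : PComp Γ N) (hN' : PBdd Γ N) (hb : PDec₁ Γ (fun _ _ => True) b) :
    PComp Γ (fun a => countBelow (b a) (N a)) := by
  classical
  refine PComp.sum hN hN' fun r e hr he => PDec.ite ?_ (.const 1) (.const 0)
  exact (hb r e hr he).ext (φ := fun x => x) (Δ := Γ.var r e hr he _)
    ⟨fun _ => rfl, le_rfl, fun x m hm => ⟨hm.1, hm.2.1, trivial⟩⟩

theorem PComp.nthTrue (hN : PComp Γ N) (hN' : PBdd Γ N) (hk : PComp Γ k)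
    (hb : PDec₁ Γ (fun _ _ => True) b) : PComp Γ (fun a => nthTrue (b a) (N a) (k a)) := by
  classical
  refine PComp.findGreatest hN hN' fun r e hr he => ?_
  refine PDec.and ?_ (PDec.eq (PComp.countBelow PComp.snd (hN'.wk.mono fun x m hm => hm.2.2)
    (hb.ext Ctx.ext_var)) hk.wk)
  exact (hb r e hr he).ext (φ := fun x => x) (Δ := Γ.var r e hr he _)
    ⟨fun _ => rfl, le_rfl, fun x m hm => ⟨hm.1, hm.2.1, trivial⟩⟩

/-- The second condition need only be decidable where the first one holds. -/
theorem PDec.andOn {P Q : α → Prop} (hP : PDec Γ P) (hQ : PDec (Γ.restrict P) Q) :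
    PDec Γ (fun a => P a ∧ Q a) := by
  classical
  exact ⟨_, hP.iteOn (hQ.ite (.const 1) (.const 0)) (.const 0), fun a m hm => by simp⟩

end lists

section solution

variable (M : CommModel) (P T g L t₀ : ℕ) [NeZero P] [NeZero T]

/-- The number of possible communication steps of a node. -/
def numSteps : ℕ := Fintype.card (Fin P × Fin P × Fin T)

theorem numSteps_pos : 0 < numSteps P T := Fintype.card_pos

/-- The number of a communication step. -/
noncomputable def encodeStep (c : Fin P × Fin P × Fin T) : ℕ := Fintype.equivFin _ c

/-- The communication step with a given number. -/
noncomputable def decodeStep (q : ℕ) : Fin P × Fin P × Fin T :=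
  (Fintype.equivFin _).symm ⟨q % numSteps P T, Nat.mod_lt _ (numSteps_pos P T)⟩

variable {P T} in
theorem encodeStep_lt (c : Fin P × Fin P × Fin T) : encodeStep P T c < numSteps P T :=
  (Fintype.equivFin _ c).2

variable {P T} in
theorem decodeStep_eq {q : ℕ} (hq : q < numSteps P T) (c : Fin P × Fin P × Fin T) :
    decodeStep P T q = c ↔ q = encodeStep P T c := by
  rw [decodeStep, Equiv.symm_apply_eq, Fin.ext_iff]
  change q % numSteps P T = _ ↔ _
  rw [Nat.mod_eq_of_lt hq]
  rfl

namespace Inst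

variable (I : Inst)

/-- The optimal choice for a node. -/
noncomputable def choice (v : ℕ) : Choice P T :=
  (decode P T (I.control M P T g L t₀ (nodeRank t₀ I.G v))).2.2

/-- The last control state of the optimal solution. -/
noncomputable def lastControl : ℕ :=
  (I.decision M P T g L t₀).bestState (initState P T I.n) I.n / numCodes P T I.n

/-- The communication step with number `e` is used. -/
def UsesStep (e : ℕ) : Prop :=
  e < I.n * numSteps P T ∧
    decodeStep P T (e % numSteps P T) ∈ (I.choice M P T g L t₀ (e / numSteps P T)).2.2

/-- The number of communication steps. -/
noncomputable def commCount : ℕ :=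
  countBelow (I.UsesStep M P T g L t₀) (I.n * numSteps P T)

/-- Entry `j` of the `k`th communication step. -/
noncomputable def commEntry (k j : ℕ) : ℕ :=
  let e := nthTrue (I.UsesStep M P T g L t₀) (I.n * numSteps P T) k
  let c := decodeStep P T (e % numSteps P T)
  if j = 0 then e / numSteps P T
  else if j = 1 then c.1
  else if j = 2 then c.2.1
  else c.2.2

/-- The output word. -/
noncomputable def outEntry (i : ℕ) : ℕ :=
  if i = 0 then (decode P T (I.lastControl M P T g L t₀)).1
  else if i < 2 * I.n + 1 then
    if (i - 1) % 2 = 0 then (I.choice M P T g L t₀ ((i - 1) / 2)).1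
    else (I.choice M P T g L t₀ ((i - 1) / 2)).2.1
  else if i = 2 * I.n + 1 then I.commCount M P T g L t₀
  else I.commEntry M P T g L t₀ ((i - (2 * I.n + 2)) / 4) ((i - (2 * I.n + 2)) % 4)

/-- The length of the output word. -/
noncomputable def outLength : ℕ := 2 * I.n + 2 + 4 * I.commCount M P T g L t₀

end Inst

variable {M P T g L t₀} {β : Type} {Δ : Ctx β} {φ : β → Inst} {v i k j : β → ℕ}

/-- `F` can be arbitrary: it depends on one of constantly many control states and is tabulated in
the program. -/
theorem PComp.choice (e : Δ.Ext φ (BSP.valCtx M P T g L t₀)) (hv : PComp Δ v)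
    (hvn : ∀ b m, Δ.Rep b m → v b < (φ b).n) (F : Choice P T → ℕ) :
    PComp Δ (fun b => F ((φ b).choice M P T g L t₀ (v b))) :=
  PComp.cases (F := fun q _ => F (decode P T q).2.2) (numControls P T)
    (PComp.control e (PComp.nodeRank (e.trans valCtx_ext) t₀ hv) fun b m hm =>
      IsChains.rank_lt (hvn b m hm)) (fun _ _ => .const _) fun _ _ _ => Inst.best_lt _ _ _

theorem PDec.choice (e : Δ.Ext φ (BSP.valCtx M P T g L t₀)) (hv : PComp Δ v)
    (hvn : ∀ b m, Δ.Rep b m → v b < (φ b).n) (F : Choice P T → Prop) :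
    PDec Δ (fun b => F ((φ b).choice M P T g L t₀ (v b))) := by
  classical
  exact ⟨_, PComp.choice e hv hvn fun c => if F c then 1 else 0, fun b m _ => by simp⟩

theorem PComp.mulSteps (e : Δ.Ext φ inputCtx) : PComp Δ (fun b => (φ b).n * numSteps P T) :=
  (PComp.nodes e).mul (.const _) (PBdd.nodes e)

theorem PBdd.mulSteps (e : Δ.Ext φ inputCtx) : PBdd Δ (fun b => (φ b).n * numSteps P T) :=
  (PBdd.nodes e).mul (.const _)

theorem PDec.usesStep (e : Δ.Ext φ (BSP.valCtx M P T g L t₀)) (hi : PComp Δ i) :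
    PDec Δ (fun b => (φ b).UsesStep M P T g L t₀ (i b)) := by
  have e' := e.trans valCtx_ext
  refine (PDec.lt hi (PComp.mulSteps e')).andOn ?_
  set Θ := Δ.restrict fun b => i b < (φ b).n * numSteps P T with hΘ
  have eΘ : Θ.Ext φ (BSP.valCtx M P T g L t₀) := e.restrict
  have hiΘ : PComp Θ i := hi.ext Ctx.ext_restrict
  have hb : PBdd Θ i := (PBdd.mulSteps (eΘ.trans valCtx_ext)).mono fun b m hm => hm.2.le
  refine PDec.cases (F := fun q b => decodeStep P T q ∈
    ((φ b).choice M P T g L t₀ (i b / numSteps P T)).2.2) (numSteps P T)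
    (hiΘ.mod (.const _) hb) (fun q _ => ?_) fun b m hm => Nat.mod_lt _ (numSteps_pos P T)
  exact PDec.choice eΘ (hiΘ.div (.const _) hb) (fun b m hm =>
    (Nat.div_lt_iff_lt_mul (numSteps_pos P T)).2 hm.2) fun c => decodeStep P T q ∈ c.2.2

theorem PDec₁.usesStep (e : Δ.Ext φ (BSP.valCtx M P T g L t₀)) :
    PDec₁ Δ (fun _ _ => True) (fun b => (φ b).UsesStep M P T g L t₀) :=
  fun _ _ _ _ => PDec.usesStep e.var PComp.snd

theorem PComp.commCount (e : Δ.Ext φ (BSP.valCtx M P T g L t₀)) :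
    PComp Δ (fun b => (φ b).commCount M P T g L t₀) :=
  PComp.countBelow (PComp.mulSteps (e.trans valCtx_ext)) (PBdd.mulSteps (e.trans valCtx_ext))
    (PDec₁.usesStep e)

theorem PBdd.commCount (e : Δ.Ext φ (BSP.valCtx M P T g L t₀)) :
    PBdd Δ (fun b => (φ b).commCount M P T g L t₀) := by
  classical
  refine (PBdd.mulSteps (P := P) (T := T) (e.trans valCtx_ext)).mono fun b m _ => ?_
  rw [Inst.commCount, countBelow_eq_count]
  exact Nat.count_le _

theorem PComp.commEntry (e : Δ.Ext φ (BSP.valCtx M P T g L t₀)) (hk : PComp Δ k)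
    (hj : PComp Δ j) : PComp Δ (fun b => (φ b).commEntry M P T g L t₀ (k b) (j b)) := by
  have e' := e.trans valCtx_ext
  have hn := PComp.nthTrue (b := fun b => (φ b).UsesStep M P T g L t₀)
    (PComp.mulSteps (P := P) (T := T) e') (PBdd.mulSteps e') hk (PDec₁.usesStep e)
  have hb : PBdd Δ fun b => BSP.nthTrue ((φ b).UsesStep M P T g L t₀) ((φ b).n * numSteps P T)
      (k b) := (PBdd.mulSteps (P := P) (T := T) e').mono fun b m _ => by
        classical exact Nat.findGreatest_le _
  have hc : ∀ F : Fin P × Fin P × Fin T → ℕ, PComp Δ fun b => F (decodeStep P T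
      (BSP.nthTrue ((φ b).UsesStep M P T g L t₀) ((φ b).n * numSteps P T) (k b) %
        numSteps P T)) := fun F =>
    PComp.cases (F := fun q _ => F (decodeStep P T q)) (numSteps P T) (hn.mod (.const _) hb)
      (fun q _ => .const _) fun b m _ => Nat.mod_lt _ (numSteps_pos P T)
  exact (PDec.eq hj (.const 0)).ite (hn.div (.const _) hb) ((PDec.eq hj (.const 1)).ite
    (hc fun c => c.1) ((PDec.eq hj (.const 2)).ite (hc fun c => c.2.1) (hc fun c => c.2.2)))

theorem PComp.outEntry (e : Δ.Ext φ (BSP.valCtx M P T g L t₀)) (hi : PComp Δ i)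
    (hib : PBdd Δ i) : PComp Δ (fun b => (φ b).outEntry M P T g L t₀ (i b)) := by
  have e' := e.trans valCtx_ext
  have hlast : PComp Δ (fun b => ((decode P T ((φ b).lastControl M P T g L t₀)).1 : ℕ)) :=
    PComp.cases (F := fun q _ => ((decode P T q).1 : ℕ)) (numControls P T)
      (PComp.divCodes e' (PComp.bestState e (PComp.nodes e') fun _ _ _ => le_rfl)
        fun _ _ _ => Inst.bestState_lt _ _)
      (fun _ _ => .const _) fun _ _ _ => div_numCodes_lt (Inst.bestState_lt _ _)
  have hpred : PComp Δ fun b => i b - 1 := hi.sub (.const 1)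
  have hpredb : PBdd Δ fun b => i b - 1 := hib.mono fun _ _ _ => Nat.sub_le _ _
  have hrest : PComp Δ fun b => i b - (2 * (φ b).n + 2) :=
    hi.sub (((PComp.nodes e').constMul 2).add (.const 2))
  have hrestb : PBdd Δ fun b => i b - (2 * (φ b).n + 2) := hib.mono fun _ _ _ => Nat.sub_le _ _
  refine (PDec.eq hi (.const 0)).iteOn (hlast.ext Ctx.ext_restrict) ?_
  refine ((PDec.lt hi (((PComp.nodes e').constMul 2).add (.const 1))).ext
    Ctx.ext_restrict).iteOn ?_ (((PDec.eq hi (((PComp.nodes e').constMul 2).add (.const 1))).ite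
      (PComp.commCount e) (PComp.commEntry e (hrest.div (.const 4) hrestb)
        (hrest.mod (.const 4) hrestb))).ext (Ctx.ext_restrict.trans Ctx.ext_restrict))
  have hdiv := (hpred.div (.const 2) hpredb).ext
    ((Ctx.ext_restrict (P := fun b => i b < 2 * (φ b).n + 1)).trans
      (Ctx.ext_restrict (P := fun b => ¬ i b = 0)))
  have hmod := (hpred.mod (.const 2) hpredb).ext
    ((Ctx.ext_restrict (P := fun b => i b < 2 * (φ b).n + 1)).trans
      (Ctx.ext_restrict (P := fun b => ¬ i b = 0)))
  have hlt : ∀ b m, ((Δ.restrict fun b => ¬ i b = 0).restrict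
      fun b => i b < 2 * (φ b).n + 1).Rep b m → (i b - 1) / 2 < (φ b).n := fun b m hm => by
    have h1 : ¬ i b = 0 := hm.1.2
    have h2 : i b < 2 * (φ b).n + 1 := hm.2
    omega
  have er := (e.restrict (P := fun b => ¬ i b = 0)).restrict (P := fun b => i b < 2 * (φ b).n + 1)
  exact (PDec.eq hmod (.const 0)).ite (PComp.choice er hdiv hlt fun c => c.1)
    (PComp.choice er hdiv hlt fun c => c.2.1)

/-- The output word in array `1`. -/
noncomputable def outCtx (M : CommModel) (P T g L t₀ : ℕ) [NeZero P] [NeZero T] : Ctx Inst :=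
  (BSP.valCtx M P T g L t₀).table 1 (Inst.outLength M P T g L t₀) (Inst.outEntry M P T g L t₀)

theorem PRun.outCtx : PRun inputCtx (outCtx M P T g L t₀) := by
  refine (PRun.valCtx (M := M) (P := P) (T := T) (g := g) (L := L) (t₀ := t₀)).trans
    (fun _ => rfl) ?_
  have e : (BSP.valCtx M P T g L t₀).Ext (fun I => I) (BSP.valCtx M P T g L t₀) := .refl _
  have e' := e.trans valCtx_ext
  refine PRun.table (by simp [BSP.valCtx, Ctx.table, inputCtx])
    ((((PComp.nodes e').constMul 2).add (.const 2)).add ((PComp.commCount e).constMul 4)) ?_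
    fun r d hr hd => ?_
  · exact (((PBdd.const 2).mul (PBdd.nodes e')).add (.const 2)).add
      ((PBdd.const 4).mul (PBdd.commCount e))
  · set Γ := (BSP.valCtx M P T g L t₀).tab 1 (Inst.outLength M P T g L t₀)
      (Inst.outEntry M P T g L t₀) r d hr hd with hΓ
    have hext : Γ.Ext Prod.fst (BSP.valCtx M P T g L t₀) :=
      ⟨fun _ => rfl, by simp [hΓ, Ctx.tab, BSP.valCtx, Ctx.table, inputCtx], fun _ _ h => h.1.1⟩
    refine PComp.outEntry hext (.expr (.reg r) fun _ _ h => h.1.2.1) ?_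
    exact ((((PBdd.const 2).mul (PBdd.nodes (hext.trans valCtx_ext))).add (.const 2)).add
      ((PBdd.const 4).mul (PBdd.commCount hext))).mono fun x m hm => hm.1.2.2.le

theorem length_outputWord {n : ℕ} (σ : Schedule (Fin n) P)
    (C : List (Fin n × Fin P × Fin P × Fin σ.S)) :
    (outputWord σ C).length = 2 * n + 2 + 4 * C.length := by
  simp [outputWord, List.length_flatMap]
  ring

/-- The computed word is an output word for the schedule given by the optimal choices. -/
theorem outputs_ofChoices (I : Inst) {S : ℕ} (hS : S ≤ T)
    (hl : ((decode P T (I.lastControl M P T g L t₀)).1 : ℕ) = S)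
    (hc : ∀ v : Fin I.n, (I.choice M P T g L t₀ v).Fits S) {m : Store}
    (hm : (outCtx M P T g L t₀).Rep I m) :
    Outputs m (Schedule.ofChoices S hS (fun v : Fin I.n => I.choice M P T g L t₀ v) hc) := by
  set σ := Schedule.ofChoices S hS (fun v : Fin I.n => I.choice M P T g L t₀ v) hc with hσ
  -- The quotient by `numSteps` is the node and the remainder the step, as in `UsesStep`; listing
  -- communication steps by code makes the `k`th one computable.
  let code : Fin I.n × Fin P × Fin P × Fin S → ℕ := fun x =>
    numSteps P T * x.1 + encodeStep P T (x.2.1, x.2.2.1, Fin.castLE hS x.2.2.2)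
  have hdiv : ∀ x, code x / numSteps P T = x.1 := fun x => by
    simp only [code]
    rw [Nat.mul_add_div (numSteps_pos P T), Nat.div_eq_of_lt (encodeStep_lt _), add_zero]
  have hdec : ∀ x, decodeStep P T (code x % numSteps P T) =
      (x.2.1, x.2.2.1, Fin.castLE hS x.2.2.2) := fun x => by
    rw [decodeStep_eq (Nat.mod_lt _ (numSteps_pos P T))]
    simp only [code]
    rw [Nat.mul_add_mod, Nat.mod_eq_of_lt (encodeStep_lt _)]
  have hinj : Function.Injective code := fun x y hxy => by
    have h1 := hdec x
    rw [hxy, hdec y] at h1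
    have h2 := hdiv x
    rw [hxy, hdiv y] at h2
    simp only [Prod.mk.injEq, Fin.castLE_inj] at h1
    exact Prod.ext (Fin.ext h2.symm) (Prod.ext h1.1.symm (Prod.ext h1.2.1.symm h1.2.2.symm))
  have hlt : ∀ x, code x < I.n * numSteps P T := fun x => by
    rw [mul_comm]
    exact index_lt x.1.2 (encodeStep_lt _)
  have huses : ∀ e, I.UsesStep M P T g L t₀ e ↔ ∃ x ∈ σ.Γ, code x = e := fun e => by
    constructor
    · rintro ⟨he, hmem⟩
      have hv : e / numSteps P T < I.n := (Nat.div_lt_iff_lt_mul (numSteps_pos P T)).2 he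
      obtain ⟨p₁, p₂, s, hd⟩ : ∃ p₁ p₂ s, decodeStep P T (e % numSteps P T) = (p₁, p₂, s) :=
        ⟨_, _, _, rfl⟩
      rw [hd] at hmem
      obtain ⟨s, rfl, hmem'⟩ := Schedule.exists_mem_ofChoices (hS := hS) (hc := hc)
        (v := ⟨_, hv⟩) hmem
      refine ⟨_, hmem', ?_⟩
      simp only [code]
      rw [← (decodeStep_eq (Nat.mod_lt _ (numSteps_pos P T)) _).1 hd, Nat.div_add_mod]
    · rintro ⟨⟨v, p₁, p₂, s⟩, hmem, rfl⟩
      refine ⟨hlt _, ?_⟩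
      rw [hdec, hdiv]
      exact (Schedule.mem_ofChoices (hc := hc)).1 hmem
  obtain ⟨C, hC, hCΓ, hlen, hget⟩ := exists_list σ.Γ hinj huses fun e he => he.1
  refine ⟨C, hC, hCΓ, fun i hi => ?_⟩
  rw [length_outputWord, hlen] at hi
  rw [hm.2 i hi, ← List.getD_eq_getElem _ 0, Inst.outEntry]
  have hA : ((List.finRange I.n).flatMap fun v => [(σ.π v : ℕ), (σ.τ v : ℕ)]).length = 2 * I.n := by
    simp [List.length_flatMap, mul_comm]
  rw [outputWord, List.cons_append]
  split_ifs with h0 h1 h2 h3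
  · rw [h0, hl]
    rfl
  · obtain ⟨i, rfl⟩ := Nat.exists_eq_succ_of_ne_zero h0
    rw [Nat.succ_sub_one] at h2 ⊢
    rw [List.getD_cons_succ, List.getD_append _ _ _ _ (by omega)]
    conv_rhs => rw [← Nat.div_add_mod i 2]
    rw [getD_flatMap (c := 2) (fun _ => rfl) _ _ _ (by simp; omega) (Nat.mod_lt _ two_pos), h2]
    simp [σ]
  · obtain ⟨i, rfl⟩ := Nat.exists_eq_succ_of_ne_zero h0
    rw [Nat.succ_sub_one] at h2 ⊢
    rw [List.getD_cons_succ, List.getD_append _ _ _ _ (by omega)]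
    conv_rhs => rw [← Nat.div_add_mod i 2]
    rw [getD_flatMap (c := 2) (fun _ => rfl) _ _ _ (by simp; omega) (Nat.mod_lt _ two_pos),
      Nat.mod_two_ne_zero.1 h2]
    simp [σ]
  · rw [h3, List.getD_cons_succ, List.getD_append_right _ _ _ _ (by omega), hA, Nat.sub_self,
      List.getD_cons_zero, hlen]
    rfl
  · obtain ⟨q, rfl⟩ : ∃ q, i = 2 * I.n + q + 1 + 1 := ⟨i - (2 * I.n + 2), by omega⟩
    have hq : q / 4 < C.length := by rw [hlen]; omega
    have h4 : 2 * I.n + q + 1 + 1 - (2 * I.n + 2) = q := by omega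
    have h5 : 2 * I.n + q + 1 - 2 * I.n = q + 1 := by omega
    rw [h4, List.getD_cons_succ, List.getD_append_right _ _ _ _ (by omega), hA, h5,
      List.getD_cons_succ]
    conv_rhs => rw [← Nat.div_add_mod q 4]
    rw [getD_flatMap (c := 4) (fun _ => rfl) _ _ _ hq (Nat.mod_lt _ four_pos), Inst.commEntry,
      ← hget _ hq, hdiv, hdec]
    have := Nat.mod_lt q four_pos
    interval_cases q % 4 <;> rfl

end solution

/-- A class of graphs for which the nodes can be ordered is solvable in polynomial time. -/
theorem solvableInPolyTime (M : CommModel) (P g L t₀ : ℕ) (hP : 1 ≤ P)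
    (𝒞 : ∀ n : ℕ, Digraph (Fin n) → Prop) (h𝒞 : ∀ n G, 𝒞 n G →
      ChainOrder G n t₀ (fun v : Fin n => nodeRank t₀ G v) (contAt t₀ G)) :
    SolvableInPolyTime M P g L 𝒞 := by
  have : NeZero P := ⟨by omega⟩
  -- The bound on the number of supersteps that loses no optimal cost; it depends only on `P`, `g`
  -- and `L`.
  obtain ⟨T, hT⟩ : ∃ T, T = (P + 2) * (g * (2 * P) + L + 1) + 1 := ⟨_, rfl⟩
  have : NeZero T := ⟨by omega⟩
  obtain ⟨c, f, hcf⟩ := PRun.outCtx (M := M) (P := P) (T := T) (g := g) (L := L) (t₀ := t₀)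
  refine ⟨c, f, fun n G hG E hE => ?_⟩
  obtain ⟨t, m, hr, ht, hm⟩ := hcf ⟨n, G, E, hE⟩ (initStore (inputWord n E)) fun i => rfl
  obtain ⟨hc, hopt⟩ := (h𝒞 n G hG).isOptimal_best (M := M) (P := P) (g := g) (L := L) hT.ge
    (D := Inst.decision M P T g L t₀ ⟨n, G, E, hE⟩) rfl
    (d := Inst.control M P T g L t₀ ⟨n, G, E, hE⟩) fun i => rfl
  exact ⟨t, m, _, hr, ht, outputs_ofChoices ⟨n, G, E, hE⟩ _ rfl hc hm, hopt⟩

end BSP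

/-- For every fixed number `P ≥ 1` of processors and all fixed `g` and `L`, the BSP scheduling
problem can be solved in time polynomial in the number of nodes for chain DAGs and for connected
chain DAGs, in each of the four communication models. -/
theorem mainTheorem3 (M : BSP.CommModel) (P g L : ℕ) (hP : 1 ≤ P) :
    BSP.SolvableInPolyTime M P g L (fun _ G => BSP.IsChainDAG G) ∧
      BSP.SolvableInPolyTime M P g L (fun _ G => BSP.IsConnectedChainDAG G) :=
  ⟨BSP.solvableInPolyTime M P g L 0 hP _ fun _ _ h => BSP.chainOrder_of_isChainDAG h,
    BSP.solvableInPolyTime M P g L 1 hP _ fun _ _ h => BSP.chainOrder_of_isConnectedChainDAG h⟩
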